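/- **Setting.** Let $(\Omega,\mathcal G,\mu)$ be a probability space with a group $(\tau_x)_{x\in\mathbb R}$ of measure preserving transformations acting ergodically on $\Omega$, such that $(x,\omega)\mapsto\tau_x\omega$ is measurable; $\mathbb M$ is the expectation under $\mu$ and $L^p(\Omega)$ are the real $L^p$-spaces of $\mu$, with norms $|\cdot|_p$. Let $T_x f(\omega)=f(\tau_x\omega)$ and let $D f=\lim_{h\to0}h^{-1}(T_hf-f)$ (limit in $L^2(\Omega)$) be the generator of $(T_x)$ on $L^2(\Omega)$. Let $H^k(\Omega)=\mathrm{Dom}(D^k)$ (so $H^0=L^2$), let $H^\infty(\Omega)=\bigcap_kH^k(\Omega)$, with the Fréchet topology of the seminorms $|D^kf|_2$, $k\ge0$, and let $C^\infty(\Omega)$ be the set of $f\in H^\infty(\Omega)$ with $|D^kf|_\infty<\infty$ for all $k\ge0$. Let $\mathcal C$ be the span of the functions $\omega\mapsto\int_{\mathbb R}g(\tau_x\omega)\varphi(x)\,dx$ with $g\in L^\infty(\Omega)$, $\varphi\in C_c^\infty(\mathbb R)$. Let $0<\alpha<2$ and $\nu(dz)=|z|^{-1-\alpha}dz$. Let $V,\sigma\in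 C^\infty(\Omega)$, $a=\sigma^2$, and let $c:\Omega\times\mathbb R\to\mathbb R$ be measurable, such that * $c(\tau_z\omega,-z)=c(\omega,z)$ for $\mu$-a.e. $\omega$ and a.e. $z$; * for some $K>0$, $K^{-1}\le a\le K$ and $K^{-1}\le c(\omega,z)\le K$ for a.e. $\omega$ and a.e. $z$; * for a.e. $z$, $c(\cdot,z)\in C^\infty(\Omega)$, and for every $k\ge1$ there is $C_k$ with $|D^kc(\cdot,z)|_\infty\le C_k$ for a.e. $z$. Put $(f,g)_\pi=\mathbb M[fg\,e^{-2V}]$, $|f|_\pi=(f,f)_\pi^{1/2}$. For $\varepsilon,\lambda>0$ put $$B^\varepsilon_\lambda(f,g)=\lambda(f,g)_\pi+\tfrac12(a\,Df,Dg)_\pi+\tfrac{\varepsilon^{2-\alpha}}2\,\mathbb M\int_{\mathbb R}(T_zf-f)(T_zg-g)\,c(\cdot,z)\,\nu(dz),$$ and let $\mathbb H\subset H^1(\Omega)$ be the closure of $\mathcal C$ for the norm $B^\varepsilon_\lambda(f,f)^{1/2}$. For $f\in L^2(\Omega)$ let $G^\varepsilon_\lambda f$ be the element $u\in\mathbb H$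 such that $B^\varepsilon_\lambda(u,\psi)=(f,\psi)_\pi$ for all $\psi\in\mathbb H$, and let $L^\varepsilon=\lambda-(G^\varepsilon_\lambda)^{-1}$ with domain $\mathrm{Dom}(L^\varepsilon)=G^\varepsilon_\lambda(L^2(\Omega))$. **Proposition.** Fix $\varepsilon>0$. For each $\lambda>0$ the operator $G^\varepsilon_\lambda$ is well defined (such a $u$ exists and is unique) and one-to-one, and the following holds, with $L^\varepsilon$ formed from any $\lambda>0$. 1. For each $\lambda>0$, $G^\varepsilon_\lambda$ maps $L^2(\Omega)$ into $H^2(\Omega)$, and $H^m(\Omega)$ into $H^{m+2}(\Omega)$ for every $m\ge1$. In particular $\mathrm{Dom}((L^\varepsilon)^m)=H^{2m}(\Omega)$ for every $m\ge0$. 2. $L^\varepsilon$ is densely defined and self-adjoint for $(\cdot,\cdot)_\pi$, and it is the generator of a strongly continuous semigroup $(P^\varepsilon_t)_{t\ge0}$ of operators on $L^2(\Omega)$ that are self-adjoint for $(\cdot,\cdot)_\pi$ and contractions for $|\cdot|_\pi$. For $f\in L^2(\Omega)$, the map $t\mapsto P^\varepsilon_tf$ belongs to $C([0,\infty);L^2(\Omega))\cap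 C^\infty((0,\infty);H^\infty(\Omega))$; for $f\in H^\infty(\Omega)$ it belongs to $C^\infty([0,\infty);H^\infty(\Omega))$. 3. The semigroup is sub-Markovian: if $f\in L^2(\Omega)$ and $0\le f\le1$ $\mu$-a.s., then $0\le P^\varepsilon_tf\le1$ $\mu$-a.s. for every $t\ge0$. Moreover, for every $t\ge0$ and $\lambda>0$, $P^\varepsilon_t$ and $G^\varepsilon_\lambda$ map $L^\infty(\Omega)$ into $L^\infty(\Omega)$ and are bounded operators there, with norms exactly $1$ and $1/\lambda$ respectively. -/

import Mathlib

open MeasureTheory Filter Topology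

noncomputable section

/-- The domain of the power `A ^ k` of an unbounded operator `A` with domain `dom`
(the values of `A` off `dom` play no role):
`Dom (A ^ 0)` is everything and
`Dom (A ^ (k + 1)) = {x ∈ Dom (A ^ k) | A ^ k x ∈ dom}`. -/
def powDomain {X : Type*} (dom : Set X) (A : X → X) : ℕ → Set X
  | 0 => Set.univ
  | k + 1 => {x | x ∈ powDomain dom A k ∧ A^[k] x ∈ dom}

/-- A random medium: a probability space together with a jointly measurable group
`(τ_x)`, `x ∈ ℝ`, of measure preserving transformations acting ergodically. -/
structure RandomMedium (Ω : Type*) [MeasurableSpace Ω] where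
  μ : Measure Ω
  isProbabilityMeasure : IsProbabilityMeasure μ
  τ : ℝ → Ω → Ω
  τ_zero : ∀ ω, τ 0 ω = ω
  τ_add : ∀ x y ω, τ (x + y) ω = τ x (τ y ω)
  measurePreserving : ∀ x, MeasurePreserving (τ x) μ μ
  ergodic : ∀ A, MeasurableSet A → (∀ x, τ x '' A = A) → μ A = 0 ∨ μ A = 1
  measurable_τ : Measurable fun p : ℝ × Ω => τ p.1 p.2

attribute [instance] RandomMedium.isProbabilityMeasure

namespace RandomMedium

variable {Ω : Type*} [MeasurableSpace Ω] (M : RandomMedium Ω)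

/-- The real space `L²(Ω)`. -/
abbrev L2 : Type _ := Lp ℝ 2 M.μ

/-- `T_x f (ω) = f (τ_x ω)` on `L²(Ω)`. -/
def T (x : ℝ) (f : M.L2) : M.L2 :=
  Lp.compMeasurePreserving (M.τ x) (M.measurePreserving x) f

/-- The domain of the generator `D` of the group `(T_x)`. -/
def domD : Set M.L2 :=
  {f | ∃ g : M.L2, Tendsto (fun h : ℝ => h⁻¹ • (M.T h f - f)) (𝓝[≠] 0) (𝓝 g)}

/-- The generator `D f = lim_{h → 0} h⁻¹ (T_h f - f)`, the limit being taken in `L²(Ω)`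
(meaningful for `f ∈ domD`). -/
def D (f : M.L2) : M.L2 :=
  limUnder (𝓝[≠] (0 : ℝ)) (fun h : ℝ => h⁻¹ • (M.T h f - f))

/-- `H^k(Ω)`, the domain of `D ^ k`. -/
def H (k : ℕ) : Set M.L2 := powDomain M.domD M.D k

/-- `H^∞(Ω)`. -/
def Hinf : Set M.L2 := {f | ∀ k, f ∈ M.H k}

/-- `g` coincides almost everywhere with an element `f` of `H^k(Ω)` such that `|D^k f|_∞ ≤ C`. -/
def DerivBoundedBy (g : Ω → ℝ) (k : ℕ) (C : ℝ) : Prop :=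
  ∃ f : M.L2, f =ᵐ[M.μ] g ∧ f ∈ M.H k ∧ ∀ᵐ ω ∂M.μ, |(M.D^[k] f : M.L2) ω| ≤ C

/-- `g` belongs to `C^∞(Ω)`: it lies in `H^∞(Ω)` and `|D^k g|_∞ < ∞` for all `k ≥ 0`. -/
def MemCinf (g : Ω → ℝ) : Prop :=
  ∃ f : M.L2, f =ᵐ[M.μ] g ∧ f ∈ M.Hinf ∧
    ∀ k, ∃ C : ℝ, ∀ᵐ ω ∂M.μ, |(M.D^[k] f : M.L2) ω| ≤ C

/-- The space `𝒞`, spanned by the functions `g ⋆ φ (ω) = ∫ g (τ_x ω) φ(x) dx` with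
`g ∈ L^∞(Ω)` and `φ ∈ C_c^∞(ℝ)`. -/
def testSpace : Submodule ℝ M.L2 :=
  Submodule.span ℝ {f | ∃ (g : Ω → ℝ) (φ : ℝ → ℝ), MemLp g ⊤ M.μ ∧ ContDiff ℝ (⊤ : ℕ∞) φ ∧
    HasCompactSupport φ ∧ f =ᵐ[M.μ] fun ω => ∫ x, g (M.τ x ω) * φ x}

/-- `u ∈ C^∞(I; H^∞(Ω))`, where `H^∞(Ω)` carries its Fréchet topology, given by the seminorms
`f ↦ |D^k f|_2`, `k ≥ 0`: there are successive derivatives `v 0 = u, v 1, v 2, …` with values in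
`H^∞(Ω)`, each being the derivative on `I` of the preceding one for all these seminorms. -/
def SmoothOn (I : Set ℝ) (u : ℝ → M.L2) : Prop :=
  ∃ v : ℕ → ℝ → M.L2, (∀ t ∈ I, v 0 t = u t) ∧
    ∀ n, ∀ t ∈ I, v n t ∈ M.Hinf ∧
      ∀ k, HasDerivWithinAt (fun s => M.D^[k] (v n s)) (M.D^[k] (v (n + 1) t)) I t

/-- A strongly continuous semigroup `(P_t)`, `t ≥ 0`, of bounded operators on `L²(Ω)`
(the values `P t` for `t < 0` play no role). -/
structure IsSemigroup (P : ℝ → M.L2 →L[ℝ] M.L2) : Prop where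
  zero : ∀ f, P 0 f = f
  add : ∀ s t, 0 ≤ s → 0 ≤ t → ∀ f, P (s + t) f = P s (P t f)
  continuousOn : ∀ f, ContinuousOn (fun t => P t f) (Set.Ici 0)

end RandomMedium

/-- The measure `ν(dz) = |z|^{-1-α} dz`. -/
def levyMeasure (α : ℝ) : Measure ℝ :=
  volume.withDensity fun z => ENNReal.ofReal (1 / |z| ^ (1 + α))

/-- The coefficients `V`, `σ`, `c` and the index `α` entering the Dirichlet form, with their
symmetry, ellipticity and regularity assumptions. -/
structure Coefficients {Ω : Type*} [MeasurableSpace Ω] (M : RandomMedium Ω) where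
  α : ℝ
  α_pos : 0 < α
  α_lt : α < 2
  V : Ω → ℝ
  σ : Ω → ℝ
  c : Ω → ℝ → ℝ
  measurable_c : Measurable fun p : Ω × ℝ => c p.1 p.2
  symm : ∀ᵐ ω ∂M.μ, ∀ᵐ z : ℝ, c (M.τ z ω) (-z) = c ω z
  elliptic : ∃ K : ℝ, 0 < K ∧ (∀ᵐ ω ∂M.μ, K⁻¹ ≤ σ ω ^ 2 ∧ σ ω ^ 2 ≤ K) ∧
    ∀ᵐ ω ∂M.μ, ∀ᵐ z : ℝ, K⁻¹ ≤ c ω z ∧ c ω z ≤ K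
  smooth_V : M.MemCinf V
  smooth_σ : M.MemCinf σ
  smooth_c : ∀ᵐ z : ℝ, M.MemCinf fun ω => c ω z
  smooth_c_bound : ∀ k, 1 ≤ k → ∃ C : ℝ, ∀ᵐ z : ℝ, M.DerivBoundedBy (fun ω => c ω z) k C

namespace Coefficients

variable {Ω : Type*} [MeasurableSpace Ω] {M : RandomMedium Ω} (A : Coefficients M)

/-- `(f, g)_π = 𝕄[f g e^{-2V}]`. -/
def innerPi (f g : M.L2) : ℝ := ∫ ω, f ω * g ω * Real.exp (-2 * A.V ω) ∂M.μ

/-- `|f|_π`. -/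
def normPi (f : M.L2) : ℝ := Real.sqrt (A.innerPi f f)

/-- `B^d(f, g) = (1/2) (a Df, Dg)_π` with `a = σ²`, for `f, g ∈ Dom D`. -/
def Bd (f g : M.L2) : ℝ :=
  (1 / 2) * ∫ ω, A.σ ω ^ 2 * (M.D f) ω * (M.D g) ω * Real.exp (-2 * A.V ω) ∂M.μ

/-- `B^j(f, g) = (1/2) 𝕄 ∫ (T_z f - f)(T_z g - g) c(·, z) ν(dz)`. -/
def Bj (f g : M.L2) : ℝ :=
  (1 / 2) * ∫ ω, ∫ z, (f (M.τ z ω) - f ω) * (g (M.τ z ω) - g ω) * A.c ω z ∂(levyMeasure A.α) ∂M.μ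

/-- `B_λ^ε = λ (·, ·)_π + B^d + ε^{2 - α} B^j`, for functions in `Dom D`. -/
def B (ε lam : ℝ) (f g : M.L2) : ℝ :=
  lam * A.innerPi f g + A.Bd f g + ε ^ (2 - A.α) * A.Bj f g

/-- The space `ℍ`: the closure of `𝒞` in `Dom D` for the norm associated with `B_λ^ε`. -/
def formDomain (ε lam : ℝ) : Set M.L2 :=
  {f | f ∈ M.domD ∧ ∃ φ : ℕ → M.L2, (∀ n, φ n ∈ M.testSpace) ∧
    Tendsto (fun n => A.B ε lam (φ n - f) (φ n - f)) atTop (𝓝 0)}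

/-- `u ∈ ℍ` and `B_λ^ε(u, ψ) = (f, ψ)_π` for all `ψ ∈ ℍ`. -/
def IsResolventSolution (ε lam : ℝ) (f u : M.L2) : Prop :=
  u ∈ A.formDomain ε lam ∧ ∀ ψ ∈ A.formDomain ε lam, A.B ε lam u ψ = A.innerPi f ψ

/-- The resolvent operator `G_λ^ε`: `G_λ^ε f` is the `u ∈ ℍ` such that
`B_λ^ε(u, ψ) = (f, ψ)_π` for all `ψ ∈ ℍ`. -/
def G (ε lam : ℝ) (f : M.L2) : M.L2 :=
  Classical.epsilon fun u => A.IsResolventSolution ε lam f u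

/-- `Dom(L^ε) = G_λ^ε(L²(Ω))`. -/
def domL (ε lam : ℝ) : Set M.L2 := Set.range (A.G ε lam)

/-- `L^ε = λ - (G_λ^ε)⁻¹` (meaningful on `Dom(L^ε)`). -/
def L (ε lam : ℝ) (u : M.L2) : M.L2 := lam • u - Function.invFun (A.G ε lam) u

end Coefficients

end

/-! The setting is L²(Ω) with the strongly continuous group of isometries (T_x), whose generator D
is skew-adjoint. The form B_λ^ε is bounded and coercive on H¹ = Dom D, realized as the graph of D,
and 𝒞 is dense there. Hence ℍ is H¹ (`formDomain_eq`) and Lax–Milgram gives the resolvent.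

Regularity is obtained by difference quotients along T_x. Differentiating the form along the group
only replaces the coefficients e^{-2V}, a e^{-2V} and c(·,z) by their D-derivatives, which again
give bounded forms on H¹ (`SmoothForms`, `exists_smoothForms`). Coercivity then bounds T_x u − u in
H¹ by a multiple of |x| (`mem_H_two_of_repr`), and Du solves an equation of the same kind
(`mem_H_of_repr`). Conversely, for u ∈ H² the functional B(u, ·) is continuous for the L² norm: the
diffusion part by integration by parts, the jump part by moving the difference from the test
function onto u, at the price of a weight min(1, z²) that ν integrates. So G maps H^m onto H^{m+2},
which yields the domains of the powers of L; self-adjointness follows since G is symmetric and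
defined everywhere.

Multiplication by e^{-V} is an isometry from |·|_π to the norm of L²(μ) and turns G into a symmetric
resolvent family, from which Yosida approximation builds the semigroup (`ResolventFamily.sg`).
Smoothing for t > 0 rests on ‖P_t L v‖ ≤ t⁻¹ ‖v‖, a consequence of the monotonicity of s ↦ ⟨P_s v,
v⟩ and of its derivative (`norm_sg_gen_le`); it puts P_t f in Dom L (`sg_mem_range`), and splitting
the time gives H^∞. Derivatives in time for the seminorms of H^∞ reduce to L² derivatives because
D^k G^k is bounded.

For the Markov property, U ↦ |U| does not increase the energy, so G preserves positivity
(`G_nonneg`), and so does the Yosida semigroup, an exponential series in the resolvent with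
nonnegative coefficients. Constants are eigenvectors of G and fixed by P_t; the bounds and the exact
L^∞ norms follow. -/

noncomputable section

/-! ### The group (T_x) on L²(Ω) and its strong continuity. -/

namespace RandomMedium

variable {Ω : Type*} [MeasurableSpace Ω] (M : RandomMedium Ω)

/-- `T_x` as a linear isometry of `L²(Ω)`. -/
def Tl (x : ℝ) : M.L2 →ₗᵢ[ℝ] M.L2 :=
  Lp.compMeasurePreservingₗᵢ ℝ (M.τ x) (M.measurePreserving x)

lemma Tl_apply (x : ℝ) (f : M.L2) : M.Tl x f = M.T x f := rfl

lemma T_coeFn (x : ℝ) (f : M.L2) : M.T x f =ᵐ[M.μ] fun ω => f (M.τ x ω) :=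
  Lp.coeFn_compMeasurePreserving f (M.measurePreserving x)

lemma T_map_add (x : ℝ) (f g : M.L2) : M.T x (f + g) = M.T x f + M.T x g := (M.Tl x).map_add f g
lemma T_map_sub (x : ℝ) (f g : M.L2) : M.T x (f - g) = M.T x f - M.T x g := (M.Tl x).map_sub f g
lemma T_map_smul (x c : ℝ) (f : M.L2) : M.T x (c • f) = c • M.T x f := (M.Tl x).map_smul c f
lemma norm_T (x : ℝ) (f : M.L2) : ‖M.T x f‖ = ‖f‖ := (M.Tl x).norm_map f
lemma inner_T (x : ℝ) (f g : M.L2) : inner ℝ (M.T x f) (M.T x g) = inner ℝ f g :=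
  (M.Tl x).inner_map_map f g

lemma ae_τ {p : Ω → Prop} (x : ℝ) (h : ∀ᵐ ω ∂M.μ, p ω) : ∀ᵐ ω ∂M.μ, p (M.τ x ω) :=
  (M.measurePreserving x).quasiMeasurePreserving.ae h

lemma T_zero (f : M.L2) : M.T 0 f = f := by
  apply Lp.ext
  filter_upwards [M.T_coeFn 0 f] with ω h
  rw [h, M.τ_zero]

lemma T_add (x y : ℝ) (f : M.L2) : M.T (x + y) f = M.T x (M.T y f) := by
  apply Lp.ext
  filter_upwards [M.T_coeFn (x + y) f, M.T_coeFn x (M.T y f), M.ae_τ x (M.T_coeFn y f)]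
    with ω h1 h2 h3
  rw [h1, h2, h3, add_comm, M.τ_add]

lemma T_comm (x y : ℝ) (f : M.L2) : M.T x (M.T y f) = M.T y (M.T x f) := by
  rw [← T_add, ← T_add, add_comm]

lemma T_neg_T (x : ℝ) (f : M.L2) : M.T (-x) (M.T x f) = f := by
  rw [← T_add, neg_add_cancel, T_zero]

lemma T_T_neg (x : ℝ) (f : M.L2) : M.T x (M.T (-x) f) = f := by
  rw [← T_add, add_neg_cancel, T_zero]

lemma inner_T_left (x : ℝ) (f g : M.L2) :
    inner ℝ (M.T x f) g = inner ℝ f (M.T (-x) g) := by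
  rw [← M.inner_T (-x), T_neg_T]

/-- By invariance of μ the measure is an average over x ∈ [0, 1], that is, the expectation of the
Lebesgue measure of the times x at which the orbit of ω is in the set. For fixed ω this is bounded
by the symmetric difference of a subset of ℝ and its translate by h, which tends to 0 by continuity
of translations on ℝ; dominated convergence concludes. -/
lemma tendsto_measure_symmDiff_orbit {A : Set Ω} (hA : MeasurableSet A) :
    Tendsto (fun h => M.μ (symmDiff (M.τ h ⁻¹' A) A)) (𝓝 0) (𝓝 0) := by
  classical
  have hτx : ∀ x, Measurable (M.τ x) := fun x => (M.measurePreserving x).measurable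
  have hS : ∀ h, MeasurableSet (symmDiff (M.τ h ⁻¹' A) A) := fun h =>
    ((hτx h hA).symmDiff hA)
  let Φ : ℝ → Ω → ENNReal := fun h ω =>
    ∫⁻ x in Set.Icc (0:ℝ) 1, (symmDiff (M.τ h ⁻¹' A) A).indicator 1 (M.τ x ω)
  have hjm : ∀ h, Measurable fun p : Ω × ℝ =>
      (symmDiff (M.τ h ⁻¹' A) A).indicator (1 : Ω → ENNReal) (M.τ p.2 p.1) := fun h =>
    (measurable_one.indicator (hS h)).comp (M.measurable_τ.comp measurable_swap)
  have key : ∀ h, M.μ (symmDiff (M.τ h ⁻¹' A) A) = ∫⁻ ω, Φ h ω ∂M.μ := by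
    intro h
    rw [lintegral_lintegral_swap (hjm h).aemeasurable]
    have : ∀ x, ∫⁻ ω, (symmDiff (M.τ h ⁻¹' A) A).indicator (1 : Ω → ENNReal) (M.τ x ω) ∂M.μ =
        M.μ (symmDiff (M.τ h ⁻¹' A) A) := by
      intro x
      rw [(M.measurePreserving x).lintegral_comp (measurable_one.indicator (hS h)),
        lintegral_indicator_one (hS h)]
    simp [this]
  simp_rw [key]
  rw [show (0 : ENNReal) = ∫⁻ ω, (0:ENNReal) ∂M.μ by simp]
  refine tendsto_lintegral_filter_of_dominated_convergence (fun _ => 1) ?_ ?_ (by simp) ?_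
  · exact Eventually.of_forall fun h => (hjm h).lintegral_prod_right'
  · refine Eventually.of_forall fun h => Eventually.of_forall fun ω => ?_
    calc Φ h ω ≤ ∫⁻ x in Set.Icc (0:ℝ) 1, 1 :=
          lintegral_mono fun x => Set.indicator_le_self' (by simp) _ |>.trans (by simp)
      _ = 1 := by simp
  · refine Eventually.of_forall fun ω => ?_
    -- The window [-1, 2] gives `B` finite measure and contains both x and h + x when x ∈ [0, 1] and
    -- |h| < 1.
    let B : Set ℝ := {x | M.τ x ω ∈ A} ∩ Set.Icc (-1) 2
    have hτω : Measurable fun x => M.τ x ω := M.measurable_τ.comp measurable_prodMk_right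
    have hB : MeasurableSet B := (hτω hA).inter measurableSet_Icc
    have hBfin : volume B ≠ ⊤ :=
      ne_top_of_le_ne_top (by simp) (measure_mono (Set.inter_subset_right))
    let f : ℝ → C(ℝ, ℝ) := fun h => ⟨fun x => h + x, by fun_prop⟩
    have hf : Continuous f := ContinuousMap.continuous_of_continuous_uncurry _ (by
      change Continuous fun p : ℝ × ℝ => p.1 + p.2; fun_prop)
    have ht := tendsto_measure_symmDiff_preimage_nhds_zero (μ := volume) (ν := volume)
      (hf.tendsto 0) (Eventually.of_forall fun h => measurePreserving_add_left volume h)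
      (measurePreserving_add_left volume (0:ℝ)) hB.nullMeasurableSet hBfin
    refine tendsto_of_tendsto_of_tendsto_of_le_of_le' tendsto_const_nhds ht
      (Eventually.of_forall fun h => zero_le) ?_
    filter_upwards [Ioo_mem_nhds (show (-1:ℝ) < 0 by norm_num) (show (0:ℝ) < 1 by norm_num)]
      with h hh
    have hm : MeasurableSet (symmDiff (f h ⁻¹' B) (f 0 ⁻¹' B)) :=
      ((f h).continuous.measurable hB).symmDiff ((f 0).continuous.measurable hB)
    rw [← lintegral_indicator_one hm]
    simp only [Φ]
    rw [← lintegral_indicator measurableSet_Icc]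
    refine lintegral_mono fun x => ?_
    by_cases hx : x ∈ Set.Icc (0:ℝ) 1
    · rw [Set.indicator_of_mem hx]
      by_cases hx2 : M.τ x ω ∈ symmDiff (M.τ h ⁻¹' A) A
      · suffices hx3 : x ∈ symmDiff (f h ⁻¹' B) (f 0 ⁻¹' B) by
          rw [Set.indicator_of_mem hx2, Set.indicator_of_mem hx3]; rfl
        simp only [Set.mem_symmDiff, Set.mem_preimage, ← M.τ_add] at hx2
        simp only [Set.mem_symmDiff, Set.mem_preimage, f, B, ContinuousMap.coe_mk,
          Set.mem_inter_iff, Set.mem_ofPred_eq, zero_add]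
        have h1 : h + x ∈ Set.Icc (-1:ℝ) 2 := ⟨by linarith [hh.1, hx.1], by linarith [hh.2, hx.2]⟩
        have h2 : x ∈ Set.Icc (-1:ℝ) 2 := ⟨by linarith [hx.1], by linarith [hx.2]⟩
        tauto
      · rw [Set.indicator_of_notMem hx2]; exact zero_le
    · rw [Set.indicator_of_notMem hx]; exact zero_le

lemma tendsto_T_zero (f : M.L2) : Tendsto (fun h => M.T h f) (𝓝 0) (𝓝 f) := by
  have h2 : (2 : ENNReal) ≠ ⊤ := by norm_num
  refine Lp.induction h2 (fun f : M.L2 => Tendsto (fun h => M.T h f) (𝓝 0) (𝓝 f)) ?_ ?_ ?_ f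
  · intro c s hs hμs
    exact tendsto_indicatorConstLp_set (s := s) (t := fun h => M.τ h ⁻¹' s) (hs := hs)
      (hμs := hμs.ne) (ht := fun h => (M.measurePreserving h).measurable hs)
      (hμt := fun h => measure_ne_top _ _) h2 (M.tendsto_measure_symmDiff_orbit hs)
  · intro f g hf hg _ h1 h2
    simp_rw [T_map_add]
    exact h1.add h2
  · refine isClosed_of_closure_subset fun f hf => ?_
    rw [Set.mem_ofPred_eq, Metric.tendsto_nhds]
    intro ε hε
    obtain ⟨g, hg, hgf⟩ := Metric.mem_closure_iff.1 hf (ε / 3) (by positivity)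
    filter_upwards [Metric.tendsto_nhds.1 hg (ε / 3) (by positivity)] with h hh
    have : dist (M.T h f) (M.T h g) = dist f g := (M.Tl h).isometry.dist_eq f g
    have h1 := dist_triangle4 (M.T h f) (M.T h g) g f
    rw [dist_comm g f] at h1
    linarith

lemma continuous_T (f : M.L2) : Continuous fun x => M.T x f := by
  refine continuous_iff_continuousAt.2 fun x => ?_
  have h := (M.Tl x).continuous.continuousAt.tendsto.comp (M.tendsto_T_zero f)
  have h2 : Tendsto (fun y : ℝ => y - x) (𝓝 x) (𝓝 0) := by
    have : Continuous fun y : ℝ => y - x := by fun_prop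
    simpa using this.tendsto x
  have := h.comp h2
  refine this.congr fun y => ?_
  simp only [Function.comp, Tl_apply, ← T_add]
  congr 1; ring

end RandomMedium

/-! ### Powers of an operator, and representation of dominated functionals. -/

lemma mem_powDomain_succ {X : Type*} (dom : Set X) (A : X → X) (k : ℕ) (x : X) :
    x ∈ powDomain dom A (k + 1) ↔ x ∈ dom ∧ A x ∈ powDomain dom A k := by
  induction k with
  | zero => simp [powDomain]
  | succ k ih =>
    have h1 : x ∈ powDomain dom A (k + 1 + 1) ↔
        x ∈ powDomain dom A (k + 1) ∧ A^[k + 1] x ∈ dom := Iff.rfl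
    have h2 : A x ∈ powDomain dom A (k + 1) ↔
        A x ∈ powDomain dom A k ∧ A^[k] (A x) ∈ dom := Iff.rfl
    rw [h1, h2, ih, Function.iterate_succ_apply, and_assoc]

/-- A linear functional dominated by the norm of `j x` is represented by a vector. -/
lemma exists_inner_eq_of_bound {E X : Type*} [NormedAddCommGroup E] [InnerProductSpace ℝ E]
    [CompleteSpace E] [AddCommGroup X] [Module ℝ X] (j : X →ₗ[ℝ] E) (φ : X →ₗ[ℝ] ℝ) (C : ℝ)
    (h : ∀ x, |φ x| ≤ C * ‖j x‖) : ∃ w : E, ∀ x, φ x = inner ℝ w (j x) := by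
  have hker : LinearMap.ker j.rangeRestrict ≤ LinearMap.ker φ := by
    intro x hx
    have hx' : j x = 0 := by simpa using congrArg Subtype.val hx
    have := h x
    rw [hx', norm_zero, mul_zero] at this
    exact abs_nonpos_iff.1 this
  obtain ⟨s, hs⟩ := j.rangeRestrict.exists_rightInverse_of_surjective
    (LinearMap.range_rangeRestrict j)
  have hs' : ∀ y, j (s y) = y := fun y => congrArg Subtype.val (LinearMap.congr_fun hs y)
  let ψ : LinearMap.range j →L[ℝ] ℝ := (φ.comp s).mkContinuous C fun y => by
    have := h (s y)
    rw [hs'] at this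
    exact this
  -- The range of `j` is neither assumed closed nor dense: Hahn–Banach extends the functional before
  -- Riesz is applied.
  obtain ⟨g, hg, -⟩ := exists_extension_norm_eq (LinearMap.range j) ψ
  refine ⟨(InnerProductSpace.toDual ℝ E).symm g, fun x => ?_⟩
  rw [InnerProductSpace.toDual_symm_apply, hg ⟨j x, LinearMap.mem_range_self j x⟩]
  have h1 : x - s ⟨j x, LinearMap.mem_range_self j x⟩ ∈ LinearMap.ker j.rangeRestrict := by
    rw [LinearMap.mem_ker]
    apply Subtype.ext
    simp [hs']
  have h2 := hker h1
  rw [LinearMap.mem_ker, map_sub, sub_eq_zero] at h2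
  exact h2

/-! ### Calculus of the generator D: mollification, weak derivatives, difference quotients. -/

namespace RandomMedium

variable {Ω : Type*} [MeasurableSpace Ω] {M : RandomMedium Ω}

/-- `f ∈ Dom D` and `D f = g`. -/
def HasD (f g : M.L2) : Prop := HasDerivAt (fun h : ℝ => M.T h f) g 0

lemma hasD_iff {f g : M.L2} :
    M.HasD f g ↔ Tendsto (fun h : ℝ => h⁻¹ • (M.T h f - f)) (𝓝[≠] 0) (𝓝 g) := by
  rw [HasD, hasDerivAt_iff_tendsto_slope_zero]
  simp [T_zero]

lemma mem_domD {f : M.L2} : f ∈ M.domD ↔ ∃ g, M.HasD f g := by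
  simp only [hasD_iff]; rfl

lemma HasD.mem {f g : M.L2} (h : M.HasD f g) : f ∈ M.domD := mem_domD.2 ⟨g, h⟩

lemma HasD.D_eq {f g : M.L2} (h : M.HasD f g) : M.D f = g := (hasD_iff.1 h).limUnder_eq

lemma hasD_of_mem {f : M.L2} (h : f ∈ M.domD) : M.HasD f (M.D f) := by
  obtain ⟨g, hg⟩ := mem_domD.1 h
  rwa [hg.D_eq]

lemma HasD.unique {f g g' : M.L2} (h : M.HasD f g) (h' : M.HasD f g') : g = g' :=
  HasDerivAt.unique h h'

lemma HasD.add {f g f' g' : M.L2} (h : M.HasD f g) (h' : M.HasD f' g') :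
    M.HasD (f + f') (g + g') := by
  unfold HasD; simp_rw [T_map_add]; exact HasDerivAt.add h h'

lemma HasD.sub {f g f' g' : M.L2} (h : M.HasD f g) (h' : M.HasD f' g') :
    M.HasD (f - f') (g - g') := by
  unfold HasD; simp_rw [T_map_sub]; exact HasDerivAt.sub h h'

lemma HasD.smul {f g : M.L2} (c : ℝ) (h : M.HasD f g) : M.HasD (c • f) (c • g) := by
  unfold HasD; simp_rw [T_map_smul]; exact HasDerivAt.const_smul c h

lemma hasD_zero : M.HasD (0 : M.L2) 0 := by
  have : ∀ x, M.T x (0 : M.L2) = 0 := fun x => (M.Tl x).map_zero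
  unfold HasD; simp_rw [this]; exact hasDerivAt_const _ _

lemma HasD.T {f g : M.L2} (h : M.HasD f g) (x : ℝ) : M.HasD (M.T x f) (M.T x g) := by
  unfold HasD
  simp_rw [fun h => M.T_comm h x f]
  exact (M.Tl x).toContinuousLinearMap.hasFDerivAt.comp_hasDerivAt (0 : ℝ) h

lemma HasD.hasDerivAt {f g : M.L2} (h : M.HasD f g) (x : ℝ) :
    HasDerivAt (fun y => M.T y f) (M.T x g) x := by
  have h1 : HasDerivAt (fun y : ℝ => y - x) 1 x := (hasDerivAt_id x).sub_const x
  have h2 : HasDerivAt (fun h : ℝ => M.T h (M.T x f)) (M.T x g) (x - x) := by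
    rw [sub_self]; exact h.T x
  have h3 := HasDerivAt.scomp (𝕜 := ℝ) (𝕜' := ℝ) (h := fun y => y - x) x h2 h1
  rw [one_smul] at h3
  refine h3.congr_of_eventuallyEq (Eventually.of_forall fun y => ?_)
  simp only [Function.comp, ← T_add, sub_add_cancel]

lemma HasD.norm_T_sub_le {f g : M.L2} (h : M.HasD f g) (x : ℝ) :
    ‖M.T x f - f‖ ≤ ‖g‖ * |x| := by
  have := (convex_univ : Convex ℝ (Set.univ : Set ℝ)).norm_image_sub_le_of_norm_hasDerivWithin_le
    (f := fun y => M.T y f) (f' := fun y => M.T y g) (C := ‖g‖) (x := 0) (y := x)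
    (fun y _ => (h.hasDerivAt y).hasDerivWithinAt) (fun y _ => (M.norm_T y g).le)
    (Set.mem_univ _) (Set.mem_univ _)
  simpa [T_zero] using this

lemma HasD.inner_skew {f g f' g' : M.L2} (h : M.HasD f g) (h' : M.HasD f' g') :
    inner ℝ f g' = - inner ℝ g f' := by
  have h1 : HasDerivAt (fun y => inner ℝ (M.T y f) (M.T y f'))
    (inner ℝ (M.T 0 f) g' + inner ℝ g (M.T 0 f')) 0 := HasDerivAt.inner ℝ h h'
  simp_rw [inner_T, T_zero] at h1
  have := h1.unique (hasDerivAt_const (0 : ℝ) _)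
  linarith

/-- `∫_0^h T_s f ds`. -/
def orbitInt (h : ℝ) (f : M.L2) : M.L2 := ∫ s in (0:ℝ)..h, M.T s f

lemma hasDerivAt_orbitInt (f : M.L2) (x : ℝ) :
    HasDerivAt (fun h => M.orbitInt h f) (M.T x f) x :=
  intervalIntegral.integral_hasDerivAt_right ((M.continuous_T f).intervalIntegrable _ _)
    ((M.continuous_T f).stronglyMeasurableAtFilter _ _) (M.continuous_T f).continuousAt

lemma T_orbitInt (x h : ℝ) (f : M.L2) :
    M.T x (M.orbitInt h f) = M.orbitInt (x + h) f - M.orbitInt x f := by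
  have hi : ∀ a b, IntervalIntegrable (fun s => M.T s f) volume a b := fun a b =>
    (M.continuous_T f).intervalIntegrable a b
  have h1 : M.T x (M.orbitInt h f) = ∫ s in (0:ℝ)..h, M.T x (M.T s f) :=
    ((M.Tl x).toContinuousLinearMap.intervalIntegral_comp_comm (hi 0 h)).symm
  rw [h1]
  simp_rw [← T_add]
  rw [intervalIntegral.integral_comp_add_left (fun s => M.T s f), add_zero]
  exact (intervalIntegral.integral_interval_sub_left (hi _ _) (hi _ _)).symm

lemma hasD_orbitInt (h : ℝ) (f : M.L2) : M.HasD (M.orbitInt h f) (M.T h f - f) := by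
  unfold HasD
  simp_rw [T_orbitInt]
  have h1 : HasDerivAt (fun x => M.orbitInt (x + h) f) (M.T h f) 0 := by
    have := M.hasDerivAt_orbitInt f (0 + h)
    rw [zero_add] at this
    exact HasDerivAt.comp_add_const 0 h (by rwa [zero_add])
  have h2 := M.hasDerivAt_orbitInt f 0
  rw [T_zero] at h2
  exact h1.sub h2

lemma HasD.sub_eq_orbitInt {f g : M.L2} (h : M.HasD f g) (x : ℝ) :
    M.T x f - f = M.orbitInt x g := by
  have := intervalIntegral.integral_eq_sub_of_hasDerivAt (a := 0) (b := x)
    (fun y _ => h.hasDerivAt y) ((M.continuous_T g).intervalIntegrable _ _)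
  rw [T_zero] at this
  exact this.symm

lemma HasD.orbitInt {f g : M.L2} (h : M.HasD f g) (x : ℝ) :
    M.HasD (M.orbitInt x f) (M.orbitInt x g) := by
  rw [← h.sub_eq_orbitInt]; exact hasD_orbitInt x f

/-- Mean value of `T_s f` over an interval of length `1 / (n + 1)`. -/
def moll (n : ℕ) (f : M.L2) : M.L2 := ((n : ℝ) + 1) • M.orbitInt (((n : ℝ) + 1)⁻¹) f

lemma tendsto_moll (f : M.L2) : Tendsto (fun n => M.moll n f) atTop (𝓝 f) := by
  have h := M.hasDerivAt_orbitInt f 0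
  rw [hasDerivAt_iff_tendsto_slope_zero, T_zero] at h
  have h0 : Tendsto (fun n : ℕ => ((n : ℝ) + 1)⁻¹) atTop (𝓝[≠] 0) := by
    refine tendsto_nhdsWithin_iff.2 ⟨?_, Eventually.of_forall fun n => ?_⟩
    · simpa using tendsto_one_div_add_atTop_nhds_zero_nat (𝕜 := ℝ)
    · exact (by positivity : ((n : ℝ) + 1)⁻¹ ≠ 0)
  refine (h.comp h0).congr fun n => ?_
  simp [moll, RandomMedium.orbitInt]

lemma HasD.moll {f g : M.L2} (h : M.HasD f g) (n : ℕ) : M.HasD (M.moll n f) (M.moll n g) :=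
  (h.orbitInt _).smul _

lemma hasD_moll (n : ℕ) (f : M.L2) : ∃ g, M.HasD (M.moll n f) g :=
  ⟨_, (hasD_orbitInt _ f).smul _⟩

/-- `moll` gains one derivative and keeps those already present, so two mollifications suffice. -/
lemma dense_domD2 : Dense {f : M.L2 | ∃ g k, M.HasD f g ∧ M.HasD g k} := by
  intro f
  have h1 : Dense {f : M.L2 | ∃ g, M.HasD f g} := fun f =>
    mem_closure_of_tendsto (M.tendsto_moll f) (Eventually.of_forall fun n => hasD_moll n f)
  refine closure_minimal ?_ isClosed_closure (h1 f)
  rintro f ⟨g, hg⟩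
  refine mem_closure_of_tendsto (M.tendsto_moll f) (Eventually.of_forall fun n => ?_)
  obtain ⟨k, hk⟩ := hasD_moll n g
  exact ⟨_, k, hg.moll n, hk⟩

/-- Paired with such a ψ, T_y v − v − ∫₀^y T_s w ds has zero derivative in y. The orbit of v is
therefore a primitive of that of w, hence differentiable. Testing on H² is enough, which matters
because the forms below are differentiated only against H² functions. -/
lemma hasD_of_weak {v w : M.L2}
    (h : ∀ ψ ψ' ψ'' : M.L2, M.HasD ψ ψ' → M.HasD ψ' ψ'' → inner ℝ v ψ' = - inner ℝ w ψ) :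
    M.HasD v w := by
  have key : ∀ x, M.T x v = v + M.orbitInt x w := by
    intro x
    refine dense_domD2.eq_of_inner_left (𝕜 := ℝ) ?_
    rintro ψ ⟨ψ', ψ'', h1, h2⟩
    have hd : ∀ y, HasDerivAt
        (fun y => inner ℝ (M.T y v) ψ - inner ℝ (v + M.orbitInt y w) ψ) 0 y := by
      intro y
      have hA : HasDerivAt (fun y => inner ℝ (M.T y v) ψ) (inner ℝ (M.T y w) ψ) y := by
        simp_rw [inner_T_left]
        have e1 : HasDerivAt (fun y => M.T (-y) ψ) (-(M.T (-y) ψ')) y := by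
          have := HasDerivAt.scomp (𝕜 := ℝ) (𝕜' := ℝ) (h := fun y => -y) y
            (h1.hasDerivAt (-y)) (hasDerivAt_neg y)
          rw [neg_one_smul] at this
          exact this
        have e2 := (hasDerivAt_const y v).inner ℝ e1
        rw [inner_zero_left, add_zero, inner_neg_right,
          h _ _ _ (h1.T (-y)) (h2.T (-y)), neg_neg] at e2
        exact e2
      have hB : HasDerivAt (fun y => inner ℝ (v + M.orbitInt y w) ψ) (inner ℝ (M.T y w) ψ) y := by
        have := ((M.hasDerivAt_orbitInt w y).const_add v).inner ℝ (hasDerivAt_const y ψ)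
        simpa using this
      have := hA.sub hB
      rw [sub_self] at this
      exact this
    have := is_const_of_deriv_eq_zero (fun y => (hd y).differentiableAt)
      (fun y => (hd y).deriv) x 0
    simp only [T_zero, RandomMedium.orbitInt, intervalIntegral.integral_same, add_zero, sub_self] at this
    exact sub_eq_zero.1 this
  unfold HasD
  simp_rw [key]
  have := (M.hasDerivAt_orbitInt w 0).const_add v
  rwa [T_zero] at this

lemma hasD_of_tendsto {f g : M.L2} {ι : Type*} {l : Filter ι} [l.NeBot] {u v : ι → M.L2}
    (h : ∀ i, M.HasD (u i) (v i)) (hu : Tendsto u l (𝓝 f)) (hv : Tendsto v l (𝓝 g)) :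
    M.HasD f g := by
  refine hasD_of_weak fun ψ ψ' ψ'' h1 _ => ?_
  refine tendsto_nhds_unique (hu.inner tendsto_const_nhds) ?_
  refine ((hv.inner tendsto_const_nhds).neg).congr fun i => ?_
  rw [(h i).inner_skew h1]

/-- By duality the bound becomes |⟨v, Dψ⟩| ≤ C‖ψ‖ on Dom D. A vector w represents this functional,
and the weak characterization gives Dv = −w. This is what turns difference quotient estimates into
regularity. -/
lemma domD_eq_of_bounded_quotient {v : M.L2} {C : ℝ} (h : ∀ x, ‖M.T x v - v‖ ≤ C * |x|) :
    v ∈ M.domD := by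
  let S : Submodule ℝ (M.L2 × M.L2) :=
    { carrier := {p | M.HasD p.1 p.2}
      add_mem' := fun ha hb => HasD.add ha hb
      zero_mem' := hasD_zero
      smul_mem' := fun c _ hx => HasD.smul c hx }
  let j : S →ₗ[ℝ] M.L2 := (LinearMap.fst ℝ M.L2 M.L2).comp S.subtype
  let φ : S →ₗ[ℝ] ℝ := (innerₛₗ ℝ v).comp ((LinearMap.snd ℝ M.L2 M.L2).comp S.subtype)
  have hφ : ∀ x : S, |φ x| ≤ C * ‖j x‖ := by
    rintro ⟨⟨ψ, ψ'⟩, hψ⟩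
    change |inner ℝ v ψ'| ≤ C * ‖ψ‖
    have ht := (hasD_iff.1 hψ)
    have ht2 := ((tendsto_const_nhds (x := v)).inner ht (𝕜 := ℝ)).abs
    refine le_of_tendsto ht2 ?_
    filter_upwards [self_mem_nhdsWithin] with x hx
    have hx0 : 0 < |x| := abs_pos.2 hx
    have e : inner ℝ v (M.T x ψ - ψ) = inner ℝ (M.T (-x) v - v) ψ := by
      rw [inner_sub_right, inner_sub_left, inner_T_left, neg_neg]
    rw [inner_smul_right, e, abs_mul, abs_inv, inv_mul_le_iff₀ hx0]
    calc |inner ℝ (M.T (-x) v - v) ψ| ≤ ‖M.T (-x) v - v‖ * ‖ψ‖ := abs_real_inner_le_norm _ _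
      _ ≤ (C * |x|) * ‖ψ‖ := by
          gcongr
          simpa using h (-x)
      _ = |x| * (C * ‖ψ‖) := by ring
  obtain ⟨w, hw⟩ := exists_inner_eq_of_bound j φ C hφ
  have : M.HasD v (-w) := hasD_of_weak fun ψ ψ' _ h1 _ => by
    have := hw ⟨(ψ, ψ'), h1⟩
    rw [inner_neg_left, neg_neg]
    exact this
  exact this.mem

lemma mem_H_zero (f : M.L2) : f ∈ M.H 0 := Set.mem_univ f

lemma mem_H_succ {k : ℕ} {f : M.L2} :
    f ∈ M.H (k + 1) ↔ ∃ g, M.HasD f g ∧ g ∈ M.H k := by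
  unfold H
  rw [mem_powDomain_succ]
  constructor
  · rintro ⟨h1, h2⟩
    exact ⟨_, hasD_of_mem h1, h2⟩
  · rintro ⟨g, h1, h2⟩
    exact ⟨h1.mem, by rwa [h1.D_eq]⟩

lemma HasD.mem_H {k : ℕ} {f g : M.L2} (h : M.HasD f g) (hg : g ∈ M.H k) : f ∈ M.H (k + 1) :=
  mem_H_succ.2 ⟨g, h, hg⟩

lemma H_succ_subset (k : ℕ) : M.H (k + 1) ⊆ M.H k := fun _ h => h.1

lemma H_antitone : Antitone M.H := antitone_nat_of_succ_le H_succ_subset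

lemma HasD.mem_H_of {k : ℕ} {f g : M.L2} (h : M.HasD f g) (hf : f ∈ M.H (k + 1)) : g ∈ M.H k := by
  obtain ⟨g', h1, h2⟩ := mem_H_succ.1 hf
  rwa [h.unique h1]

lemma H_add {k : ℕ} {f g : M.L2} (hf : f ∈ M.H k) (hg : g ∈ M.H k) : f + g ∈ M.H k := by
  induction k generalizing f g with
  | zero => exact mem_H_zero _
  | succ k ih =>
    obtain ⟨f', h1, h2⟩ := mem_H_succ.1 hf
    obtain ⟨g', h3, h4⟩ := mem_H_succ.1 hg
    exact (h1.add h3).mem_H (ih h2 h4)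

lemma H_smul {k : ℕ} {f : M.L2} (c : ℝ) (hf : f ∈ M.H k) : c • f ∈ M.H k := by
  induction k generalizing f with
  | zero => exact mem_H_zero _
  | succ k ih =>
    obtain ⟨f', h1, h2⟩ := mem_H_succ.1 hf
    exact (h1.smul c).mem_H (ih h2)

lemma H_sub {k : ℕ} {f g : M.L2} (hf : f ∈ M.H k) (hg : g ∈ M.H k) : f - g ∈ M.H k := by
  rw [sub_eq_add_neg, ← neg_one_smul ℝ g]
  exact H_add hf (H_smul _ hg)

lemma dense_H_two : Dense (M.H 2) := by
  refine dense_domD2.mono ?_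
  rintro f ⟨g, k, h1, h2⟩
  exact h1.mem_H (h2.mem_H (mem_H_zero k))

lemma iterate_D_hasD {f : M.L2} (hf : f ∈ M.Hinf) (k : ℕ) :
    M.HasD (M.D^[k] f) (M.D^[k + 1] f) := by
  have : M.D^[k] f ∈ M.domD := (hf (k + 1)).2
  rw [Function.iterate_succ_apply']
  exact hasD_of_mem this

end RandomMedium

/-! ### Bounded functions, multiplication operators and C^∞(Ω). -/

namespace RandomMedium

variable {Ω : Type*} [MeasurableSpace Ω] {M : RandomMedium Ω}

/-- `|f|_∞ ≤ C`. -/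
def BddBy (f : M.L2) (C : ℝ) : Prop := ∀ᵐ ω ∂M.μ, |f ω| ≤ C

lemma BddBy.nonneg {f : M.L2} {C : ℝ} (h : M.BddBy f C) : 0 ≤ C := by
  obtain ⟨ω, hω⟩ := h.exists
  exact (abs_nonneg _).trans hω

lemma BddBy.mono {f : M.L2} {C C' : ℝ} (h : M.BddBy f C) (hC : C ≤ C') : M.BddBy f C' :=
  Eventually.mono h fun _ hx => hx.trans hC

lemma BddBy.norm_le {f : M.L2} {C : ℝ} (h : M.BddBy f C) : ‖f‖ ≤ C := by
  have := Lp.norm_le_of_ae_bound (f := f) h.nonneg h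
  simpa [measureUnivNNReal] using this

lemma BddBy.add {f g : M.L2} {C C' : ℝ} (h : M.BddBy f C) (h' : M.BddBy g C') :
    M.BddBy (f + g) (C + C') := by
  filter_upwards [h, h', Lp.coeFn_add f g] with ω h1 h2 h3
  rw [h3, Pi.add_apply]
  exact (abs_add_le _ _).trans (add_le_add h1 h2)

lemma BddBy.smul {f : M.L2} {C : ℝ} (c : ℝ) (h : M.BddBy f C) :
    M.BddBy (c • f) (|c| * C) := by
  filter_upwards [h, Lp.coeFn_smul c f] with ω h1 h3
  rw [h3, Pi.smul_apply, smul_eq_mul, abs_mul]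
  gcongr

lemma BddBy.neg {f : M.L2} {C : ℝ} (h : M.BddBy f C) : M.BddBy (-f) C := by
  simpa using h.smul (-1)

lemma BddBy.sub {f g : M.L2} {C C' : ℝ} (h : M.BddBy f C) (h' : M.BddBy g C') :
    M.BddBy (f - g) (C + C') := by
  rw [sub_eq_add_neg]; exact h.add h'.neg

lemma BddBy.T {f : M.L2} {C : ℝ} (h : M.BddBy f C) (x : ℝ) : M.BddBy (M.T x f) C := by
  filter_upwards [M.ae_τ x h, M.T_coeFn x f] with ω h1 h2
  rwa [h2]

/-- A uniform bound is membership in an order interval between constants, which is closed in L².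
With convexity, such bounds survive averages of L²-valued curves. -/
lemma isClosed_bddBy (C : ℝ) : IsClosed {f : M.L2 | M.BddBy f C} := by
  have : {f : M.L2 | M.BddBy f C} = Set.Icc (Lp.const 2 M.μ (-C)) (Lp.const 2 M.μ C) := by
    ext f
    rw [Set.mem_ofPred_eq, Set.mem_Icc, ← Lp.coeFn_le, ← Lp.coeFn_le]
    constructor
    · intro h
      constructor
      · filter_upwards [h, Lp.coeFn_const 2 M.μ (-C)] with ω h1 h2
        rw [h2]; exact (abs_le.1 h1).1
      · filter_upwards [h, Lp.coeFn_const 2 M.μ C] with ω h1 h2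
        rw [h2]; exact (abs_le.1 h1).2
    · rintro ⟨h1, h2⟩
      filter_upwards [h1, h2, Lp.coeFn_const 2 M.μ C, Lp.coeFn_const 2 M.μ (-C)] with ω h1 h2 h3 h4
      rw [h3] at h2; rw [h4] at h1
      exact abs_le.2 ⟨h1, h2⟩
  rw [this]; exact isClosed_Icc

lemma convex_bddBy (C : ℝ) : Convex ℝ {f : M.L2 | M.BddBy f C} := by
  intro f hf g hg a b ha hb hab
  have := (BddBy.smul a hf).add (BddBy.smul b hg)
  rwa [abs_of_nonneg ha, abs_of_nonneg hb, ← add_mul, hab, one_mul] at this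

lemma bddBy_intervalIntegral {F : ℝ → M.L2} (hF : Continuous F) {C x : ℝ}
    (h : ∀ s ∈ Set.uIcc 0 x, M.BddBy (F s) C) : M.BddBy (∫ s in (0:ℝ)..x, F s) (C * |x|) := by
  rcases eq_or_ne x 0 with rfl | hx
  · simp only [intervalIntegral.integral_same, abs_zero, mul_zero]
    filter_upwards [Lp.coeFn_zero ℝ 2 M.μ] with ω h1
    rw [h1]; simp
  have hmem : (⨍ s in (0:ℝ)..x, F s) ∈ {f : M.L2 | M.BddBy f C} := by
    refine (convex_bddBy C).set_average_mem (isClosed_bddBy C) ?_ ?_ ?_ ?_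
    · rw [Real.volume_uIoc, ne_eq, ENNReal.ofReal_eq_zero, not_le, sub_zero]
      exact abs_pos.2 hx
    · rw [Real.volume_uIoc]; exact ENNReal.ofReal_ne_top
    · exact (ae_restrict_iff' measurableSet_uIoc).2
        (Eventually.of_forall fun s hs => h s (Set.uIoc_subset_uIcc hs))
    · exact (intervalIntegrable_iff.1 (hF.intervalIntegrable 0 x))
  rw [interval_average_eq, sub_zero] at hmem
  have := BddBy.smul x hmem
  rwa [smul_inv_smul₀ hx, mul_comm] at this

lemma HasD.bddBy_T_sub {p p' : M.L2} (h : M.HasD p p') {C : ℝ} (hb : M.BddBy p' C) (x : ℝ) :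
    M.BddBy (M.T x p - p) (C * |x|) := by
  rw [h.sub_eq_orbitInt]
  exact bddBy_intervalIntegral (M.continuous_T p') fun s _ => hb.T s

lemma HasD.bddBy_T_sub_sub {p p' p'' : M.L2} (h : M.HasD p p') (h' : M.HasD p' p'') {C : ℝ}
    (hb : M.BddBy p'' C) (x : ℝ) : M.BddBy (M.T x p - p - x • p') (C * |x| * |x|) := by
  have : M.T x p - p - x • p' = ∫ s in (0:ℝ)..x, (M.T s p' - p') := by
    rw [h.sub_eq_orbitInt, intervalIntegral.integral_sub
      ((M.continuous_T p').intervalIntegrable _ _) (continuous_const.intervalIntegrable _ _),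
      intervalIntegral.integral_const, sub_zero]
    rfl
  rw [this]
  refine bddBy_intervalIntegral ((M.continuous_T p').sub continuous_const) fun s hs => ?_
  refine (h'.bddBy_T_sub hb s).mono ?_
  have hC := hb.nonneg
  gcongr ?_ * ?_
  have := Set.abs_sub_left_of_mem_uIcc hs
  simpa using this

/-- Serves for e^V, whose increments are controlled pointwise. -/
lemma hasD_of_bddBy {p p' : M.L2} {C δ : ℝ} (hδ : 0 < δ)
    (h : ∀ x, |x| < δ → M.BddBy (M.T x p - p - x • p') (C * |x| * |x|)) : M.HasD p p' := by
  rw [hasD_iff, tendsto_iff_norm_sub_tendsto_zero]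
  have h0 : Tendsto (fun x : ℝ => C * |x|) (𝓝[≠] 0) (𝓝 0) := by
    have : Continuous fun x : ℝ => C * |x| := by fun_prop
    simpa using (this.tendsto 0).mono_left nhdsWithin_le_nhds
  refine squeeze_zero' (Eventually.of_forall fun _ => norm_nonneg _) ?_ h0
  have hnh : ∀ᶠ x : ℝ in 𝓝[≠] 0, |x| < δ := by
    refine nhdsWithin_le_nhds ?_
    filter_upwards [Metric.ball_mem_nhds (0:ℝ) hδ] with x hx
    simpa using hx
  filter_upwards [hnh, self_mem_nhdsWithin] with x hx hx0
  have hx0' : 0 < |x| := abs_pos.2 hx0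
  have e : x⁻¹ • (M.T x p - p) - p' = x⁻¹ • (M.T x p - p - x • p') := by
    rw [smul_sub _ _ (x • p'), inv_smul_smul₀ hx0]
  rw [e, norm_smul, norm_inv, Real.norm_eq_abs, inv_mul_le_iff₀ hx0']
  calc _ ≤ C * |x| * |x| := (h x hx).norm_le
    _ = _ := by ring

lemma BddBy.memLp_mul {p : M.L2} {C : ℝ} (h : M.BddBy p C) (f : M.L2) :
    MemLp (fun ω => p ω * f ω) 2 M.μ := by
  refine MemLp.of_le_mul (c := C) (Lp.memLp f)
    ((Lp.aestronglyMeasurable p).mul (Lp.aestronglyMeasurable f)) ?_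
  filter_upwards [h] with ω hω
  rw [norm_mul]
  exact mul_le_mul_of_nonneg_right hω (norm_nonneg _)

lemma BddBy.norm_toLp_mul_le {p : M.L2} {C : ℝ} (h : M.BddBy p C) (f : M.L2)
    (hm : MemLp (fun ω => p ω * f ω) 2 M.μ) : ‖hm.toLp‖ ≤ C * ‖f‖ := by
  refine Lp.norm_le_mul_norm_of_ae_le_mul ?_
  filter_upwards [hm.coeFn_toLp, h] with ω hω h1
  rw [hω, norm_mul]
  exact mul_le_mul_of_nonneg_right h1 (norm_nonneg _)

open Classical in
/-- Multiplication by `p` as an operator on `L²(Ω)`, for bounded `p`. -/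
def mulOp (p : M.L2) : M.L2 →L[ℝ] M.L2 :=
  if h : ∃ C, M.BddBy p C then
    LinearMap.mkContinuous
      { toFun := fun f => (h.choose_spec.memLp_mul f).toLp
        map_add' := fun f g => by
          rw [← MemLp.toLp_add, MemLp.toLp_eq_toLp_iff]
          filter_upwards [Lp.coeFn_add f g] with ω hω
          simp only [hω, Pi.add_apply, mul_add]
        map_smul' := fun c f => by
          rw [RingHom.id_apply, ← MemLp.toLp_const_smul, MemLp.toLp_eq_toLp_iff]
          filter_upwards [Lp.coeFn_smul c f] with ω hω
          simp only [hω, Pi.smul_apply, smul_eq_mul]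
          ring } h.choose (fun f => h.choose_spec.norm_toLp_mul_le f (h.choose_spec.memLp_mul f))
  else 0

lemma BddBy.mulOp_coeFn {p : M.L2} {C : ℝ} (h : M.BddBy p C) (f : M.L2) :
    M.mulOp p f =ᵐ[M.μ] fun ω => p ω * f ω := by
  rw [mulOp, dif_pos ⟨C, h⟩]
  exact (h.memLp_mul f).coeFn_toLp

lemma BddBy.norm_mulOp_le {p : M.L2} {C : ℝ} (h : M.BddBy p C) (f : M.L2) :
    ‖M.mulOp p f‖ ≤ C * ‖f‖ := by
  refine Lp.norm_le_mul_norm_of_ae_le_mul ?_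
  filter_upwards [h.mulOp_coeFn f, h] with ω hω h1
  rw [hω, norm_mul]
  exact mul_le_mul_of_nonneg_right h1 (norm_nonneg _)

lemma BddBy.mulOp_bddBy {p q : M.L2} {C C' : ℝ} (h : M.BddBy p C) (h' : M.BddBy q C') :
    M.BddBy (M.mulOp p q) (C * C') := by
  filter_upwards [h.mulOp_coeFn q, h, h'] with ω hω h1 h2
  rw [hω, abs_mul]
  exact mul_le_mul h1 h2 (abs_nonneg _) h.nonneg

lemma inner_eq_integral (f g : M.L2) : inner ℝ f g = ∫ ω, f ω * g ω ∂M.μ := by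
  rw [L2.inner_def]
  refine integral_congr_ae (Eventually.of_forall fun ω => ?_)
  simp [mul_comm]

lemma BddBy.inner_mulOp_eq_integral {p : M.L2} {C : ℝ} (h : M.BddBy p C) (f g : M.L2) :
    inner ℝ (M.mulOp p f) g = ∫ ω, p ω * f ω * g ω ∂M.μ := by
  rw [inner_eq_integral]
  refine integral_congr_ae ?_
  filter_upwards [h.mulOp_coeFn f] with ω h1
  rw [h1]

lemma T_mulOp {p : M.L2} {C : ℝ} (h : M.BddBy p C) (x : ℝ) (f : M.L2) :
    M.T x (M.mulOp p f) = M.mulOp (M.T x p) (M.T x f) := by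
  apply Lp.ext
  filter_upwards [M.T_coeFn x (M.mulOp p f), M.T_coeFn x p, M.T_coeFn x f,
    (h.T x).mulOp_coeFn (M.T x f), M.ae_τ x (h.mulOp_coeFn f)] with ω h1 h2 h3 h4 h5
  rw [h1, h4, h5, h2, h3]

lemma mulOp_sub_left {p q : M.L2} {C C' : ℝ} (h : M.BddBy p C) (h' : M.BddBy q C') (f : M.L2) :
    M.mulOp (p - q) f = M.mulOp p f - M.mulOp q f := by
  apply Lp.ext
  filter_upwards [(h.sub h').mulOp_coeFn f, h.mulOp_coeFn f, h'.mulOp_coeFn f,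
    Lp.coeFn_sub p q, Lp.coeFn_sub (M.mulOp p f) (M.mulOp q f)] with ω h1 h2 h3 h4 h5
  rw [h1, h5, Pi.sub_apply, h2, h3, h4, Pi.sub_apply, sub_mul]

lemma mulOp_smul_left {p : M.L2} {C : ℝ} (c : ℝ) (h : M.BddBy p C) (f : M.L2) :
    M.mulOp (c • p) f = c • M.mulOp p f := by
  apply Lp.ext
  filter_upwards [(h.smul c).mulOp_coeFn f, h.mulOp_coeFn f,
    Lp.coeFn_smul c p, Lp.coeFn_smul c (M.mulOp p f)] with ω h1 h2 h4 h5
  rw [h1, h5, Pi.smul_apply, h2, h4, Pi.smul_apply, smul_eq_mul, smul_eq_mul, mul_assoc]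

/-- Leibniz rule for multiplication by a function with bounded derivatives. -/
lemma HasD.mulOp {p p' p'' f g : M.L2} {C₀ C₁ C₂ : ℝ} (hp : M.HasD p p') (hp' : M.HasD p' p'')
    (h0 : M.BddBy p C₀) (h1 : M.BddBy p' C₁) (h2 : M.BddBy p'' C₂) (hf : M.HasD f g) :
    M.HasD (M.mulOp p f) (M.mulOp p' f + M.mulOp p g) := by
  rw [hasD_iff, tendsto_iff_norm_sub_tendsto_zero]
  have hF := tendsto_iff_norm_sub_tendsto_zero.1 (hasD_iff.1 hf)
  have hx0 : Tendsto (fun x : ℝ => |x|) (𝓝[≠] 0) (𝓝 0) := by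
    have : Continuous fun x : ℝ => |x| := by fun_prop
    simpa using (this.tendsto 0).mono_left nhdsWithin_le_nhds
  have hlim : Tendsto (fun x : ℝ => C₀ * ‖x⁻¹ • (M.T x f - f) - g‖ + C₁ * |x| * ‖g‖
      + C₂ * |x| * ‖f‖) (𝓝[≠] 0) (𝓝 0) := by
    have := ((hF.const_mul C₀).add ((hx0.const_mul C₁).mul_const ‖g‖)).add
      ((hx0.const_mul C₂).mul_const ‖f‖)
    simpa using this
  refine squeeze_zero' (Eventually.of_forall fun _ => norm_nonneg _) ?_ hlim
  filter_upwards [self_mem_nhdsWithin] with x hx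
  have hx' : 0 < |x| := abs_pos.2 hx
  -- The last term explains the bound on p'': since f is only in L², x⁻¹(T_x p − p) must converge to
  -- p' uniformly, and C₂ |x| bounds its error.
  have e : x⁻¹ • (M.T x (M.mulOp p f) - M.mulOp p f) - (M.mulOp p' f + M.mulOp p g) =
      M.mulOp (M.T x p) (x⁻¹ • (M.T x f - f) - g) + M.mulOp (M.T x p - p) g
      + x⁻¹ • M.mulOp (M.T x p - p - x • p') f := by
    rw [T_mulOp h0, mulOp_sub_left ((h0.T x).sub h0) (h1.smul x), mulOp_sub_left (h0.T x) h0,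
      mulOp_sub_left (h0.T x) h0, mulOp_smul_left x h1, map_sub, map_smul, map_sub,
      smul_sub x⁻¹ _ (x • M.mulOp p' f), inv_smul_smul₀ hx]
    simp only [smul_sub]
    abel
  rw [e]
  refine (norm_add₃_le).trans ?_
  gcongr
  · exact (h0.T x).norm_mulOp_le _
  · exact (hp.bddBy_T_sub h1 x).norm_mulOp_le _
  · rw [norm_smul, norm_inv, Real.norm_eq_abs, inv_mul_le_iff₀ hx']
    refine ((hp.bddBy_T_sub_sub hp' h2 x).norm_mulOp_le f).trans (le_of_eq ?_)
    ring

/-- `f` and its derivatives up to order `k` are bounded. -/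
def BddDeriv : ℕ → M.L2 → Prop
  | 0, f => ∃ C, M.BddBy f C
  | k + 1, f => (∃ C, M.BddBy f C) ∧ ∃ g, M.HasD f g ∧ BddDeriv k g

/-- The set `C^∞(Ω)`, as a subset of `L²(Ω)`. -/
def Cinf : Set M.L2 := {f | ∀ k, BddDeriv k f}

lemma BddDeriv.bdd {k : ℕ} {f : M.L2} (h : BddDeriv k f) : ∃ C, M.BddBy f C := by
  cases k with
  | zero => exact h
  | succ k => exact h.1

lemma BddDeriv.mem_H {k : ℕ} {f : M.L2} (h : BddDeriv k f) : f ∈ M.H k := by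
  induction k generalizing f with
  | zero => exact mem_H_zero _
  | succ k ih =>
    obtain ⟨-, g, h1, h2⟩ := h
    exact h1.mem_H (ih h2)

lemma BddDeriv.add {k : ℕ} {f g : M.L2} (h : BddDeriv k f) (h' : BddDeriv k g) :
    BddDeriv k (f + g) := by
  induction k generalizing f g with
  | zero =>
    obtain ⟨C, hC⟩ := h
    obtain ⟨C', hC'⟩ := h'
    exact ⟨_, hC.add hC'⟩
  | succ k ih =>
    obtain ⟨⟨C, hC⟩, f', h1, h2⟩ := h
    obtain ⟨⟨C', hC'⟩, g', h3, h4⟩ := h'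
    exact ⟨⟨_, hC.add hC'⟩, _, h1.add h3, ih h2 h4⟩

lemma Cinf.bdd {f : M.L2} (h : f ∈ M.Cinf) : ∃ C, M.BddBy f C := h 0

lemma Cinf.exists_hasD {f : M.L2} (h : f ∈ M.Cinf) : ∃ g ∈ M.Cinf, M.HasD f g := by
  obtain ⟨-, g, h1, -⟩ := h 1
  refine ⟨g, fun k => ?_, h1⟩
  obtain ⟨-, g', h2, h3⟩ := h (k + 1)
  rwa [h1.unique h2]

lemma Cinf.hasD {f : M.L2} (h : f ∈ M.Cinf) : M.HasD f (M.D f) := by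
  obtain ⟨g, -, h1⟩ := Cinf.exists_hasD h
  rwa [h1.D_eq]

lemma Cinf.D {f : M.L2} (h : f ∈ M.Cinf) : M.D f ∈ M.Cinf := by
  obtain ⟨g, h0, h1⟩ := Cinf.exists_hasD h
  rwa [h1.D_eq]

lemma Cinf.iterate_D {f : M.L2} (h : f ∈ M.Cinf) (k : ℕ) : M.D^[k] f ∈ M.Cinf := by
  induction k with
  | zero => exact h
  | succ k ih => rw [Function.iterate_succ_apply']; exact Cinf.D ih

lemma Cinf.hasD_mulOp {p f g : M.L2} (hp : p ∈ M.Cinf) (hf : M.HasD f g) :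
    M.HasD (M.mulOp p f) (M.mulOp (M.D p) f + M.mulOp p g) := by
  obtain ⟨C0, h0⟩ := Cinf.bdd hp
  obtain ⟨C1, h1⟩ := Cinf.bdd (Cinf.D hp)
  obtain ⟨C2, h2⟩ := Cinf.bdd (Cinf.D (Cinf.D hp))
  exact (Cinf.hasD hp).mulOp (Cinf.hasD (Cinf.D hp)) h0 h1 h2 hf

lemma Cinf.mulOp_mem_H {p : M.L2} (hp : p ∈ M.Cinf) {k : ℕ} {f : M.L2} (hf : f ∈ M.H k) :
    M.mulOp p f ∈ M.H k := by
  induction k generalizing p f with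
  | zero => exact mem_H_zero _
  | succ k ih =>
    obtain ⟨g, h1, h2⟩ := mem_H_succ.1 hf
    exact (Cinf.hasD_mulOp hp h1).mem_H (H_add (ih (Cinf.D hp) (H_succ_subset k hf)) (ih hp h2))

lemma BddDeriv.of_succ {k : ℕ} {f : M.L2} (h : BddDeriv (k + 1) f) : BddDeriv k f := by
  induction k generalizing f with
  | zero => exact h.1
  | succ k ih =>
    obtain ⟨h0, g, h1, h2⟩ := h
    exact ⟨h0, g, h1, ih h2⟩

lemma BddDeriv.mulOp {p : M.L2} (hp : p ∈ M.Cinf) {k : ℕ} {f : M.L2} (hf : BddDeriv k f) :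
    BddDeriv k (M.mulOp p f) := by
  obtain ⟨C, hC⟩ := Cinf.bdd hp
  obtain ⟨C', hC'⟩ := hf.bdd
  induction k generalizing p f C C' with
  | zero => exact ⟨_, hC.mulOp_bddBy hC'⟩
  | succ k ih =>
    obtain ⟨-, g, h1, h2⟩ := id hf
    obtain ⟨C1, hC1⟩ := Cinf.bdd (Cinf.D hp)
    obtain ⟨C2, hC2⟩ := h2.bdd
    exact ⟨⟨_, hC.mulOp_bddBy hC'⟩, _, Cinf.hasD_mulOp hp h1,
      (ih (Cinf.D hp) hf.of_succ _ hC1 _ hC').add (ih hp h2 _ hC _ hC2)⟩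

lemma Cinf.mulOp {p q : M.L2} (hp : p ∈ M.Cinf) (hq : q ∈ M.Cinf) : M.mulOp p q ∈ M.Cinf :=
  fun k => (hq k).mulOp hp

lemma const_mem_Cinf (c : ℝ) : Lp.const 2 M.μ c ∈ M.Cinf := by
  have hT : ∀ x, M.T x (Lp.const 2 M.μ c) = Lp.const 2 M.μ c := by
    intro x
    apply Lp.ext
    filter_upwards [M.T_coeFn x (Lp.const 2 M.μ c), Lp.coeFn_const 2 M.μ c,
      M.ae_τ x (Lp.coeFn_const 2 M.μ c)] with ω h1 h2 h3
    rw [h1, h2, h3]; rfl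
  have h0 : M.HasD (Lp.const 2 M.μ c) 0 := by
    unfold HasD; simp_rw [hT]; exact hasDerivAt_const _ _
  have hz : M.BddBy 0 0 := by
    filter_upwards [Lp.coeFn_zero ℝ 2 M.μ] with ω h; rw [h]; simp
  have hB : M.BddBy (Lp.const 2 M.μ c) |c| := by
    filter_upwards [Lp.coeFn_const 2 M.μ c] with ω h; rw [h]; rfl
  have h00 : ∀ k, BddDeriv k (0 : M.L2) := by
    intro k
    induction k with
    | zero => exact ⟨0, hz⟩
    | succ k ih => exact ⟨⟨0, hz⟩, 0, hasD_zero, ih⟩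
  intro k
  cases k with
  | zero => exact ⟨_, hB⟩
  | succ k => exact ⟨⟨_, hB⟩, 0, h0, h00 k⟩

lemma Cinf.smul {p : M.L2} (c : ℝ) (hp : p ∈ M.Cinf) : c • p ∈ M.Cinf := by
  have hc := const_mem_Cinf (M := M) c
  have : c • p = M.mulOp (Lp.const 2 M.μ c) p := by
    obtain ⟨C, hC⟩ := Cinf.bdd hc
    apply Lp.ext
    filter_upwards [Lp.coeFn_smul c p, hC.mulOp_coeFn p, Lp.coeFn_const 2 M.μ c] with ω h1 h2 h3
    rw [h1, h2, h3]; rfl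
  rw [this]; exact Cinf.mulOp hc hp

lemma memCinf_iff {g : Ω → ℝ} : M.MemCinf g ↔ ∃ f ∈ M.Cinf, f =ᵐ[M.μ] g := by
  constructor
  · rintro ⟨f, h1, h2, h3⟩
    refine ⟨f, fun k => ?_, h1⟩
    have : ∀ k n, BddDeriv k (M.D^[n] f) := by
      intro k
      induction k with
      | zero => exact fun n => h3 n
      | succ k ih => exact fun n => ⟨h3 n, _, iterate_D_hasD h2 n, ih (n + 1)⟩
    exact this k 0
  · rintro ⟨f, h1, h2⟩
    exact ⟨f, h2, fun k => (h1 k).mem_H, fun k => Cinf.bdd (Cinf.iterate_D h1 k)⟩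

/-- Once D(e^V) = (DV) e^V is known, boundedness of e^V alone gives all derivatives by induction
with the Leibniz rule. -/
lemma Cinf.exp {V : M.L2} (hV : V ∈ M.Cinf) :
    ∃ E ∈ M.Cinf, E =ᵐ[M.μ] fun ω => Real.exp (V ω) := by
  obtain ⟨C0, h0⟩ := Cinf.bdd hV
  obtain ⟨C1, h1⟩ := Cinf.bdd (Cinf.D hV)
  obtain ⟨C2, h2⟩ := Cinf.bdd (Cinf.D (Cinf.D hV))
  have hC1 := h1.nonneg
  have hbd : ∀ᵐ ω ∂M.μ, ‖Real.exp (V ω)‖ ≤ Real.exp C0 := by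
    filter_upwards [h0] with ω h
    rw [Real.norm_eq_abs, Real.abs_exp]
    exact Real.exp_le_exp.2 (abs_le.1 h).2
  have hm : MemLp (fun ω => Real.exp (V ω)) 2 M.μ :=
    MemLp.of_bound (Real.continuous_exp.comp_aestronglyMeasurable (Lp.aestronglyMeasurable V)) _ hbd
  have hE := hm.coeFn_toLp
  set E : M.L2 := hm.toLp with hEdef
  have hEb : M.BddBy E (Real.exp C0) := by
    filter_upwards [hE, hbd] with ω h1 h2
    rwa [h1]
  have hD : M.HasD E (M.mulOp (M.D V) E) := by
    -- For these x the increment y of V satisfies |y| ≤ C1 |x| ≤ 1, where |e^y − 1 − y| ≤ y². This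
    -- contributes C1² x², and the Taylor remainder of V itself contributes C2 x².
    refine hasD_of_bddBy (C := Real.exp C0 * (C1 ^ 2 + C2)) (δ := (C1 + 1)⁻¹) (by positivity)
      fun x hx => ?_
    have hx1 : C1 * |x| ≤ 1 := by
      have : (C1 + 1) * |x| ≤ 1 := by
        calc (C1 + 1) * |x| ≤ (C1 + 1) * (C1 + 1)⁻¹ := by gcongr
          _ = 1 := mul_inv_cancel₀ (by positivity)
      nlinarith [abs_nonneg x]
    filter_upwards [hE, M.ae_τ x hE, M.T_coeFn x E, M.T_coeFn x V, h0,
      (Cinf.hasD hV).bddBy_T_sub h1 x, (Cinf.hasD hV).bddBy_T_sub_sub (Cinf.hasD (Cinf.D hV)) h2 x,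
      Lp.coeFn_sub (M.T x V) V, Lp.coeFn_sub (M.T x V - V) (x • M.D V), Lp.coeFn_smul x (M.D V),
      Lp.coeFn_sub (M.T x E) E, Lp.coeFn_sub (M.T x E - E) (x • M.mulOp (M.D V) E),
      Lp.coeFn_smul x (M.mulOp (M.D V) E), h1.mulOp_coeFn E]
      with ω e1 e2 e3 e4 b0 b1 b2 e5 e6 e7 e8 e9 e10 e11
    rw [e9, Pi.sub_apply, e8, Pi.sub_apply, e10, Pi.smul_apply, e11, e3, e2, e1, smul_eq_mul]
    rw [e5, Pi.sub_apply, e4] at b1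
    rw [e6, Pi.sub_apply, e5, Pi.sub_apply, e4, e7, Pi.smul_apply, smul_eq_mul] at b2
    set v := V ω
    set v' := V (M.τ x ω)
    set d := (M.D V) ω
    have hexp := Real.abs_exp_sub_one_sub_id_le (b1.trans hx1)
    have e : Real.exp v' - Real.exp v - x * (d * Real.exp v) =
        Real.exp v * ((Real.exp (v' - v) - 1 - (v' - v)) + (v' - v - x * d)) := by
      rw [Real.exp_sub]
      field_simp
      ring
    rw [e, abs_mul, Real.abs_exp, mul_assoc, mul_assoc]
    have hv : Real.exp v ≤ Real.exp C0 := Real.exp_le_exp.2 (abs_le.1 b0).2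
    have hsq : (v' - v) ^ 2 ≤ C1 ^ 2 * (|x| * |x|) := by
      rw [← sq_abs]
      calc |v' - v| ^ 2 ≤ (C1 * |x|) ^ 2 := by gcongr
        _ = _ := by ring
    have : |(Real.exp (v' - v) - 1 - (v' - v)) + (v' - v - x * d)| ≤
        (C1 ^ 2 + C2) * (|x| * |x|) := by
      refine (abs_add_le _ _).trans ?_
      rw [add_mul]
      refine add_le_add (hexp.trans hsq) (b2.trans (le_of_eq (by ring)))
    exact mul_le_mul hv this (abs_nonneg _) (Real.exp_pos _).le
  refine ⟨E, fun k => ?_, hE⟩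
  induction k with
  | zero => exact ⟨_, hEb⟩
  | succ k ih => exact ⟨⟨_, hEb⟩, _, hD, ih.mulOp (Cinf.D hV)⟩

end RandomMedium

/-! ### The Hilbert space H¹(Ω), smooth forms and elliptic regularity. -/

namespace RandomMedium

variable {Ω : Type*} [MeasurableSpace Ω] {M : RandomMedium Ω}

variable (M) in
/-- The graph of `D`. -/
def graphD : Submodule ℝ (WithLp 2 (M.L2 × M.L2)) where
  carrier := {x | M.HasD x.fst x.snd}
  add_mem' := fun ha hb => HasD.add ha hb
  zero_mem' := hasD_zero
  smul_mem' := fun c _ hx => HasD.smul c hx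

variable (M) in
/-- `H¹(Ω)` as a Hilbert space, realized as the graph of `D`. -/
def H1 : Type _ := M.graphD

instance : NormedAddCommGroup M.H1 := inferInstanceAs (NormedAddCommGroup M.graphD)
instance : InnerProductSpace ℝ M.H1 := inferInstanceAs (InnerProductSpace ℝ M.graphD)

/-- The inclusion of `H¹(Ω)` in the product space. -/
def inclH1 : M.H1 →L[ℝ] WithLp 2 (M.L2 × M.L2) := M.graphD.subtypeL

/-- The underlying function of an element of `H¹(Ω)`. -/
def val : M.H1 →L[ℝ] M.L2 := (WithLp.fstL 2 ℝ M.L2 M.L2).comp inclH1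

/-- The derivative of an element of `H¹(Ω)`. -/
def der : M.H1 →L[ℝ] M.L2 := (WithLp.sndL 2 ℝ M.L2 M.L2).comp inclH1

lemma hasD_val_der (u : M.H1) : M.HasD (val u) (der u) := u.2

/-- The element of `H¹(Ω)` given by `f ∈ Dom D`. -/
def HasD.toH1 {f g : M.L2} (h : M.HasD f g) : M.H1 := ⟨WithLp.toLp 2 (f, g), h⟩

@[simp] lemma HasD.val_toH1 {f g : M.L2} (h : M.HasD f g) : val h.toH1 = f := rfl
@[simp] lemma HasD.der_toH1 {f g : M.L2} (h : M.HasD f g) : der h.toH1 = g := rfl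

lemma H1_ext {u v : M.H1} (h : val u = val v) : u = v := by
  have h1 := hasD_val_der u
  rw [h] at h1
  have h2 := h1.unique (hasD_val_der v)
  apply Subtype.ext
  exact WithLp.ofLp_injective 2 (Prod.ext h h2)

lemma norm_sq_H1 (u : M.H1) : ‖u‖ ^ 2 = ‖val u‖ ^ 2 + ‖der u‖ ^ 2 :=
  WithLp.prod_norm_sq_eq_of_L2 (inclH1 u)

lemma norm_val_le (u : M.H1) : ‖val u‖ ≤ ‖u‖ := by
  have := norm_sq_H1 u
  exact le_of_sq_le_sq (by nlinarith [sq_nonneg ‖der u‖]) (norm_nonneg _)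

lemma norm_der_le (u : M.H1) : ‖der u‖ ≤ ‖u‖ := by
  have := norm_sq_H1 u
  exact le_of_sq_le_sq (by nlinarith [sq_nonneg ‖val u‖]) (norm_nonneg _)

lemma norm_H1_le (u : M.H1) : ‖u‖ ≤ ‖val u‖ + ‖der u‖ := by
  have := norm_sq_H1 u
  refine le_of_sq_le_sq ?_ (by positivity)
  nlinarith [mul_nonneg (norm_nonneg (val u)) (norm_nonneg (der u))]

lemma isClosed_graphD : IsClosed (M.graphD : Set (WithLp 2 (M.L2 × M.L2))) := by
  refine isClosed_of_closure_subset fun x hx => ?_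
  obtain ⟨u, hu, hux⟩ := mem_closure_iff_seq_limit.1 hx
  exact hasD_of_tendsto hu
    (((WithLp.fstL 2 ℝ M.L2 M.L2).continuous.tendsto x).comp hux)
    (((WithLp.sndL 2 ℝ M.L2 M.L2).continuous.tendsto x).comp hux)

instance : CompleteSpace M.H1 :=
  show CompleteSpace M.graphD from (isClosed_graphD (M := M)).completeSpace_coe

/-- The action of `T_x` on `H¹(Ω)`. -/
def TH (x : ℝ) (u : M.H1) : M.H1 := ((hasD_val_der u).T x).toH1

@[simp] lemma val_TH (x : ℝ) (u : M.H1) : val (TH x u) = M.T x (val u) := rfl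
@[simp] lemma der_TH (x : ℝ) (u : M.H1) : der (TH x u) = M.T x (der u) := rfl

lemma norm_TH (x : ℝ) (u : M.H1) : ‖TH x u‖ = ‖u‖ := by
  have h1 := norm_sq_H1 (TH x u)
  rw [val_TH, der_TH, norm_T, norm_T, ← norm_sq_H1] at h1
  exact (sq_eq_sq₀ (norm_nonneg _) (norm_nonneg _)).1 h1

lemma TH_sub (x : ℝ) (u v : M.H1) : TH x (u - v) = TH x u - TH x v :=
  H1_ext (by simp [T_map_sub])

lemma hasDerivAt_TH {u u' : M.H1} (h : val u' = der u) (x : ℝ) :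
    HasDerivAt (fun y => TH y u) (TH x u') x := by
  rw [hasDerivAt_iff_tendsto_slope_zero, tendsto_iff_norm_sub_tendsto_zero]
  have h1 := hasDerivAt_iff_tendsto_slope_zero.1 ((hasD_val_der u).hasDerivAt x)
  have h2 := hasDerivAt_iff_tendsto_slope_zero.1 ((hasD_val_der u').hasDerivAt x)
  have h3 := (tendsto_iff_norm_sub_tendsto_zero.1 h1).add (tendsto_iff_norm_sub_tendsto_zero.1 h2)
  rw [add_zero] at h3
  refine squeeze_zero (fun _ => norm_nonneg _) (fun t => ?_) h3
  refine (norm_H1_le _).trans ?_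
  simp [h]

/-- Mean values in `H¹(Ω)`. -/
def mollH (n : ℕ) (u : M.H1) : M.H1 := ((hasD_val_der u).moll n).toH1

lemma tendsto_mollH (u : M.H1) : Tendsto (fun n => mollH n u) atTop (𝓝 u) := by
  rw [tendsto_iff_norm_sub_tendsto_zero]
  have h3 := (tendsto_iff_norm_sub_tendsto_zero.1 (tendsto_moll (val u))).add
    (tendsto_iff_norm_sub_tendsto_zero.1 (tendsto_moll (der u)))
  rw [add_zero] at h3
  refine squeeze_zero (fun _ => norm_nonneg _) (fun n => ?_) h3
  exact (norm_H1_le _).trans (by simp [mollH])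

lemma exists_val_eq_der_mollH (n : ℕ) (u : M.H1) : ∃ u' : M.H1, val u' = der (mollH n u) := by
  obtain ⟨g, hg⟩ := hasD_moll n (der u)
  exact ⟨hg.toH1, rfl⟩

/-- A property that holds on `H²(Ω)` and is closed in `H¹(Ω)` holds on `H¹(Ω)`. -/
lemma H1_induction {p : M.H1 → Prop} (hc : IsClosed {u | p u})
    (h : ∀ u u' : M.H1, val u' = der u → p u) (u : M.H1) : p u :=
  hc.mem_of_tendsto (tendsto_mollH u) (Eventually.of_forall fun n => by
    obtain ⟨u', hu'⟩ := exists_val_eq_der_mollH n u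
    exact h _ _ hu')

variable (M) in
/-- A sequence of bounded bilinear forms on `H¹(Ω)`, each being the derivative of the preceding
one along `(T_x)`, and each representable on `H²(Ω)` by elements of `L²(Ω)`. -/
structure SmoothForms (b : ℕ → M.H1 →L[ℝ] M.H1 →L[ℝ] ℝ) : Prop where
  deriv : ∀ k (u u' v v' : M.H1), val u' = der u → val v' = der v →
    b k u v' + b k u' v = - b (k + 1) u v
  bound : ∀ k (u u' : M.H1), val u' = der u → ∃ C, ∀ v, |b k u v| ≤ C * ‖val v‖

lemma SmoothForms.add {b c : ℕ → M.H1 →L[ℝ] M.H1 →L[ℝ] ℝ} (hb : M.SmoothForms b)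
    (hc : M.SmoothForms c) : M.SmoothForms (fun k => b k + c k) where
  deriv k u u' v v' h1 h2 := by
    have e1 := hb.deriv k u u' v v' h1 h2
    have e2 := hc.deriv k u u' v v' h1 h2
    simp only [add_apply]
    linarith
  bound k u u' h := by
    obtain ⟨C, hC⟩ := hb.bound k u u' h
    obtain ⟨C', hC'⟩ := hc.bound k u u' h
    refine ⟨C + C', fun v => ?_⟩
    simp only [add_apply]
    rw [add_mul]
    exact (abs_add_le _ _).trans (add_le_add (hC v) (hC' v))

lemma SmoothForms.smul {b : ℕ → M.H1 →L[ℝ] M.H1 →L[ℝ] ℝ} (hb : M.SmoothForms b) (r : ℝ) :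
    M.SmoothForms (fun k => r • b k) where
  deriv k u u' v v' h1 h2 := by
    have e1 := hb.deriv k u u' v v' h1 h2
    simp only [smul_apply, smul_eq_mul]
    rw [← mul_add, e1]; ring
  bound k u u' h := by
    obtain ⟨C, hC⟩ := hb.bound k u u' h
    refine ⟨|r| * C, fun v => ?_⟩
    simp only [smul_apply, smul_eq_mul, abs_mul]
    rw [mul_assoc]
    exact mul_le_mul_of_nonneg_left (hC v) (abs_nonneg _)

namespace SmoothForms

variable {b : ℕ → M.H1 →L[ℝ] M.H1 →L[ℝ] ℝ}

lemma exists_repr (hb : M.SmoothForms b) (k : ℕ) {u u' : M.H1} (h : val u' = der u) :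
    ∃ w : M.L2, ∀ v, b k u v = inner ℝ w (val v) := by
  obtain ⟨C, hC⟩ := hb.bound k u u' h
  exact exists_inner_eq_of_bound (val : M.H1 →L[ℝ] M.L2).toLinearMap (b k u).toLinearMap C hC

/-- On representatives, `deriv` reads ⟨w, Dψ⟩ = −⟨w1 + w2, ψ⟩, with w1 representing b_k(Du, ·) and
w2 representing b_{k+1}(u, ·); hence Dw = w1 + w2. The second term is why the induction keeps k
arbitrary. -/
lemma exists_repr_mem_H (hb : M.SmoothForms b) (m k : ℕ) (u : M.H1) (hu : val u ∈ M.H (m + 2)) :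
    ∃ w ∈ M.H m, ∀ v, b k u v = inner ℝ w (val v) := by
  have hder : ∀ {m} (u : M.H1), val u ∈ M.H (m + 1 + 1) →
      ∃ u' : M.H1, val u' = der u ∧ val u' ∈ M.H (m + 1) := by
    intro m u hu
    have h1 := (hasD_val_der u).mem_H_of hu
    obtain ⟨g, hg, -⟩ := mem_H_succ.1 h1
    exact ⟨hg.toH1, rfl, h1⟩
  induction m generalizing k u with
  | zero =>
    obtain ⟨u', hu', -⟩ := hder u hu
    obtain ⟨w, hw⟩ := hb.exists_repr k hu'
    exact ⟨w, mem_H_zero w, hw⟩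
  | succ m ih =>
    obtain ⟨u', hu', hu2⟩ := hder u hu
    obtain ⟨w, hw⟩ := hb.exists_repr k hu'
    obtain ⟨w1, hw1, hw1'⟩ := ih k u' hu2
    obtain ⟨w2, hw2, hw2'⟩ := ih (k + 1) u (H_succ_subset _ hu)
    refine ⟨w, HasD.mem_H (g := w1 + w2) (hasD_of_weak fun ψ ψ' ψ'' h1 h2 => ?_)
      (H_add hw1 hw2), hw⟩
    have e1 := hb.deriv k u u' h1.toH1 h2.toH1 hu' rfl
    rw [hw, hw1', hw2'] at e1
    simp only [HasD.val_toH1] at e1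
    rw [inner_add_left]
    linarith

/-- On H² the derivative of y ↦ b_k(T_y u, T_y v) is −b_{k+1}(T_y u, T_y v), bounded uniformly in y
because T_y is isometric on H¹. Both sides are continuous on H¹, so density finishes. The estimate
plays the part of a commutator bound between T_x and the coefficients. -/
lemma lipschitz (hb : M.SmoothForms b) (k : ℕ) (x : ℝ) (u v : M.H1) :
    |b k (TH x u) (TH x v) - b k u v| ≤ ‖b (k + 1)‖ * ‖u‖ * ‖v‖ * |x| := by
  have hTc : Continuous fun u : M.H1 => TH x u := by
    have : Isometry fun u : M.H1 => TH x u :=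
      Isometry.of_dist_eq fun u v => by rw [dist_eq_norm, ← TH_sub, norm_TH, dist_eq_norm]
    exact this.continuous
  induction u using H1_induction with
  | hc =>
    refine isClosed_le ?_ (by fun_prop)
    fun_prop
  | h u u' hu =>
  induction v using H1_induction with
  | hc =>
    refine isClosed_le ?_ (by fun_prop)
    fun_prop
  | h v v' hv =>
  have hd : ∀ y, HasDerivAt (fun y => b k (TH y u) (TH y v)) (- b (k + 1) (TH y u) (TH y v)) y := by
    intro y
    have h1 := ((b k).hasFDerivAt (x := TH y u)).comp_hasDerivAt y (hasDerivAt_TH hu y)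
    have h2 := h1.clm_apply (hasDerivAt_TH hv y)
    refine h2.congr_deriv ?_
    rw [← hb.deriv k (TH y u) (TH y u') (TH y v) (TH y v') (by simp [hu]) (by simp [hv]), add_comm]
    rfl
  have := (convex_univ : Convex ℝ (Set.univ : Set ℝ)).norm_image_sub_le_of_norm_hasDerivWithin_le
    (f := fun y => b k (TH y u) (TH y v)) (C := ‖b (k + 1)‖ * ‖u‖ * ‖v‖) (x := 0) (y := x)
    (fun y _ => (hd y).hasDerivWithinAt) (fun y _ => by
      rw [norm_neg]
      refine ((b (k + 1)).le_opNorm₂ _ _).trans ?_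
      rw [norm_TH, norm_TH])
    (Set.mem_univ _) (Set.mem_univ _)
  have h0 : ∀ u : M.H1, TH 0 u = u := fun u => H1_ext (by simp [T_zero])
  simpa [h0] using this

/-- Nirenberg's method: coercivity is applied to d = T_x u − u, and b(d, d) is shown to be at most a
constant times |x| ‖d‖, so that ‖d‖ = O(|x|) in H¹ and Du has bounded difference quotients. -/
lemma mem_H_two_of_repr (hb : M.SmoothForms b) {κ : ℝ} (hκ : 0 < κ)
    (hco : ∀ u, κ * ‖u‖ ^ 2 ≤ b 0 u u) {u : M.H1} {w : M.L2}
    (h : ∀ v, b 0 u v = inner ℝ w (val v)) : val u ∈ M.H 2 := by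
  set C := ‖b 1‖ * ‖u‖ + ‖w‖ with hC
  have key : ∀ x, ‖M.T x (der u) - der u‖ ≤ κ⁻¹ * C * |x| := by
    intro x
    set d := TH x u - u with hd
    -- The bracket measures how far the form is from being invariant under T_x. In the remaining
    -- term the equation for u applies, and the difference T_{-x} d − d costs one derivative of d
    -- only.
    have e1 : b 0 d d = (b 0 (TH x u) (TH x (TH (-x) d)) - b 0 u (TH (-x) d))
        + b 0 u (TH (-x) d - d) := by
      have : TH x (TH (-x) d) = d := H1_ext (by simp [T_T_neg])
      have e : b 0 d d = b 0 (TH x u) d - b 0 u d := by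
        have := (b 0).map_sub₂ (TH x u) u d
        exact this
      have e' : b 0 u (TH (-x) d - d) = b 0 u (TH (-x) d) - b 0 u d := map_sub _ _ _
      rw [this, e, e']
      ring
    have e2 := hb.lipschitz 0 x u (TH (-x) d)
    rw [norm_TH] at e2
    have e3 : |b 0 u (TH (-x) d - d)| ≤ ‖w‖ * (‖d‖ * |x|) := by
      rw [h]
      refine (abs_real_inner_le_norm _ _).trans ?_
      gcongr
      rw [map_sub, val_TH]
      refine ((hasD_val_der d).norm_T_sub_le (-x)).trans ?_
      rw [abs_neg]
      gcongr
      exact norm_der_le d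
    have e4 : κ * ‖d‖ ^ 2 ≤ C * |x| * ‖d‖ := by
      refine (hco d).trans ((le_abs_self _).trans ?_)
      rw [e1]
      refine (abs_add_le _ _).trans ((add_le_add e2 e3).trans (le_of_eq ?_))
      rw [hC]; ring
    have e5 : κ * ‖d‖ ≤ C * |x| := by
      rcases eq_or_ne ‖d‖ 0 with h0 | h0
      · rw [h0, mul_zero]; positivity
      · have : 0 < ‖d‖ := lt_of_le_of_ne (norm_nonneg _) h0.symm
        refine le_of_mul_le_mul_right ?_ this
        calc κ * ‖d‖ * ‖d‖ = κ * ‖d‖ ^ 2 := by ring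
          _ ≤ _ := e4
    have e6 : M.T x (der u) - der u = der d := by rw [hd, map_sub, der_TH]
    rw [e6, mul_assoc, ← div_eq_inv_mul, le_div_iff₀' hκ]
    refine le_trans ?_ e5
    gcongr
    exact norm_der_le d
  obtain ⟨g, hg⟩ := mem_domD.1 (domD_eq_of_bounded_quotient key)
  exact (hasD_val_der u).mem_H (hg.mem_H (mem_H_zero _))

/-- Elliptic regularity. -/
lemma mem_H_of_repr (hb : M.SmoothForms b) {κ : ℝ} (hκ : 0 < κ)
    (hco : ∀ u, κ * ‖u‖ ^ 2 ≤ b 0 u u) (m : ℕ) {u : M.H1} {w : M.L2}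
    (h : ∀ v, b 0 u v = inner ℝ w (val v)) (hw : w ∈ M.H m) : val u ∈ M.H (m + 2) := by
  induction m generalizing u w with
  | zero => exact hb.mem_H_two_of_repr hκ hco h
  | succ m ih =>
    have hu := ih h (H_succ_subset _ hw)
    obtain ⟨w', hw', hwm⟩ := mem_H_succ.1 hw
    obtain ⟨w2, hw2, hw2'⟩ := hb.exists_repr_mem_H m 1 u hu
    have h1 := (hasD_val_der u).mem_H_of hu
    obtain ⟨g, hg, -⟩ := mem_H_succ.1 h1
    refine (hasD_val_der u).mem_H ?_
    -- The differentiated equation: Du solves the same problem with right-hand side Dw − w2, where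
    -- w2 represents b_1(u, ·).
    refine ih (u := hg.toH1) (w := w' - w2) (fun v => ?_) (H_sub hwm hw2)
    induction v using H1_induction with
    | hc => exact isClosed_eq (by fun_prop) (by fun_prop)
    | h v v' hv =>
      have e := hb.deriv 0 u hg.toH1 v v' rfl hv
      have e2 := hw'.inner_skew (hasD_val_der v)
      rw [h, hv, zero_add, hw2'] at e
      rw [inner_sub_left]
      linarith

end SmoothForms

end RandomMedium

/-! ### Measurability in the jump size, and integrability against ν. -/

lemma aemeasurable_simpleFunc_pair {E Z : Type*} [MeasurableSpace Z] {ν : Measure Z}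
    {F : E → E → Z → ℝ} (hF : ∀ a b, AEMeasurable (F a b) ν) (s t : SimpleFunc Z E) :
    AEMeasurable (fun z => F (s z) (t z) z) ν := by
  classical
  have : (fun z => F (s z) (t z) z) = fun z =>
      ∑ c ∈ (s.pair t).range, ((s.pair t) ⁻¹' {c}).indicator (F c.1 c.2) z := by
    funext z
    rw [Finset.sum_eq_single ((s.pair t) z)]
    · rw [Set.indicator_of_mem (by simp)]; rfl
    · intro c _ hc
      rw [Set.indicator_of_notMem]
      simpa using hc.symm
    · intro h
      exact absurd (SimpleFunc.mem_range_self _ z) h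
  rw [this]
  exact Finset.aemeasurable_fun_sum _ fun c _ =>
    (hF c.1 c.2).indicator ((s.pair t).measurableSet_fiber c)

/-- `Q` is only weakly measurable in z, so the moving arguments are first replaced by simple
functions; continuity of each `Q z` allows the passage to the limit. -/
lemma aemeasurable_inner_of_continuous {E Z : Type*} [NormedAddCommGroup E]
    [InnerProductSpace ℝ E] [TopologicalSpace Z] [SecondCountableTopology Z] [MeasurableSpace Z]
    [OpensMeasurableSpace Z] {ν : Measure Z}
    {Q : Z → E →L[ℝ] E} (hQ : ∀ a b, AEMeasurable (fun z => inner ℝ (Q z a) b) ν)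
    {X Y : Z → E} (hX : Continuous X) (hY : Continuous Y) :
    AEMeasurable (fun z => inner ℝ (Q z (X z)) (Y z)) ν := by
  have hX' := hX.stronglyMeasurable
  have hY' := hY.stronglyMeasurable
  refine aemeasurable_of_tendsto_metrizable_ae atTop
    (f := fun n z => inner ℝ (Q z (hX'.approx n z)) (hY'.approx n z))
    (fun n => aemeasurable_simpleFunc_pair (F := fun a b z => inner ℝ (Q z a) b) hQ _ _)
    (Eventually.of_forall fun z => ?_)
  exact (((Q z).continuous.tendsto _).comp (hX'.tendsto_approx z)).inner (hY'.tendsto_approx z)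

/-- The integrable weight `min(1, z²)` against Lévy measures. -/
def levyWeight (z : ℝ) : ℝ := (min 1 |z|) ^ 2

/-- Against dz the weight becomes |z|^{1−α} for |z| ≤ 1, integrable at 0 because α < 2, and
|z|^{−1−α} beyond, integrable at infinity because α > 0. -/
lemma integrable_levyWeight {α : ℝ} (h0 : 0 < α) (h2 : α < 2) :
    Integrable levyWeight (levyMeasure α) := by
  have hmeas : Measurable fun z : ℝ => 1 / |z| ^ (1 + α) := by
    exact measurable_const.div (measurable_norm.pow_const _)
  unfold levyMeasure
  rw [integrable_withDensity_iff_integrable_smul' hmeas.ennreal_ofReal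
    (Eventually.of_forall fun _ => ENNReal.ofReal_lt_top)]
  have heq : ∀ z : ℝ, (ENNReal.ofReal (1 / |z| ^ (1 + α))).toReal • levyWeight z =
      1 / |z| ^ (1 + α) * (min 1 |z|) ^ 2 := fun z => by
    rw [ENNReal.toReal_ofReal (by positivity), smul_eq_mul, levyWeight]
  simp_rw [heq]
  set f : ℝ → ℝ := fun z => 1 / |z| ^ (1 + α) * (min 1 |z|) ^ 2 with hf
  have hIoi : IntegrableOn f (Set.Ioi 0) := by
    rw [← Set.Ioc_union_Ioi_eq_Ioi (zero_le_one' ℝ)]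
    refine IntegrableOn.union ?_ ?_
    · have h1 : IntegrableOn (fun z : ℝ => z ^ (1 - α)) (Set.Ioc 0 1) :=
        (intervalIntegrable_iff_integrableOn_Ioc_of_le zero_le_one).1
          (intervalIntegral.intervalIntegrable_rpow' (by linarith))
      refine h1.congr_fun (fun z hz => ?_) measurableSet_Ioc
      have hz0 : 0 < z := hz.1
      simp only [hf]
      rw [abs_of_pos hz0, min_eq_right hz.2, one_div, ← Real.rpow_neg hz0.le, ← Real.rpow_natCast,
        ← Real.rpow_add hz0]
      congr 1
      push_cast; ring
    · have h1 : IntegrableOn (fun z : ℝ => z ^ (-(1 + α))) (Set.Ioi 1) :=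
        integrableOn_Ioi_rpow_of_lt (by linarith) one_pos
      refine h1.congr_fun (fun z hz => ?_) measurableSet_Ioi
      have hz0 : (0:ℝ) < z := one_pos.trans hz
      simp only [hf]
      rw [abs_of_pos hz0, min_eq_left (le_of_lt hz), one_div, ← Real.rpow_neg hz0.le]
      ring
  have hIio : IntegrableOn f (Set.Iio 0) := by
    have := (Measure.measurePreserving_neg (volume : Measure ℝ)).integrableOn_comp_preimage
      (f := f) (s := Set.Ioi 0) (Homeomorph.neg ℝ).measurableEmbedding
    have h2 := this.2 hIoi
    have e1 : f ∘ (fun x : ℝ => -x) = f := by funext z; simp [hf]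
    have e2 : (fun x : ℝ => -x) ⁻¹' Set.Ioi 0 = Set.Iio 0 := by ext z; simp
    rw [← e1, ← e2]
    exact h2
  rw [← integrableOn_univ, ← Set.Iic_union_Ioi (a := (0:ℝ))]
  exact ((integrableOn_Iic_iff_integrableOn_Iio (by simp)).2 hIio).union hIoi

/-! ### The zero order, diffusion and jump forms as smooth forms. -/

namespace RandomMedium

variable {Ω : Type*} [MeasurableSpace Ω] {M : RandomMedium Ω}

/-- The form `(f, g) ↦ ⟨A f, B g⟩` on `H¹(Ω)`. -/
def innerForm (A B : M.H1 →L[ℝ] M.L2) : M.H1 →L[ℝ] M.H1 →L[ℝ] ℝ :=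
  LinearMap.mkContinuous₂
    (LinearMap.mk₂ ℝ (fun f g => inner ℝ (A f) (B g))
      (fun f f' g => by rw [map_add, inner_add_left])
      (fun c f g => by rw [map_smul, inner_smul_left]; rfl)
      (fun f g g' => by rw [map_add, inner_add_right])
      (fun c f g => by rw [map_smul, inner_smul_right]; rfl))
    (‖A‖ * ‖B‖) (fun f g => by
      rw [LinearMap.mk₂_apply]
      refine (abs_real_inner_le_norm _ _).trans ?_
      calc ‖A f‖ * ‖B g‖ ≤ (‖A‖ * ‖f‖) * (‖B‖ * ‖g‖) := by
            gcongr
            · exact A.le_opNorm f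
            · exact B.le_opNorm g
        _ = _ := by ring)

@[simp] lemma innerForm_apply (A B : M.H1 →L[ℝ] M.L2) (f g : M.H1) :
    innerForm A B f g = inner ℝ (A f) (B g) := rfl

lemma smoothForms_val {p : M.L2} (hp : p ∈ M.Cinf) :
    M.SmoothForms fun k => innerForm ((M.mulOp (M.D^[k] p)).comp val) val where
  deriv k u u' v v' hu hv := by
    have h1 := Cinf.hasD_mulOp (Cinf.iterate_D hp k) (hasD_val_der u)
    have h2 := h1.inner_skew (hasD_val_der v)
    rw [inner_add_left] at h2
    simp only [innerForm_apply, ContinuousLinearMap.comp_apply, hu, hv,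
      Function.iterate_succ_apply']
    linarith
  bound k u u' hu := by
    refine ⟨‖M.mulOp (M.D^[k] p) (val u)‖, fun v => ?_⟩
    simp only [innerForm_apply, ContinuousLinearMap.comp_apply]
    exact abs_real_inner_le_norm _ _

/-- For u ∈ H² the product of the coefficient with Du is again in Dom D, and skew-adjointness moves
the derivative off v. -/
lemma smoothForms_der {p : M.L2} (hp : p ∈ M.Cinf) :
    M.SmoothForms fun k => innerForm ((M.mulOp (M.D^[k] p)).comp der) der where
  deriv k u u' v v' hu hv := by
    have h1 := (Cinf.hasD_mulOp (Cinf.iterate_D hp k) (hasD_val_der u')).inner_skew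
      (hasD_val_der v')
    rw [inner_add_left, hu, hv] at h1
    simp only [innerForm_apply, ContinuousLinearMap.comp_apply, Function.iterate_succ_apply']
    linarith
  bound k u u' hu := by
    have h1 := Cinf.hasD_mulOp (Cinf.iterate_D hp k) (hasD_val_der u')
    rw [hu] at h1
    refine ⟨‖M.mulOp (M.D (M.D^[k] p)) (der u) + M.mulOp (M.D^[k] p) (der u')‖, fun v => ?_⟩
    simp only [innerForm_apply, ContinuousLinearMap.comp_apply]
    rw [h1.inner_skew (hasD_val_der v), abs_neg]
    exact abs_real_inner_le_norm _ _

lemma HasD.norm_T_sub_le_min {f g : M.L2} (h : M.HasD f g) (z : ℝ) :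
    ‖M.T z f - f‖ ≤ 2 * min 1 |z| * (‖f‖ + ‖g‖) := by
  rcases le_total 1 |z| with hz | hz
  · rw [min_eq_left hz]
    refine (norm_sub_le _ _).trans ?_
    rw [norm_T]
    linarith [norm_nonneg g]
  · rw [min_eq_right hz]
    refine (h.norm_T_sub_le z).trans ?_
    nlinarith [norm_nonneg g, norm_nonneg f, abs_nonneg z,
      mul_nonneg (norm_nonneg f) (abs_nonneg z), mul_nonneg (norm_nonneg g) (abs_nonneg z)]

lemma norm_T_val_sub_le (u : M.H1) (z : ℝ) :
    ‖M.T z (val u) - val u‖ ≤ 4 * min 1 |z| * ‖u‖ := by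
  refine ((hasD_val_der u).norm_T_sub_le_min z).trans ?_
  have : ‖val u‖ + ‖der u‖ ≤ 2 * ‖u‖ := by linarith [norm_val_le u, norm_der_le u]
  calc 2 * min 1 |z| * (‖val u‖ + ‖der u‖) ≤ 2 * min 1 |z| * (2 * ‖u‖) := by gcongr
    _ = _ := by ring

variable (M) in
/-- A family of bounded operators on `L²(Ω)` indexed by the jump size, together with its
successive commutators with `D`. -/
structure SmoothKernel (ν : Measure ℝ) (Q : ℕ → ℝ → M.L2 →L[ℝ] M.L2) : Prop where
  bound : ∀ k, ∃ C, 0 ≤ C ∧ ∀ z f, ‖Q k z f‖ ≤ C * ‖f‖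
  comm : ∀ k z f g, M.HasD f g → M.HasD (Q k z f) (Q (k + 1) z f + Q k z g)
  meas : ∀ f g, AEMeasurable (fun z => inner ℝ (Q 0 z f) g) ν

namespace SmoothKernel

variable {ν : Measure ℝ} {Q : ℕ → ℝ → M.L2 →L[ℝ] M.L2}

/-- On Dom D the commutation relation, tested against g, expresses the pairing for k + 1 through
pairings for k; mollification extends this to all f and g. -/
lemma aemeasurable (hQ : M.SmoothKernel ν Q) (k : ℕ) (f g : M.L2) :
    AEMeasurable (fun z => inner ℝ (Q k z f) g) ν := by
  induction k generalizing f g with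
  | zero => exact hQ.meas f g
  | succ k ih =>
    have h1 : ∀ f f' g g' : M.L2, M.HasD f f' → M.HasD g g' →
        AEMeasurable (fun z => inner ℝ (Q (k + 1) z f) g) ν := by
      intro f f' g g' hf hg
      have : (fun z => inner ℝ (Q (k + 1) z f) g) =
          fun z => - inner ℝ (Q k z f) g' - inner ℝ (Q k z f') g := by
        funext z
        have := (hQ.comm k z f f' hf).inner_skew hg
        rw [inner_add_left] at this
        linarith
      rw [this]
      exact (ih f g').neg.sub (ih f' g)
    refine aemeasurable_of_tendsto_metrizable_ae atTop
      (f := fun n z => inner ℝ (Q (k + 1) z (M.moll n f)) (M.moll n g)) (fun n => ?_)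
      (Eventually.of_forall fun z => ?_)
    · obtain ⟨f', hf'⟩ := hasD_moll n f
      obtain ⟨g', hg'⟩ := hasD_moll n g
      exact h1 _ _ _ _ hf' hg'
    · exact (((Q (k + 1) z).continuous.tendsto _).comp (tendsto_moll f)).inner (tendsto_moll g)

lemma abs_inner_le {k : ℕ} {C : ℝ} (hC0 : 0 ≤ C)
    (hC : ∀ z f, ‖Q k z f‖ ≤ C * ‖f‖) (f g : M.H1) (z : ℝ) :
    |inner ℝ (Q k z (M.T z (val f) - val f)) (M.T z (val g) - val g)| ≤
      16 * C * ‖f‖ * ‖g‖ * levyWeight z := by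
  refine (abs_real_inner_le_norm _ _).trans ?_
  calc _ ≤ (C * (4 * min 1 |z| * ‖f‖)) * (4 * min 1 |z| * ‖g‖) := by
        gcongr
        · exact (hC z _).trans (mul_le_mul_of_nonneg_left (norm_T_val_sub_le f z) hC0)
        · exact norm_T_val_sub_le g z
    _ = _ := by unfold levyWeight; ring

lemma integrable (hQ : M.SmoothKernel ν Q) (hν : Integrable levyWeight ν) (k : ℕ) (f g : M.H1) :
    Integrable (fun z => inner ℝ (Q k z (M.T z (val f) - val f)) (M.T z (val g) - val g)) ν := by
  obtain ⟨C, hC0, hC⟩ := hQ.bound k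
  refine Integrable.mono' (hν.const_mul (16 * C * ‖f‖ * ‖g‖)) ?_
    (Eventually.of_forall fun z => abs_inner_le hC0 hC f g z)
  exact (aemeasurable_inner_of_continuous (hQ.aemeasurable k)
    ((M.continuous_T _).sub continuous_const)
    ((M.continuous_T _).sub continuous_const)).aestronglyMeasurable

open Classical in
/-- The form `(f, g) ↦ ∫ ⟨Q_z (T_z f - f), T_z g - g⟩ ν(dz)` on `H¹(Ω)`. -/
def form (hQ : M.SmoothKernel ν Q) (hν : Integrable levyWeight ν) (k : ℕ) :
    M.H1 →L[ℝ] M.H1 →L[ℝ] ℝ :=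
  LinearMap.mkContinuous₂
    (LinearMap.mk₂ ℝ
      (fun f g => ∫ z, inner ℝ (Q k z (M.T z (val f) - val f)) (M.T z (val g) - val g) ∂ν)
      (fun f f' g => by
        rw [← integral_add (hQ.integrable hν k f g) (hQ.integrable hν k f' g)]
        congr 1; funext z
        rw [← inner_add_left, ← map_add, map_add, T_map_add]
        congr 2; abel)
      (fun c f g => by
        rw [smul_eq_mul, ← integral_const_mul]
        congr 1; funext z
        rw [map_smul, T_map_smul, ← smul_sub, map_smul, inner_smul_left]; rfl)
      (fun f g g' => by
        rw [← integral_add (hQ.integrable hν k f g) (hQ.integrable hν k f g')]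
        congr 1; funext z
        rw [← inner_add_right, map_add, T_map_add]
        congr 1; abel)
      (fun c f g => by
        rw [smul_eq_mul, ← integral_const_mul]
        congr 1; funext z
        rw [map_smul, T_map_smul, ← smul_sub, inner_smul_right]))
    (16 * (hQ.bound k).choose * ∫ z, levyWeight z ∂ν) (fun f g => by
      rw [LinearMap.mk₂_apply]
      obtain ⟨hC0, hC⟩ := (hQ.bound k).choose_spec
      refine (norm_integral_le_of_norm_le (hν.const_mul _)
        (Eventually.of_forall fun z => abs_inner_le hC0 hC f g z)).trans (le_of_eq ?_)
      rw [integral_const_mul]; ring)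

lemma form_apply (hQ : M.SmoothKernel ν Q) (hν : Integrable levyWeight ν) (k : ℕ) (f g : M.H1) :
    hQ.form hν k f g =
      ∫ z, inner ℝ (Q k z (M.T z (val f) - val f)) (M.T z (val g) - val g) ∂ν := rfl

/-- For the L² bound, the difference of v is transferred to y = Q_z(T_z u − u). When u ∈ H², both y
and Dy are O(min(1, |z|)), so T_{-z} y − y is O(min(1, z²)), which is ν-integrable for every α in
(0, 2), and no derivative of v is needed. -/
lemma smoothForms (hQ : M.SmoothKernel ν Q) (hν : Integrable levyWeight ν) :
    M.SmoothForms (hQ.form hν) where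
  deriv k u u' v v' hu hv := by
    rw [form_apply, form_apply, form_apply, ← integral_add (hQ.integrable hν _ _ _)
      (hQ.integrable hν _ _ _), ← integral_neg]
    congr 1; funext z
    have h1 := ((hasD_val_der u).T z).sub (hasD_val_der u)
    have h2 := ((hasD_val_der v).T z).sub (hasD_val_der v)
    have h3 := (hQ.comm k z _ _ h1).inner_skew h2
    rw [inner_add_left] at h3
    rw [hu, hv]
    linarith
  bound k u u' hu := by
    obtain ⟨C, hC0, hC⟩ := hQ.bound k
    obtain ⟨C', hC0', hC'⟩ := hQ.bound (k + 1)
    refine ⟨8 * (C * ‖u‖ + C' * ‖u‖ + C * ‖u'‖) * ∫ z, levyWeight z ∂ν, fun v => ?_⟩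
    rw [form_apply]
    have hb : ∀ z, ‖inner ℝ (Q k z (M.T z (val u) - val u)) (M.T z (val v) - val v)‖ ≤
        8 * (C * ‖u‖ + C' * ‖u‖ + C * ‖u'‖) * ‖val v‖ * levyWeight z := by
      intro z
      set y := Q k z (M.T z (val u) - val u) with hy
      have h1 := hQ.comm k z _ _ (((hasD_val_der u).T z).sub (hasD_val_der u))
      set y' := Q (k + 1) z (M.T z (val u) - val u) + Q k z (M.T z (der u) - der u) with hy'
      have e : inner ℝ y (M.T z (val v) - val v) = inner ℝ (M.T (-z) y - y) (val v) := by
        rw [inner_sub_right, inner_sub_left, inner_T_left, neg_neg]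
      have b1 : ‖y‖ ≤ C * (4 * min 1 |z| * ‖u‖) :=
        (hC z _).trans (mul_le_mul_of_nonneg_left (norm_T_val_sub_le u z) hC0)
      have b2 : ‖y'‖ ≤ C' * (4 * min 1 |z| * ‖u‖) + C * (4 * min 1 |z| * ‖u'‖) := by
        refine (norm_add_le _ _).trans (add_le_add ?_ ?_)
        · exact (hC' z _).trans (mul_le_mul_of_nonneg_left (norm_T_val_sub_le u z) hC0')
        · rw [← hu]
          exact (hC z _).trans (mul_le_mul_of_nonneg_left (norm_T_val_sub_le u' z) hC0)
      have b3 := h1.norm_T_sub_le_min (-z)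
      rw [abs_neg] at b3
      rw [e]
      refine (abs_real_inner_le_norm _ _).trans ?_
      calc _ ≤ (2 * min 1 |z| * (C * (4 * min 1 |z| * ‖u‖) +
            (C' * (4 * min 1 |z| * ‖u‖) + C * (4 * min 1 |z| * ‖u'‖)))) * ‖val v‖ := by
            gcongr
            exact b3.trans (by gcongr)
        _ = _ := by unfold levyWeight; ring
    refine (norm_integral_le_of_norm_le (hν.const_mul _)
        (Eventually.of_forall hb)).trans (le_of_eq ?_)
    rw [integral_const_mul]; ring

end SmoothKernel

end RandomMedium

/-! ### The form B_λ^ε: identification with smooth forms, and coercivity. -/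

namespace RandomMedium

variable {Ω : Type*} [MeasurableSpace Ω] {M : RandomMedium Ω}

lemma BddBy.le_inner_mulOp {p : M.L2} {C κ : ℝ} (h : M.BddBy p C) (hκ : ∀ᵐ ω ∂M.μ, κ ≤ p ω)
    (f : M.L2) : κ * ‖f‖ ^ 2 ≤ inner ℝ (M.mulOp p f) f := by
  rw [← real_inner_self_eq_norm_sq, inner_eq_integral, inner_eq_integral, ← integral_const_mul]
  have h1 : Integrable (fun ω => f ω * f ω) M.μ := (Lp.memLp f).integrable_mul (Lp.memLp f)
  have h2 : Integrable (fun ω => M.mulOp p f ω * f ω) M.μ :=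
    (Lp.memLp (M.mulOp p f)).integrable_mul (Lp.memLp f)
  refine integral_mono_ae (h1.const_mul κ) h2 ?_
  filter_upwards [h.mulOp_coeFn f, hκ] with ω e1 e2
  simp only [e1]
  nlinarith [mul_self_nonneg (f ω)]

lemma integral_abs_mul_le (f g : M.L2) : ∫ ω, |f ω * g ω| ∂M.μ ≤ ‖f‖ * ‖g‖ := by
  have : ∫ ω, |f ω * g ω| ∂M.μ = inner ℝ |f| |g| := by
    rw [inner_eq_integral]
    refine integral_congr_ae ?_
    filter_upwards [Lp.coeFn_abs f, Lp.coeFn_abs g] with ω h1 h2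
    rw [h1, h2, abs_mul]
  rw [this]
  refine (real_inner_le_norm _ _).trans ?_
  rw [norm_abs_eq_norm, norm_abs_eq_norm]

end RandomMedium

namespace Coefficients

open RandomMedium

variable {Ω : Type*} [MeasurableSpace Ω] {M : RandomMedium Ω} (A : Coefficients M)

lemma exists_exp (r : ℝ) : ∃ E ∈ M.Cinf, E =ᵐ[M.μ] fun ω => Real.exp (r * A.V ω) := by
  obtain ⟨V, hV, hVe⟩ := memCinf_iff.1 A.smooth_V
  obtain ⟨E, hE, hEe⟩ := Cinf.exp (Cinf.smul r hV)
  refine ⟨E, hE, ?_⟩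
  filter_upwards [hVe, hEe, Lp.coeFn_smul r V] with ω h1 h2 h3
  rw [h2, h3, Pi.smul_apply, h1, smul_eq_mul]

/-- The function `e^{r V}` as an element of `C^∞(Ω)`. -/
def expV (r : ℝ) : M.L2 := (A.exists_exp r).choose

lemma expV_mem (r : ℝ) : A.expV r ∈ M.Cinf := (A.exists_exp r).choose_spec.1

lemma expV_coeFn (r : ℝ) : A.expV r =ᵐ[M.μ] fun ω => Real.exp (r * A.V ω) :=
  (A.exists_exp r).choose_spec.2

lemma exists_le_expV (r : ℝ) : ∃ κ, 0 < κ ∧ ∀ᵐ ω ∂M.μ, κ ≤ A.expV r ω := by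
  obtain ⟨C, hC⟩ := Cinf.bdd (A.expV_mem (-r))
  refine ⟨(C + 1)⁻¹, inv_pos.2 (by linarith [hC.nonneg]), ?_⟩
  filter_upwards [hC, A.expV_coeFn r, A.expV_coeFn (-r)] with ω h1 h2 h3
  rw [h3, Real.abs_exp, neg_mul, Real.exp_neg] at h1
  rw [h2]
  refine inv_le_of_inv_le₀ (Real.exp_pos _) ?_
  linarith

lemma exists_diffusion : ∃ p ∈ M.Cinf,
    p =ᵐ[M.μ] fun ω => A.σ ω ^ 2 * Real.exp (-2 * A.V ω) := by
  obtain ⟨s, hs, hse⟩ := memCinf_iff.1 A.smooth_σ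
  refine ⟨M.mulOp s (M.mulOp s (A.expV (-2))), Cinf.mulOp hs (Cinf.mulOp hs (A.expV_mem _)), ?_⟩
  obtain ⟨C, hC⟩ := Cinf.bdd hs
  filter_upwards [hC.mulOp_coeFn (A.expV (-2)), hC.mulOp_coeFn (M.mulOp s (A.expV (-2))), hse,
    A.expV_coeFn (-2)] with ω h1 h2 h3 h4
  rw [h2, h1, h3, h4]; ring

lemma innerPi_eq (f g : M.L2) : A.innerPi f g = inner ℝ (M.mulOp (A.expV (-2)) f) g := by
  obtain ⟨C, hC⟩ := Cinf.bdd (A.expV_mem (-2))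
  rw [hC.inner_mulOp_eq_integral, innerPi]
  refine integral_congr_ae ?_
  filter_upwards [A.expV_coeFn (-2)] with ω h
  rw [h]; ring

/-- The regular jump sizes: those `z` for which `c(·, z)` is nonnegative and in `C^∞(Ω)` with the
bounds `C k` on its derivatives. -/
def IsRegularAt (C : ℕ → ℝ) (z : ℝ) (q : M.L2) : Prop :=
  q ∈ M.Cinf ∧ (q =ᵐ[M.μ] fun ω => A.c ω z) ∧ (∀ k, M.BddBy (M.D^[k] q) (C k)) ∧
    ∀ᵐ ω ∂M.μ, 0 ≤ q ω

/-- Ellipticity is given for a.e. ω and then a.e. z; Fubini exchanges the two. Taking the maximum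
with K makes `C 0` a bound for c itself and every `C k` nonnegative. -/
lemma exists_regular : ∃ C : ℕ → ℝ, (∀ k, 0 ≤ C k) ∧ ∀ᵐ z : ℝ, ∃ q, A.IsRegularAt C z q := by
  obtain ⟨K, hK, -, hc⟩ := A.elliptic
  have hcm : MeasurableSet {p : Ω × ℝ | K⁻¹ ≤ A.c p.1 p.2 ∧ A.c p.1 p.2 ≤ K} :=
    (measurableSet_le measurable_const A.measurable_c).inter
      (measurableSet_le A.measurable_c measurable_const)
  have hc' : ∀ᵐ z : ℝ, ∀ᵐ ω ∂M.μ, K⁻¹ ≤ A.c ω z ∧ A.c ω z ≤ K :=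
    (Measure.ae_ae_comm hcm).1 hc
  have hb : ∀ k, ∃ C : ℝ, 1 ≤ k → ∀ᵐ z : ℝ, M.DerivBoundedBy (fun ω => A.c ω z) k C := by
    intro k
    by_cases hk : 1 ≤ k
    · obtain ⟨C, hC⟩ := A.smooth_c_bound k hk
      exact ⟨C, fun _ => hC⟩
    · exact ⟨0, fun h => absurd h hk⟩
  choose C hC using hb
  refine ⟨fun k => max K |C k|, fun k => le_max_of_le_left hK.le, ?_⟩
  have hall : ∀ᵐ z : ℝ, ∀ k, 1 ≤ k → M.DerivBoundedBy (fun ω => A.c ω z) k (C k) := by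
    rw [ae_all_iff]
    intro k
    by_cases hk : 1 ≤ k
    · exact (hC k hk).mono fun _ h _ => h
    · exact Eventually.of_forall fun _ h => absurd h hk
  filter_upwards [hc', hall, A.smooth_c] with z h1 h2 h3
  obtain ⟨q, hq, hqe⟩ := memCinf_iff.1 h3
  refine ⟨q, hq, hqe, fun k => ?_, ?_⟩
  · rcases Nat.eq_zero_or_pos k with rfl | hk
    · filter_upwards [hqe, h1] with ω e1 e2
      rw [Function.iterate_zero, id, e1, abs_of_nonneg ((inv_pos.2 hK).le.trans e2.1)]
      exact e2.2.trans (le_max_left _ _)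
    · obtain ⟨f, hf, -, hfb⟩ := h2 k hk
      have : f = q := Lp.ext (hf.trans hqe.symm)
      rw [← this]
      exact BddBy.mono hfb ((le_abs_self _).trans (le_max_right _ _))
  · filter_upwards [hqe, h1] with ω e1 e2
    rw [e1]
    exact (inv_pos.2 hK).le.trans e2.1

open Classical in
/-- The operators of multiplication by `D^k c(·, z)`. -/
def jumpOp (C : ℕ → ℝ) (k : ℕ) (z : ℝ) : M.L2 →L[ℝ] M.L2 :=
  -- The value 0 at irregular z lets the bounds and commutation relations of `SmoothKernel` hold for
  -- every z, not just almost every z.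
  if h : ∃ q, A.IsRegularAt C z q then M.mulOp (M.D^[k] h.choose) else 0

lemma jumpOp_eq {C : ℕ → ℝ} {z : ℝ} {q : M.L2} (h : A.IsRegularAt C z q) (k : ℕ) :
    A.jumpOp C k z = M.mulOp (M.D^[k] q) := by
  have hex : ∃ q, A.IsRegularAt C z q := ⟨q, h⟩
  have : hex.choose = q := Lp.ext (hex.choose_spec.2.1.trans h.2.1.symm)
  rw [jumpOp, dif_pos hex, this]

lemma jumpOp_eq_zero {C : ℕ → ℝ} {z : ℝ} (h : ¬ ∃ q, A.IsRegularAt C z q) (k : ℕ) :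
    A.jumpOp C k z = 0 := by
  rw [jumpOp, dif_neg h]

lemma levyMeasure_absolutelyContinuous (α : ℝ) : levyMeasure α ≪ volume :=
  withDensity_absolutelyContinuous _ _

instance sFinite_levyMeasure (α : ℝ) : SFinite (levyMeasure α) := by
  unfold levyMeasure; infer_instance

lemma smoothKernel_jumpOp {C : ℕ → ℝ} (hC0 : ∀ k, 0 ≤ C k)
    (hC : ∀ᵐ z : ℝ, ∃ q, A.IsRegularAt C z q) :
    M.SmoothKernel (levyMeasure A.α) (A.jumpOp C) where
  bound k := by
    refine ⟨C k, hC0 k, fun z f => ?_⟩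
    by_cases h : ∃ q, A.IsRegularAt C z q
    · obtain ⟨q, hq⟩ := h
      rw [A.jumpOp_eq hq]
      exact (hq.2.2.1 k).norm_mulOp_le f
    · rw [A.jumpOp_eq_zero h, zero_apply, norm_zero]
      exact mul_nonneg (hC0 k) (norm_nonneg _)
  comm k z f g hf := by
    by_cases h : ∃ q, A.IsRegularAt C z q
    · obtain ⟨q, hq⟩ := h
      rw [A.jumpOp_eq hq, A.jumpOp_eq hq, Function.iterate_succ_apply']
      exact Cinf.hasD_mulOp (Cinf.iterate_D hq.1 k) hf
    · rw [A.jumpOp_eq_zero h, A.jumpOp_eq_zero h]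
      simpa using hasD_zero
  meas f g := by
    have hm : Measurable fun z => ∫ ω, A.c ω z * f ω * g ω ∂M.μ := by
      have : StronglyMeasurable fun p : ℝ × Ω => A.c p.2 p.1 * f p.2 * g p.2 :=
        (((A.measurable_c.comp measurable_swap).mul
          ((Lp.stronglyMeasurable f).measurable.comp measurable_snd)).mul
          ((Lp.stronglyMeasurable g).measurable.comp measurable_snd)).stronglyMeasurable
      exact this.integral_prod_right.measurable
    refine (hm.aemeasurable (μ := volume)).congr ?_ |>.mono_ac
      (levyMeasure_absolutelyContinuous A.α)
    filter_upwards [hC] with z hz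
    obtain ⟨q, hq⟩ := hz
    rw [A.jumpOp_eq hq, (hq.2.2.1 0).inner_mulOp_eq_integral]
    refine integral_congr_ae ?_
    filter_upwards [hq.2.1] with ω h
    rw [Function.iterate_zero, id, h]

/-- Fubini exchanges the integrals in ω and z. Integrability on the product comes from
Cauchy–Schwarz at fixed z, which leaves a multiple of `levyWeight`. -/
lemma Bj_eq {C : ℕ → ℝ} (hC0 : ∀ k, 0 ≤ C k) (hC : ∀ᵐ z : ℝ, ∃ q, A.IsRegularAt C z q)
    (u v : M.H1) :
    A.Bj (val u) (val v) = (1 / 2) * (A.smoothKernel_jumpOp hC0 hC).form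
      (integrable_levyWeight A.α_pos A.α_lt) 0 u v := by
  set f := val u with hf
  set g := val v with hg
  set ν := levyMeasure A.α with hν
  have hint := (A.smoothKernel_jumpOp hC0 hC).integrable
      (integrable_levyWeight A.α_pos A.α_lt) 0 u v
  rw [← hf, ← hg] at hint
  let F : Ω → ℝ → ℝ := fun ω z => (f (M.τ z ω) - f ω) * (g (M.τ z ω) - g ω) * A.c ω z
  have hFm : Measurable (Function.uncurry F) := by
    have hτ : Measurable fun p : Ω × ℝ => M.τ p.2 p.1 := M.measurable_τ.comp measurable_swap
    have hfm := (Lp.stronglyMeasurable f).measurable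
    have hgm := (Lp.stronglyMeasurable g).measurable
    exact (((hfm.comp hτ).sub (hfm.comp measurable_fst)).mul
      ((hgm.comp hτ).sub (hgm.comp measurable_fst))).mul A.measurable_c
  have hCν : ∀ᵐ z ∂ν, ∃ q, A.IsRegularAt C z q := levyMeasure_absolutelyContinuous A.α hC
  have hFe : ∀ z q, A.IsRegularAt C z q → (fun ω => F ω z) =ᵐ[M.μ] fun ω =>
      (M.mulOp q (M.T z f - f)) ω * (M.T z g - g) ω := by
    intro z q hq
    filter_upwards [(hq.2.2.1 0).mulOp_coeFn (M.T z f - f), hq.2.1, Lp.coeFn_sub (M.T z f) f,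
      Lp.coeFn_sub (M.T z g) g, M.T_coeFn z f, M.T_coeFn z g] with ω h1 h2 h3 h4 h5 h6
    rw [Function.iterate_zero, id] at h1
    rw [h1, h2, h3, h4, Pi.sub_apply, Pi.sub_apply, h5, h6]
    simp only [F]; ring
  have hFint : Integrable (Function.uncurry F) (M.μ.prod ν) := by
    rw [integrable_prod_iff' hFm.aestronglyMeasurable]
    constructor
    · filter_upwards [hCν] with z ⟨q, hq⟩
      refine Integrable.congr ?_ (hFe z q hq).symm
      exact (Lp.memLp (M.mulOp q (M.T z f - f))).integrable_mul (Lp.memLp (M.T z g - g))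
    · refine Integrable.mono' ((integrable_levyWeight A.α_pos A.α_lt).const_mul
        (16 * C 0 * ‖u‖ * ‖v‖)) ?_ ?_
      · exact (hFm.stronglyMeasurable.norm.comp_measurable
          measurable_swap).integral_prod_right'.aestronglyMeasurable
      · filter_upwards [hCν] with z ⟨q, hq⟩
        have e : ∫ ω, ‖Function.uncurry F (ω, z)‖ ∂M.μ =
            ∫ ω, |(M.mulOp q (M.T z f - f)) ω * (M.T z g - g) ω| ∂M.μ := by
          refine integral_congr_ae ?_
          filter_upwards [hFe z q hq] with ω h
          rw [← h]; rfl
        rw [e, Real.norm_eq_abs, abs_of_nonneg (integral_nonneg fun _ => abs_nonneg _)]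
        refine (integral_abs_mul_le _ _).trans ?_
        have b1 : ‖M.mulOp q (M.T z f - f)‖ ≤ C 0 * ‖M.T z f - f‖ := (hq.2.2.1 0).norm_mulOp_le _
        have b2 := norm_T_val_sub_le u z
        have b3 := norm_T_val_sub_le v z
        calc _ ≤ (C 0 * (4 * min 1 |z| * ‖u‖)) * (4 * min 1 |z| * ‖v‖) := by
              have := hC0 0
              gcongr
              exact b1.trans (by gcongr)
          _ = _ := by unfold levyWeight; ring
  rw [Bj, SmoothKernel.form_apply]
  congr 1
  change ∫ ω, ∫ z, F ω z ∂ν ∂M.μ = _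
  rw [integral_integral_swap hFint]
  refine integral_congr_ae ?_
  filter_upwards [hCν] with z ⟨q, hq⟩
  rw [A.jumpOp_eq hq, inner_eq_integral]
  exact integral_congr_ae (hFe z q hq)

/-- The form `B_λ^ε` on `H¹(Ω)` is bounded and coercive, and has smooth coefficients. -/
theorem exists_smoothForms {ε : ℝ} (hε : 0 < ε) {lam : ℝ} (hlam : 0 < lam) :
    ∃ b : ℕ → M.H1 →L[ℝ] M.H1 →L[ℝ] ℝ, M.SmoothForms b ∧
      (∃ κ, 0 < κ ∧ ∀ u, κ * ‖u‖ ^ 2 ≤ b 0 u u) ∧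
      ∀ u v, b 0 u v = A.B ε lam (val u) (val v) := by
  obtain ⟨C, hC0, hC⟩ := A.exists_regular
  obtain ⟨p, hp, hpe⟩ := A.exists_diffusion
  have hQ := A.smoothKernel_jumpOp hC0 hC
  have hν := integrable_levyWeight A.α_pos A.α_lt
  have hε' : 0 ≤ ε ^ (2 - A.α) := Real.rpow_nonneg hε.le _
  obtain ⟨C1, hC1⟩ := Cinf.bdd hp
  obtain ⟨C2, hC2⟩ := Cinf.bdd (A.expV_mem (-2))
  obtain ⟨κ, hκ, hκe⟩ := A.exists_le_expV (-2)
  obtain ⟨K, hK, hKa, -⟩ := A.elliptic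
  refine ⟨_, (((smoothForms_val (A.expV_mem (-2))).smul lam).add
    ((smoothForms_der hp).smul (1 / 2))).add ((hQ.smoothForms hν).smul (ε ^ (2 - A.α) * (1 / 2))),
    -- κ bounds e^{-2V} from below and K⁻¹ bounds a from below: the zero order and diffusion parts
    -- alone give coercivity, the jump part being nonnegative.
    ⟨min (lam * κ) (1 / 2 * (K⁻¹ * κ)), lt_min (by positivity) (by positivity), fun u => ?_⟩,
    fun u v => ?_⟩
  · simp only [add_apply, smul_apply, smul_eq_mul, innerForm_apply, ContinuousLinearMap.comp_apply,
      Function.iterate_zero, id]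
    have h1 := hC2.le_inner_mulOp hκe (val u)
    have h2 := hC1.le_inner_mulOp (κ := K⁻¹ * κ) (by
      filter_upwards [hpe, hKa, hκe, A.expV_coeFn (-2)] with ω e1 e2 e3 e4
      rw [e1, ← e4]
      exact mul_le_mul e2.1 e3 hκ.le (sq_nonneg _)) (der u)
    have h3 : 0 ≤ hQ.form hν 0 u u := by
      rw [SmoothKernel.form_apply]
      refine integral_nonneg_of_ae ?_
      filter_upwards [levyMeasure_absolutelyContinuous A.α hC] with z ⟨q, hq⟩
      rw [A.jumpOp_eq hq]
      have := (hq.2.2.1 0).le_inner_mulOp hq.2.2.2 (M.T z (val u) - val u)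
      simpa using this
    rw [norm_sq_H1, mul_add]
    have h4 : min (lam * κ) (1 / 2 * (K⁻¹ * κ)) * ‖val u‖ ^ 2 ≤ lam * κ * ‖val u‖ ^ 2 := by
      gcongr; exact min_le_left _ _
    have h5 : min (lam * κ) (1 / 2 * (K⁻¹ * κ)) * ‖der u‖ ^ 2 ≤
        1 / 2 * (K⁻¹ * κ) * ‖der u‖ ^ 2 := by
      gcongr; exact min_le_right _ _
    have h6 := mul_le_mul_of_nonneg_left h1 hlam.le
    have h7 := mul_nonneg (mul_nonneg hε' (by norm_num : (0:ℝ) ≤ 1 / 2)) h3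
    linarith
  · simp only [add_apply, smul_apply, smul_eq_mul, innerForm_apply, ContinuousLinearMap.comp_apply,
      Function.iterate_zero, id]
    rw [B, A.Bj_eq hC0 hC, A.innerPi_eq, Bd, (hasD_val_der u).D_eq, (hasD_val_der v).D_eq,
      hC1.inner_mulOp_eq_integral]
    have : ∫ ω, A.σ ω ^ 2 * (der u) ω * (der v) ω * Real.exp (-2 * A.V ω) ∂M.μ =
        ∫ ω, p ω * (der u) ω * (der v) ω ∂M.μ := by
      refine integral_congr_ae ?_
      filter_upwards [hpe] with ω h
      rw [h]; ring
    rw [this]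
    ring

end Coefficients

/-! ### Regularization along orbits, and density of 𝒞 in H¹(Ω). -/

namespace RandomMedium

variable {Ω : Type*} [MeasurableSpace Ω] {M : RandomMedium Ω}

lemma integrable_smul_T {φ : ℝ → ℝ} (hφ : Continuous φ) (hc : HasCompactSupport φ) (f : M.L2) :
    Integrable fun x => φ x • M.T x f :=
  (hφ.smul (M.continuous_T f)).integrable_of_hasCompactSupport hc.smul_right

/-- The regularization `∫ φ(x) T_x f dx` of `f`. -/
def conv {φ : ℝ → ℝ} (hφ : Continuous φ) (hc : HasCompactSupport φ) : M.L2 →L[ℝ] M.L2 :=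
  LinearMap.mkContinuous
    { toFun := fun f => ∫ x, φ x • M.T x f
      map_add' := fun f g => by
        rw [← integral_add (integrable_smul_T hφ hc f) (integrable_smul_T hφ hc g)]
        simp only [T_map_add, smul_add]
      map_smul' := fun c f => by
        rw [RingHom.id_apply, ← integral_smul]
        simp only [T_map_smul, smul_comm c] }
    (∫ x, |φ x|) (fun f => by
      refine (norm_integral_le_integral_norm _).trans (le_of_eq ?_)
      rw [← integral_mul_const]
      simp only [norm_smul, norm_T, Real.norm_eq_abs])

lemma conv_apply {φ : ℝ → ℝ} (hφ : Continuous φ) (hc : HasCompactSupport φ) (f : M.L2) :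
    conv hφ hc f = ∫ x, φ x • M.T x f := rfl

lemma T_conv {φ : ℝ → ℝ} (hφ : Continuous φ) (hc : HasCompactSupport φ) (f : M.L2) (y : ℝ) :
    M.T y (conv hφ hc f) = conv hφ hc (M.T y f) := by
  have := (M.Tl y).toContinuousLinearMap.integral_comp_comm (integrable_smul_T hφ hc f)
  refine this.symm.trans ?_
  rw [conv_apply]
  congr 1; funext x
  exact (M.T_map_smul y (φ x) _).trans (by rw [T_comm])

lemma HasD.conv {φ : ℝ → ℝ} (hφ : Continuous φ) (hc : HasCompactSupport φ) {f g : M.L2}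
    (h : M.HasD f g) : M.HasD (conv hφ hc f) (RandomMedium.conv hφ hc g) := by
  unfold HasD
  simp_rw [T_conv]
  exact (ContinuousLinearMap.hasFDerivAt _).comp_hasDerivAt (0 : ℝ) h

lemma convolution_eq_conv {φ : ℝ → ℝ} (hφ : Continuous φ) (hc : HasCompactSupport φ) (f : M.L2)
    (y : ℝ) : convolution φ (fun x => M.T (-x) f) (ContinuousLinearMap.lsmul ℝ ℝ) volume y =
      M.T (-y) (conv hφ hc f) := by
  rw [T_conv, conv_apply, convolution]
  congr 1; funext x
  rw [ContinuousLinearMap.lsmul_apply, ← T_add]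
  congr 2; ring

/-- T_{-y} of the regularization is the convolution at y of φ with x ↦ T_{-x} f, so the derivative
falls on φ; the sign comes from y ↦ −y. -/
lemma hasD_conv {φ : ℝ → ℝ} (hφ : ContDiff ℝ (⊤ : ℕ∞) φ) (hc : HasCompactSupport φ) (f : M.L2) :
    M.HasD (conv hφ.continuous hc f)
      (-(conv (hφ.continuous_deriv (by simp)) hc.deriv f)) := by
  have hcont : Continuous fun x : ℝ => M.T (-x) f := (M.continuous_T f).comp continuous_neg
  have h1 := hc.hasDerivAt_convolution_left (ContinuousLinearMap.lsmul ℝ ℝ) (μ := volume)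
    (hφ.of_le (by simp)) hcont.locallyIntegrable (0 : ℝ)
  have e1 : convolution φ (fun x => M.T (-x) f) (ContinuousLinearMap.lsmul ℝ ℝ) volume =
      fun y => M.T (-y) (conv hφ.continuous hc f) :=
    funext fun y => convolution_eq_conv hφ.continuous hc f y
  rw [convolution_eq_conv (hφ.continuous_deriv (by simp)) hc.deriv, e1, neg_zero, T_zero] at h1
  have h2 := HasDerivAt.scomp (𝕜 := ℝ) (𝕜' := ℝ) (h := fun y : ℝ => -y) (0 : ℝ)
    (by rw [neg_zero]; exact h1) (hasDerivAt_neg (0 : ℝ))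
  rw [neg_one_smul] at h2
  unfold HasD
  refine h2.congr_of_eventuallyEq (Eventually.of_forall fun y => ?_)
  simp

/-- The L²-valued integral has no pointwise meaning a priori, so the two sides are compared by their
integrals over measurable sets, where Fubini applies. This ties regularizations to the pointwise
generators of 𝒞. -/
lemma conv_coeFn {φ : ℝ → ℝ} (hφ : Continuous φ) (hc : HasCompactSupport φ) {f : M.L2}
    {g : Ω → ℝ} (hg : Measurable g) {C : ℝ} (hC : ∀ ω, ‖g ω‖ ≤ C) (hfg : f =ᵐ[M.μ] g) :
    conv hφ hc f =ᵐ[M.μ] fun ω => ∫ x, g (M.τ x ω) * φ x := by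
  have hjoint : Integrable (fun p : Ω × ℝ => g (M.τ p.2 p.1) * φ p.2) (M.μ.prod volume) := by
    refine Integrable.bdd_mul (c := C) ((hφ.integrable_of_hasCompactSupport hc).comp_snd M.μ)
      ((hg.comp (M.measurable_τ.comp measurable_swap)).aestronglyMeasurable)
      (Eventually.of_forall fun p => hC _)
  refine Integrable.ae_eq_of_forall_setIntegral_eq _ _ ((Lp.memLp _).integrable (by norm_num))
    hjoint.integral_prod_left fun s hs hμs => ?_
  rw [← L2.inner_indicatorConstLp_one hs hμs.ne, conv_apply,
    ← integral_inner (integrable_smul_T hφ hc f)]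
  have e : ∀ x, inner ℝ (indicatorConstLp 2 hs hμs.ne (1 : ℝ)) (φ x • M.T x f) =
      ∫ ω in s, g (M.τ x ω) * φ x ∂M.μ := by
    intro x
    rw [inner_smul_right, L2.inner_indicatorConstLp_one, integral_mul_const, mul_comm]
    congr 1
    refine setIntegral_congr_ae hs ?_
    filter_upwards [M.T_coeFn x f, M.ae_τ x hfg] with ω h1 h2 _
    rw [h1, h2]
  simp_rw [e]
  refine integral_integral_swap (f := fun x ω => g (M.τ x ω) * φ x) ?_
  have := hjoint.restrict (s := s ×ˢ Set.univ)
  rw [← Measure.prod_restrict, Measure.restrict_univ] at this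
  exact this.swap

/-- Regularizations of simple functions lie in 𝒞. For fixed φ, regularization is continuous from L²
to H¹, so those of every f lie in the closure. Finally, it commutes with D, so along an approximate
identity it converges to u in H¹, not only in L². -/
lemma H1_mem_closure_testSpace (u : M.H1) :
    u ∈ closure {u : M.H1 | val u ∈ M.testSpace} := by
  have hsimple : ∀ {φ : ℝ → ℝ} (hφ : ContDiff ℝ (⊤ : ℕ∞) φ) (hc : HasCompactSupport φ) (f : M.L2),
      (hasD_conv hφ hc f).toH1 ∈ closure {u : M.H1 | val u ∈ M.testSpace} := by
    intro φ hφ hc f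
    have hcont : Continuous fun f : M.L2 => (hasD_conv hφ hc f).toH1 := by
      have hLip : ∀ f g : M.L2, (hasD_conv hφ hc f).toH1 - (hasD_conv hφ hc g).toH1 =
          (hasD_conv hφ hc (f - g)).toH1 := fun f g => H1_ext (by simp)
      rw [continuous_iff_continuousAt]
      intro f
      rw [ContinuousAt, tendsto_iff_norm_sub_tendsto_zero]
      simp_rw [hLip]
      have h0 : Tendsto (fun g => ‖conv hφ.continuous hc (g - f)‖ +
          ‖-(conv (hφ.continuous_deriv (by simp)) hc.deriv (g - f))‖) (𝓝 f) (𝓝 0) := by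
        have : Continuous fun g => ‖conv hφ.continuous hc (g - f)‖ +
          ‖-(conv (hφ.continuous_deriv (by simp)) hc.deriv (g - f))‖ := by fun_prop
        simpa using this.tendsto f
      exact squeeze_zero (fun _ => norm_nonneg _) (fun g => norm_H1_le _) h0
    refine (Lp.simpleFunc.denseRange (E := ℝ) (μ := M.μ) (p := 2) (by norm_num)).induction_on
      (p := fun f => (hasD_conv hφ hc f).toH1 ∈ closure {u : M.H1 | val u ∈ M.testSpace}) f
      (isClosed_closure.preimage hcont) fun s => subset_closure ?_
    obtain ⟨C, hC⟩ := (Lp.simpleFunc.toSimpleFunc s).exists_forall_norm_le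
    refine Submodule.subset_span ⟨Lp.simpleFunc.toSimpleFunc s, φ,
      MemLp.of_bound (SimpleFunc.aestronglyMeasurable _) C (Eventually.of_forall hC), hφ, hc, ?_⟩
    exact conv_coeFn hφ.continuous hc (Lp.simpleFunc.measurable s) hC
      (Lp.simpleFunc.toSimpleFunc_eq_toFun s).symm
  let φ : ℕ → ContDiffBump (0 : ℝ) := fun n =>
    ⟨1 / ((n : ℝ) + 2), 1 / ((n : ℝ) + 1), by positivity, by
      apply one_div_lt_one_div_of_lt <;> linarith [(Nat.cast_nonneg n : (0:ℝ) ≤ n)]⟩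
  have hφ : ∀ n, ContDiff ℝ (⊤ : ℕ∞) ((φ n).normed volume) := fun n => (φ n).contDiff_normed
  have hc : ∀ n, HasCompactSupport ((φ n).normed volume) := fun n => (φ n).hasCompactSupport_normed
  have hlim : ∀ f : M.L2, Tendsto (fun n => conv (hφ n).continuous (hc n) f) atTop (𝓝 f) := by
    intro f
    have hcont : Continuous fun x : ℝ => M.T (-x) f := (M.continuous_T f).comp continuous_neg
    have := ContDiffBump.convolution_tendsto_right_of_continuous (φ := φ) (l := atTop)
      (μ := volume) (by exact tendsto_one_div_add_atTop_nhds_zero_nat) hcont (0 : ℝ)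
    simp_rw [fun n => convolution_eq_conv (hφ n).continuous (hc n) f 0, neg_zero, T_zero] at this
    exact this
  have hu : ∀ n, (hasD_conv (hφ n) (hc n) (val u)).toH1 =
      ((hasD_val_der u).conv (hφ n).continuous (hc n)).toH1 := fun n => H1_ext rfl
  refine isClosed_closure.mem_of_tendsto (f := fun n => (hasD_conv (hφ n) (hc n) (val u)).toH1)
    (b := atTop) ?_ (Eventually.of_forall fun n => hsimple (hφ n) (hc n) (val u))
  rw [tendsto_iff_norm_sub_tendsto_zero]
  have h3 := (tendsto_iff_norm_sub_tendsto_zero.1 (hlim (val u))).add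
    (tendsto_iff_norm_sub_tendsto_zero.1 (hlim (der u)))
  rw [add_zero] at h3
  refine squeeze_zero (fun _ => norm_nonneg _) (fun n => ?_) h3
  rw [hu]
  exact (norm_H1_le _).trans (by simp)

end RandomMedium

namespace Coefficients

open RandomMedium

variable {Ω : Type*} [MeasurableSpace Ω] {M : RandomMedium Ω} (A : Coefficients M)

/-- The form is continuous on H¹, where 𝒞 is dense, so ℍ does not depend on ε or λ. -/
lemma formDomain_eq {ε : ℝ} (hε : 0 < ε) {lam : ℝ} (hlam : 0 < lam) :
    A.formDomain ε lam = M.domD := by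
  refine Set.Subset.antisymm (fun f hf => hf.1) fun f hf => ⟨hf, ?_⟩
  obtain ⟨b, -, -, hb⟩ := A.exists_smoothForms hε hlam
  set u := (hasD_of_mem hf).toH1 with hu
  obtain ⟨v, hv, hvu⟩ := mem_closure_iff_seq_limit.1 (H1_mem_closure_testSpace u)
  refine ⟨fun n => val (v n), hv, ?_⟩
  have e : ∀ n, A.B ε lam (val (v n) - f) (val (v n) - f) = b 0 (v n - u) (v n - u) := by
    intro n
    rw [hb, map_sub]; rfl
  simp_rw [e]
  have hc : Continuous fun w : M.H1 => b 0 (w - u) (w - u) := by fun_prop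
  simpa [Function.comp_def] using (hc.tendsto u).comp hvu

end Coefficients

/-! ### Taking absolute values does not increase the energy; algebra of the forms. -/

namespace RandomMedium

variable {Ω : Type*} [MeasurableSpace Ω] {M : RandomMedium Ω}

lemma BddBy.inner_mulOp_mono {p : M.L2} {C : ℝ} (h : M.BddBy p C) (hp : ∀ᵐ ω ∂M.μ, 0 ≤ p ω)
    {f g : M.L2} (hfg : ∀ᵐ ω ∂M.μ, |f ω| ≤ |g ω|) :
    inner ℝ (M.mulOp p f) f ≤ inner ℝ (M.mulOp p g) g := by
  rw [inner_eq_integral, inner_eq_integral]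
  refine integral_mono_ae ((Lp.memLp (M.mulOp p f)).integrable_mul (Lp.memLp f))
    ((Lp.memLp (M.mulOp p g)).integrable_mul (Lp.memLp g)) ?_
  filter_upwards [h.mulOp_coeFn f, h.mulOp_coeFn g, hp, hfg] with ω h1 h2 h3 h4
  simp only [h1, h2, mul_assoc]
  refine mul_le_mul_of_nonneg_left ?_ h3
  rw [← abs_mul_abs_self (f ω), ← abs_mul_abs_self (g ω)]
  exact mul_self_le_mul_self (abs_nonneg _) h4

lemma T_abs (x : ℝ) (f : M.L2) : M.T x |f| = |M.T x f| := by
  apply Lp.ext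
  filter_upwards [M.T_coeFn x |f|, Lp.coeFn_abs (M.T x f), M.T_coeFn x f,
    M.ae_τ x (Lp.coeFn_abs f)] with ω h1 h2 h3 h4
  rw [h1, h2, h3, h4]

lemma abs_T_abs_sub_le (x : ℝ) (f : M.L2) :
    ∀ᵐ ω ∂M.μ, |(M.T x |f| - |f|) ω| ≤ |(M.T x f - f) ω| := by
  rw [T_abs]
  filter_upwards [Lp.coeFn_sub |M.T x f| |f|, Lp.coeFn_sub (M.T x f) f,
    Lp.coeFn_abs (M.T x f), Lp.coeFn_abs f] with ω h1 h2 h3 h4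
  rw [h1, h2, Pi.sub_apply, Pi.sub_apply, h3, h4]
  exact abs_abs_sub_abs_le_abs_sub _ _

lemma abs_mem_domD {f : M.L2} (hf : f ∈ M.domD) : |f| ∈ M.domD := by
  refine domD_eq_of_bounded_quotient (C := ‖M.D f‖) fun x => ?_
  refine le_trans ?_ ((hasD_of_mem hf).norm_T_sub_le x)
  rw [T_abs]
  exact norm_abs_sub_abs _ _

end RandomMedium

namespace Coefficients

open RandomMedium

variable {Ω : Type*} [MeasurableSpace Ω] {M : RandomMedium Ω} (A : Coefficients M)

lemma innerPi_comm (f g : M.L2) : A.innerPi f g = A.innerPi g f := by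
  simp only [innerPi, mul_comm (f _) (g _)]

lemma Bd_comm (f g : M.L2) : A.Bd f g = A.Bd g f := by
  simp only [Bd, mul_assoc, mul_left_comm ((M.D f) _) ((M.D g) _)]

lemma Bj_comm (f g : M.L2) : A.Bj f g = A.Bj g f := by
  simp only [Bj, mul_comm (f _ - f _) (g _ - g _)]

lemma B_comm (ε lam : ℝ) (f g : M.L2) : A.B ε lam f g = A.B ε lam g f := by
  simp only [B, A.innerPi_comm f g, A.Bd_comm f g, A.Bj_comm f g]

lemma B_eq_add (ε lam lam' : ℝ) (f g : M.L2) :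
    A.B ε lam f g = A.B ε lam' f g + (lam - lam') * A.innerPi f g := by
  simp only [B]; ring

lemma innerPi_add_left (f f' g : M.L2) :
    A.innerPi (f + f') g = A.innerPi f g + A.innerPi f' g := by
  simp only [innerPi_eq, map_add, inner_add_left]

lemma innerPi_sub_left (f f' g : M.L2) :
    A.innerPi (f - f') g = A.innerPi f g - A.innerPi f' g := by
  simp only [innerPi_eq, map_sub, inner_sub_left]

lemma innerPi_smul_left (c : ℝ) (f g : M.L2) : A.innerPi (c • f) g = c * A.innerPi f g := by
  simp only [innerPi_eq, map_smul, inner_smul_left]; rfl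

lemma innerPi_sub_right (f g g' : M.L2) :
    A.innerPi f (g - g') = A.innerPi f g - A.innerPi f g' := by
  simp only [innerPi_eq, inner_sub_right]

lemma innerPi_smul_right (c : ℝ) (f g : M.L2) : A.innerPi f (c • g) = c * A.innerPi f g := by
  simp only [innerPi_eq, inner_smul_right]

lemma innerPi_nonneg {f g : M.L2} (hf : 0 ≤ f) (hg : 0 ≤ g) : 0 ≤ A.innerPi f g := by
  refine integral_nonneg_of_ae ?_
  filter_upwards [(Lp.coeFn_nonneg f).2 hf, (Lp.coeFn_nonneg g).2 hg] with ω h1 h2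
  exact mul_nonneg (mul_nonneg h1 h2) (Real.exp_pos _).le

lemma expV_mulOp_cancel (r : ℝ) (f : M.L2) :
    M.mulOp (A.expV r) (M.mulOp (A.expV (-r)) f) = f := by
  obtain ⟨C, hC⟩ := Cinf.bdd (A.expV_mem r)
  obtain ⟨C', hC'⟩ := Cinf.bdd (A.expV_mem (-r))
  apply Lp.ext
  filter_upwards [hC.mulOp_coeFn (M.mulOp (A.expV (-r)) f), hC'.mulOp_coeFn f, A.expV_coeFn r,
    A.expV_coeFn (-r)] with ω h1 h2 h3 h4
  rw [h1, h2, h3, h4, ← mul_assoc, ← Real.exp_add]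
  simp

lemma Bd_eq {p : M.L2} {C : ℝ} (hp : M.BddBy p C)
    (hpe : p =ᵐ[M.μ] fun ω => A.σ ω ^ 2 * Real.exp (-2 * A.V ω)) (f g : M.L2) :
    A.Bd f g = 1 / 2 * inner ℝ (M.mulOp p (M.D f)) (M.D g) := by
  rw [Bd, hp.inner_mulOp_eq_integral]
  congr 1
  refine integral_congr_ae ?_
  filter_upwards [hpe] with ω h
  rw [h]; ring

/-- A chain rule for |f| is avoided: the inequality holds pointwise for difference quotients, and
their weighted L² norms converge because |f| is in Dom D as well. -/
lemma Bd_abs_le {f : M.L2} (hf : f ∈ M.domD) : A.Bd |f| |f| ≤ A.Bd f f := by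
  obtain ⟨p, hp, hpe⟩ := A.exists_diffusion
  obtain ⟨C, hC⟩ := Cinf.bdd hp
  have hp0 : ∀ᵐ ω ∂M.μ, 0 ≤ p ω := by
    filter_upwards [hpe] with ω h
    rw [h]
    exact mul_nonneg (sq_nonneg _) (Real.exp_pos _).le
  rw [A.Bd_eq hC hpe, A.Bd_eq hC hpe]
  refine mul_le_mul_of_nonneg_left ?_ (by norm_num)
  have hlim : ∀ g ∈ M.domD, Tendsto (fun h : ℝ => inner ℝ (M.mulOp p (h⁻¹ • (M.T h g - g)))
      (h⁻¹ • (M.T h g - g))) (𝓝[≠] 0) (𝓝 (inner ℝ (M.mulOp p (M.D g)) (M.D g))) := by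
    intro g hg
    have h1 := hasD_iff.1 (hasD_of_mem hg)
    exact (((M.mulOp p).continuous.tendsto _).comp h1).inner h1
  refine le_of_tendsto_of_tendsto (hlim _ (abs_mem_domD hf)) (hlim _ hf)
    (Eventually.of_forall fun h => hC.inner_mulOp_mono hp0 ?_)
  filter_upwards [abs_T_abs_sub_le h f, Lp.coeFn_smul h⁻¹ (M.T h |f| - |f|),
    Lp.coeFn_smul h⁻¹ (M.T h f - f)] with ω h1 h2 h3
  rw [h2, h3, Pi.smul_apply, Pi.smul_apply, smul_eq_mul, smul_eq_mul, abs_mul, abs_mul]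
  gcongr

lemma Bj_abs_le {f : M.L2} (hf : f ∈ M.domD) : A.Bj |f| |f| ≤ A.Bj f f := by
  obtain ⟨C, hC0, hC⟩ := A.exists_regular
  have h1 := A.Bj_eq hC0 hC (hasD_of_mem hf).toH1 (hasD_of_mem hf).toH1
  have h2 := A.Bj_eq hC0 hC (hasD_of_mem (abs_mem_domD hf)).toH1
    (hasD_of_mem (abs_mem_domD hf)).toH1
  simp only [HasD.val_toH1] at h1 h2
  rw [h1, h2]
  refine mul_le_mul_of_nonneg_left ?_ (by norm_num)
  rw [SmoothKernel.form_apply, SmoothKernel.form_apply]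
  have hint := fun u => (A.smoothKernel_jumpOp hC0 hC).integrable
      (integrable_levyWeight A.α_pos A.α_lt) 0 u u
  refine integral_mono_ae (hint _) (hint _) ?_
  filter_upwards [levyMeasure_absolutelyContinuous A.α hC] with z ⟨q, hq⟩
  simp only [A.jumpOp_eq hq, HasD.val_toH1]
  exact (hq.2.2.1 0).inner_mulOp_mono hq.2.2.2 (abs_T_abs_sub_le z f)

lemma innerPi_abs (f : M.L2) : A.innerPi |f| |f| = A.innerPi f f := by
  refine integral_congr_ae ?_
  filter_upwards [Lp.coeFn_abs f] with ω h
  rw [h, abs_mul_abs_self]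

lemma Bd_self_nonneg (f : M.L2) : 0 ≤ A.Bd f f := by
  refine mul_nonneg (by norm_num) (integral_nonneg fun ω => ?_)
  change (0:ℝ) ≤ _
  rw [mul_assoc (A.σ ω ^ 2)]
  exact mul_nonneg (mul_nonneg (sq_nonneg _) (mul_self_nonneg _)) (Real.exp_pos _).le

lemma Bj_self_nonneg (f : M.L2) : 0 ≤ A.Bj f f := by
  obtain ⟨K, hK, -, hc⟩ := A.elliptic
  refine mul_nonneg (by norm_num) (integral_nonneg_of_ae ?_)
  filter_upwards [hc] with ω h
  refine integral_nonneg_of_ae ?_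
  filter_upwards [levyMeasure_absolutelyContinuous A.α h] with z hz
  exact mul_nonneg (mul_self_nonneg _) ((inv_pos.2 hK).le.trans hz.1)


/-! ### The resolvent G: Lax–Milgram, regularity, range, positivity. -/

lemma isResolventSolution_iff {ε : ℝ} (hε : 0 < ε) {lam : ℝ} (hlam : 0 < lam)
    {f u : M.L2} : A.IsResolventSolution ε lam f u ↔
    ∃ U : M.H1, val U = u ∧ ∀ v : M.H1, A.B ε lam (val U) (val v) = A.innerPi f (val v) := by
  rw [IsResolventSolution, A.formDomain_eq hε hlam]
  constructor
  · rintro ⟨h1, h2⟩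
    exact ⟨(hasD_of_mem h1).toH1, rfl, fun v => h2 _ (hasD_val_der v).mem⟩
  · rintro ⟨U, rfl, h⟩
    exact ⟨(hasD_val_der U).mem, fun ψ hψ => h (hasD_of_mem hψ).toH1⟩

lemma IsResolventSolution.unique {ε : ℝ} (hε : 0 < ε) {lam : ℝ} (hlam : 0 < lam)
    {f u u' : M.L2} (h : A.IsResolventSolution ε lam f u)
    (h' : A.IsResolventSolution ε lam f u') : u = u' := by
  obtain ⟨U, rfl, hU⟩ := (A.isResolventSolution_iff hε hlam).1 h
  obtain ⟨U', rfl, hU'⟩ := (A.isResolventSolution_iff hε hlam).1 h'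
  obtain ⟨b, -, ⟨κ, hκ, hco⟩, hb⟩ := A.exists_smoothForms hε hlam
  have h1 := hco (U - U')
  have h2 : b 0 (U - U') (U - U') = 0 := by
    have := (b 0).map_sub₂ U U' (U - U')
    rw [this, hb, hb, hU, hU', sub_self]
  rw [h2] at h1
  have : ‖U - U'‖ ^ 2 = 0 := by nlinarith [sq_nonneg ‖U - U'‖]
  rw [sub_eq_zero.1 (norm_eq_zero.1 (pow_eq_zero_iff two_ne_zero |>.1 this))]

lemma exists_isResolventSolution {ε : ℝ} (hε : 0 < ε) {lam : ℝ} (hlam : 0 < lam)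
    (f : M.L2) : ∃ u, A.IsResolventSolution ε lam f u := by
  obtain ⟨b, -, ⟨κ, hκ, hco⟩, hb⟩ := A.exists_smoothForms hε hlam
  have hcoer : IsCoercive (b 0) := ⟨κ, hκ, fun u => by
    have := hco u
    rwa [mul_assoc, ← sq]⟩
  let φ : M.H1 →L[ℝ] ℝ := (innerSL ℝ (M.mulOp (A.expV (-2)) f)).comp val
  refine ⟨val (hcoer.continuousLinearEquivOfBilin.symm ((InnerProductSpace.toDual ℝ M.H1).symm φ)),
    (A.isResolventSolution_iff hε hlam).2 ⟨_, rfl, fun v => ?_⟩⟩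
  rw [← hb, ← hcoer.continuousLinearEquivOfBilin_apply, ContinuousLinearEquiv.apply_symm_apply,
    InnerProductSpace.toDual_symm_apply, A.innerPi_eq]
  rfl

lemma G_spec {ε : ℝ} (hε : 0 < ε) {lam : ℝ} (hlam : 0 < lam)
    (f : M.L2) : A.IsResolventSolution ε lam f (A.G ε lam f) :=
  Classical.epsilon_spec (A.exists_isResolventSolution hε hlam f)

lemma isResolventSolution_iff_eq_G {ε : ℝ} (hε : 0 < ε) {lam : ℝ} (hlam : 0 < lam)
    (f u : M.L2) :
    A.IsResolventSolution ε lam f u ↔ u = A.G ε lam f :=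
  ⟨fun h => h.unique A hε hlam (A.G_spec hε hlam f), fun h => h ▸ A.G_spec hε hlam f⟩

lemma exists_H1_G {ε : ℝ} (hε : 0 < ε) {lam : ℝ} (hlam : 0 < lam)
    (f : M.L2) : ∃ U : M.H1, val U = A.G ε lam f ∧
    ∀ v : M.H1, A.B ε lam (val U) (val v) = A.innerPi f (val v) :=
  (A.isResolventSolution_iff hε hlam).1 (A.G_spec hε hlam f)

lemma val_eq_G {ε : ℝ} (hε : 0 < ε) {lam : ℝ} (hlam : 0 < lam)
    {f : M.L2} {U : M.H1}
    (h : ∀ v : M.H1, A.B ε lam (val U) (val v) = A.innerPi f (val v)) : val U = A.G ε lam f :=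
  (A.isResolventSolution_iff_eq_G hε hlam f _).1 ((A.isResolventSolution_iff hε hlam).2 ⟨U, rfl, h⟩)

lemma G_mem_domD {ε : ℝ} (hε : 0 < ε) {lam : ℝ} (hlam : 0 < lam)
    (f : M.L2) : A.G ε lam f ∈ M.domD := by
  obtain ⟨U, hU, -⟩ := A.exists_H1_G hε hlam f
  rw [← hU]; exact (hasD_val_der U).mem

lemma B_G {ε : ℝ} (hε : 0 < ε) {lam : ℝ} (hlam : 0 < lam)
    {f v : M.L2} (hv : v ∈ M.domD) : A.B ε lam (A.G ε lam f) v = A.innerPi f v := by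
  obtain ⟨U, hU, h⟩ := A.exists_H1_G hε hlam f
  rw [← hU]
  exact h (hasD_of_mem hv).toH1

lemma innerPi_G_left {ε : ℝ} (hε : 0 < ε) {lam : ℝ} (hlam : 0 < lam)
    (f g : M.L2) :
    A.innerPi (A.G ε lam f) g = A.innerPi f (A.G ε lam g) := by
  rw [A.innerPi_comm, ← A.B_G hε hlam (A.G_mem_domD hε hlam f), A.B_comm,
    A.B_G hε hlam (A.G_mem_domD hε hlam g)]

lemma G_add {ε : ℝ} (hε : 0 < ε) {lam : ℝ} (hlam : 0 < lam)
    (f g : M.L2) : A.G ε lam (f + g) = A.G ε lam f + A.G ε lam g := by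
  obtain ⟨b, -, -, hb⟩ := A.exists_smoothForms hε hlam
  obtain ⟨U, hU, h⟩ := A.exists_H1_G hε hlam f
  obtain ⟨U', hU', h'⟩ := A.exists_H1_G hε hlam g
  rw [← hU, ← hU', ← map_add]
  refine (A.val_eq_G hε hlam fun v => ?_).symm
  rw [innerPi_add_left, ← h, ← h', ← hb, ← hb, ← hb]
  exact (b 0).map_add₂ U U' v

lemma G_smul {ε : ℝ} (hε : 0 < ε) {lam : ℝ} (hlam : 0 < lam)
    (c : ℝ) (f : M.L2) : A.G ε lam (c • f) = c • A.G ε lam f := by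
  obtain ⟨b, -, -, hb⟩ := A.exists_smoothForms hε hlam
  obtain ⟨U, hU, h⟩ := A.exists_H1_G hε hlam f
  rw [← hU, ← map_smul]
  refine (A.val_eq_G hε hlam fun v => ?_).symm
  rw [innerPi_smul_left, ← h, ← hb, ← hb]
  exact (b 0).map_smul₂ c U v

lemma exists_norm_G_le {ε : ℝ} (hε : 0 < ε) {lam : ℝ} (hlam : 0 < lam) :
    ∃ C, ∀ f, ‖A.G ε lam f‖ ≤ C * ‖f‖ := by
  obtain ⟨b, -, ⟨κ, hκ, hco⟩, hb⟩ := A.exists_smoothForms hε hlam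
  refine ⟨κ⁻¹ * ‖M.mulOp (A.expV (-2))‖, fun f => ?_⟩
  obtain ⟨U, hU, h⟩ := A.exists_H1_G hε hlam f
  have h1 := hco U
  rw [hb, h, innerPi_eq] at h1
  have h2 : inner ℝ (M.mulOp (A.expV (-2)) f) (val U) ≤
      ‖M.mulOp (A.expV (-2))‖ * ‖f‖ * ‖U‖ := by
    refine (real_inner_le_norm _ _).trans ?_
    gcongr
    · exact ContinuousLinearMap.le_opNorm _ _
    · exact norm_val_le U
  have h3 : κ * ‖U‖ ≤ ‖M.mulOp (A.expV (-2))‖ * ‖f‖ := by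
    rcases eq_or_ne ‖U‖ 0 with h0 | h0
    · rw [h0, mul_zero]; positivity
    · refine le_of_mul_le_mul_right ?_ (lt_of_le_of_ne (norm_nonneg _) h0.symm)
      calc κ * ‖U‖ * ‖U‖ = κ * ‖U‖ ^ 2 := by ring
        _ ≤ _ := h1.trans h2
  rw [← hU, mul_assoc, ← div_eq_inv_mul, le_div_iff₀' hκ]
  refine le_trans ?_ h3
  gcongr
  exact norm_val_le U

/-- `G_λ^ε` as a bounded operator. -/
def Gl {ε : ℝ} (hε : 0 < ε) {lam : ℝ} (hlam : 0 < lam) :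
    M.L2 →L[ℝ] M.L2 :=
  LinearMap.mkContinuous
    { toFun := A.G ε lam
      map_add' := A.G_add hε hlam
      map_smul' := A.G_smul hε hlam } (A.exists_norm_G_le hε hlam).choose
    (A.exists_norm_G_le hε hlam).choose_spec

@[simp] lemma Gl_apply {ε : ℝ} (hε : 0 < ε) {lam : ℝ} (hlam : 0 < lam) (f : M.L2) :
    A.Gl hε hlam f = A.G ε lam f := rfl

lemma G_mem_H {ε : ℝ} (hε : 0 < ε) {lam : ℝ} (hlam : 0 < lam)
    {m : ℕ} {f : M.L2} (hf : f ∈ M.H m) : A.G ε lam f ∈ M.H (m + 2) := by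
  obtain ⟨b, hs, ⟨κ, hκ, hco⟩, hb⟩ := A.exists_smoothForms hε hlam
  obtain ⟨U, hU, h⟩ := A.exists_H1_G hε hlam f
  rw [← hU]
  refine hs.mem_H_of_repr hκ hco m (w := M.mulOp (A.expV (-2)) f) (fun v => ?_)
    (Cinf.mulOp_mem_H (A.expV_mem _) hf)
  rw [hb, h, innerPi_eq]

/-- Converse of elliptic regularity: B(u, ·) is represented by some w ∈ H^m, and the factor e^{2V}
compensates the weight in (·,·)_π. -/
lemma exists_G_eq {ε : ℝ} (hε : 0 < ε) {lam : ℝ} (hlam : 0 < lam)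
    {m : ℕ} {u : M.L2} (hu : u ∈ M.H (m + 2)) : ∃ f ∈ M.H m, A.G ε lam f = u := by
  obtain ⟨b, hs, -, hb⟩ := A.exists_smoothForms hε hlam
  obtain ⟨u', hu', -⟩ := mem_H_succ.1 hu
  obtain ⟨w, hw, hwb⟩ := hs.exists_repr_mem_H m 0 hu'.toH1 hu
  refine ⟨M.mulOp (A.expV 2) w, Cinf.mulOp_mem_H (A.expV_mem _) hw, ?_⟩
  refine (A.val_eq_G hε hlam (U := hu'.toH1) fun v => ?_).symm
  have := A.expV_mulOp_cancel (-2) w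
  rw [neg_neg] at this
  rw [innerPi_eq, this, ← hwb, hb]

lemma G_injective {ε : ℝ} (hε : 0 < ε) {lam : ℝ} (hlam : 0 < lam) :
    Function.Injective (A.G ε lam) := by
  intro f g hfg
  have h0 : M.mulOp (A.expV (-2)) (f - g) = 0 := by
    refine dense_H_two.eq_zero_of_inner_left (𝕜 := ℝ) fun v hv => ?_
    have hv' : v ∈ M.domD := by
      obtain ⟨v', h, -⟩ := mem_H_succ.1 hv
      exact h.mem
    rw [← innerPi_eq, innerPi_sub_left, ← A.B_G hε hlam hv', ← A.B_G hε hlam hv', hfg, sub_self]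
  have := A.expV_mulOp_cancel 2 (f - g)
  rw [h0, map_zero] at this
  exact (sub_eq_zero.1 this.symm)

lemma range_G {ε : ℝ} (hε : 0 < ε) {lam : ℝ} (hlam : 0 < lam) :
    Set.range (A.G ε lam) = M.H 2 := by
  refine Set.Subset.antisymm ?_ fun u hu => ?_
  · rintro _ ⟨f, rfl⟩
    exact A.G_mem_H hε hlam (mem_H_zero f)
  · obtain ⟨f, -, h⟩ := A.exists_G_eq hε hlam (m := 0) hu
    exact ⟨f, h⟩

/-- The forms for λ and λ' differ by (λ' − λ)(·,·)_π, so a solution for λ solves the λ' problem with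
a shifted datum. -/
lemma G_resolvent {ε : ℝ} (hε : 0 < ε) {lam : ℝ} (hlam : 0 < lam)
    {lam' : ℝ} (hlam' : 0 < lam') (f : M.L2) :
    A.G ε lam f = A.G ε lam' (f + (lam' - lam) • A.G ε lam f) := by
  obtain ⟨U, hU, h⟩ := A.exists_H1_G hε hlam f
  rw [← hU]
  refine A.val_eq_G hε hlam' fun v => ?_
  rw [A.B_eq_add ε lam' lam, h, innerPi_add_left, innerPi_smul_left]

lemma lam_mul_innerPi_G_le {ε : ℝ} (hε : 0 < ε) {lam : ℝ} (hlam : 0 < lam)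
    (f : M.L2) :
    lam * A.innerPi (A.G ε lam f) (A.G ε lam f) ≤ A.innerPi f (A.G ε lam f) := by
  rw [← A.B_G hε hlam (f := f) (A.G_mem_domD hε hlam f), B]
  have h1 := A.Bd_self_nonneg (A.G ε lam f)
  have h2 := mul_nonneg (Real.rpow_nonneg hε.le (2 - A.α)) (A.Bj_self_nonneg (A.G ε lam f))
  linarith

/-- Let U be the solution and W = |U|. Then b(W − U, W − U) = b(W, W) − b(U, U) − 2 b(U, W − U),
where b(W, W) ≤ b(U, U) and b(U, W − U) = (f, |U| − U)_π ≥ 0. Coercivity forces W = U. -/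
lemma G_nonneg {ε : ℝ} (hε : 0 < ε) {lam : ℝ} (hlam : 0 < lam)
    {f : M.L2} (hf : 0 ≤ f) : 0 ≤ A.G ε lam f := by
  obtain ⟨b, -, ⟨κ, hκ, hco⟩, hb⟩ := A.exists_smoothForms hε hlam
  obtain ⟨U, hU, h⟩ := A.exists_H1_G hε hlam f
  have hUd := (hasD_val_der U).mem
  set W : M.H1 := (hasD_of_mem (abs_mem_domD hUd)).toH1 with hW
  have hWv : val W = |val U| := rfl
  have hle : b 0 W W ≤ b 0 U U := by
    rw [hb, hb, hWv, B, B, A.innerPi_abs]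
    have h1 := A.Bd_abs_le hUd
    have h2 := mul_le_mul_of_nonneg_left (A.Bj_abs_le hUd) (Real.rpow_nonneg hε.le (2 - A.α))
    linarith
  have hpos : 0 ≤ b 0 U (W - U) := by
    rw [hb, h, map_sub]
    refine A.innerPi_nonneg hf ?_
    rw [hWv, sub_nonneg]
    exact le_abs_self _
  have hsym : b 0 W U = b 0 U W := by rw [hb, hb, B_comm]
  have hexp : b 0 (W - U) (W - U) = b 0 W W - b 0 U U - 2 * b 0 U (W - U) := by
    have e1 := (b 0).map_sub₂ W U (W - U)
    have e2 : b 0 W (W - U) = b 0 W W - b 0 W U := map_sub _ _ _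
    have e3 : b 0 U (W - U) = b 0 U W - b 0 U U := map_sub _ _ _
    rw [e1, e2, e3, hsym]; ring
  have h1 := hco (W - U)
  have h2 : ‖W - U‖ ^ 2 = 0 := by
    have : κ * ‖W - U‖ ^ 2 ≤ 0 := by linarith
    nlinarith [sq_nonneg ‖W - U‖]
  have h3 : W = U := sub_eq_zero.1 (norm_eq_zero.1 (pow_eq_zero_iff two_ne_zero |>.1 h2))
  rw [← hU, ← h3, hWv]
  exact abs_nonneg _

lemma G_const {ε : ℝ} (hε : 0 < ε) {lam : ℝ} (hlam : 0 < lam)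
    (c : ℝ) : A.G ε lam (Lp.const 2 M.μ c) = lam⁻¹ • Lp.const 2 M.μ c := by
  have hT : ∀ x, M.T x (Lp.const 2 M.μ c) = Lp.const 2 M.μ c := by
    intro x
    apply Lp.ext
    filter_upwards [M.T_coeFn x (Lp.const 2 M.μ c), Lp.coeFn_const 2 M.μ c,
      M.ae_τ x (Lp.coeFn_const 2 M.μ c)] with ω h1 h2 h3
    rw [h1, h2, h3]; rfl
  have hD : M.HasD (lam⁻¹ • Lp.const 2 M.μ c) 0 := by
    unfold HasD; simp_rw [T_map_smul, hT]; exact hasDerivAt_const _ _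
  refine (A.val_eq_G hε hlam (U := hD.toH1) fun v => ?_).symm
  obtain ⟨p, hp, hpe⟩ := A.exists_diffusion
  obtain ⟨C1, hC1⟩ := Cinf.bdd hp
  obtain ⟨C, hC0, hC⟩ := A.exists_regular
  have hj : A.Bj (val hD.toH1) (val v) = 0 := by
    rw [A.Bj_eq hC0 hC, SmoothKernel.form_apply]
    simp [T_map_smul, hT]
  have hd : A.Bd (val hD.toH1) (val v) = 0 := by
    rw [A.Bd_eq hC1 hpe, HasD.val_toH1, hD.D_eq]
    simp
  rw [B, hj, hd, HasD.val_toH1, innerPi_smul_left, mul_zero, add_zero, add_zero,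
    mul_inv_cancel_left₀ hlam.ne']


end Coefficients

/-! ### Abstract semigroup theory: Yosida approximation of a symmetric resolvent family. -/

/-- Uniformly bounded operators that converge on a dense set converge everywhere. -/
lemma tendsto_of_dense_of_bound {E ι : Type*} [NormedAddCommGroup E] [NormedSpace ℝ E]
    {l : Filter ι} {S : ι → E →L[ℝ] E} {S₀ : E →L[ℝ] E} {C : ℝ}
    (hS : ∀ᶠ i in l, ∀ x, ‖S i x‖ ≤ C * ‖x‖) {s : Set E} (hs : Dense s)
    (h : ∀ x ∈ s, Tendsto (fun i => S i x) l (𝓝 (S₀ x))) (x : E) :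
    Tendsto (fun i => S i x) l (𝓝 (S₀ x)) := by
  rw [Metric.tendsto_nhds]
  intro ε hε
  set K := |C| + ‖S₀‖ + 1 with hK
  have hK0 : 0 < K := by positivity
  obtain ⟨y, hy, hxy⟩ := Metric.mem_closure_iff.1 (hs x) (ε / 2 / K) (by positivity)
  filter_upwards [hS, Metric.tendsto_nhds.1 (h y hy) (ε / 2) (by positivity)] with i h1 h2
  rw [dist_eq_norm] at h2 hxy ⊢
  have e : S i x - S₀ x = S i (x - y) - S₀ (x - y) + (S i y - S₀ y) := by
    simp only [map_sub]; abel
  have h3 : ‖S i (x - y)‖ ≤ |C| * ‖x - y‖ :=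
    (h1 _).trans (by gcongr; exact le_abs_self C)
  have h4 := S₀.le_opNorm (x - y)
  have h5 : K * ‖x - y‖ < ε / 2 := by
    rwa [lt_div_iff₀' hK0] at hxy
  calc ‖S i x - S₀ x‖ ≤ ‖S i (x - y)‖ + ‖S₀ (x - y)‖ + ‖S i y - S₀ y‖ := by
        rw [e]
        exact (norm_add_le _ _).trans (add_le_add (norm_sub_le _ _) le_rfl)
    _ < ε := by nlinarith [norm_nonneg (x - y)]

section Abstract

variable {E : Type*} [NormedAddCommGroup E] [InnerProductSpace ℝ E]

/-- The resolvent family of a densely defined nonpositive self-adjoint operator. -/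
structure ResolventFamily (R : ℝ → E →L[ℝ] E) : Prop where
  resolvent : ∀ a b, 0 < a → 0 < b → ∀ f, R a f = R b (f + (b - a) • R a f)
  symm : ∀ a, 0 < a → ∀ f g, inner ℝ (R a f) g = inner ℝ f (R a g)
  pos : ∀ a, 0 < a → ∀ f, a * inner ℝ (R a f) (R a f) ≤ inner ℝ f (R a f)
  dense : ∀ a, 0 < a → DenseRange (R a)

namespace ResolventFamily

variable {R : ℝ → E →L[ℝ] E}

lemma norm_le (hR : ResolventFamily R) {a : ℝ} (ha : 0 < a) (f : E) : a * ‖R a f‖ ≤ ‖f‖ := by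
  have h1 := hR.pos a ha f
  rw [real_inner_self_eq_norm_sq] at h1
  have h2 := real_inner_le_norm f (R a f)
  rcases eq_or_ne ‖R a f‖ 0 with h0 | h0
  · rw [h0, mul_zero]; positivity
  · refine le_of_mul_le_mul_right ?_ (lt_of_le_of_ne (norm_nonneg _) h0.symm)
    nlinarith

lemma comm (hR : ResolventFamily R) {a b : ℝ} (ha : 0 < a) (hb : 0 < b) (f : E) :
    R a (R b f) = R b (R a f) := by
  rcases eq_or_ne a b with rfl | hab
  · rfl
  have h1 := hR.resolvent a b ha hb f
  have h2 := hR.resolvent b a hb ha f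
  rw [map_add, map_smul] at h1 h2
  have h3 : (b - a) • (R a (R b f) - R b (R a f)) = 0 := by
    have : (b - a) • R b (R a f) = R a f - R b f := by
      rw [eq_sub_iff_add_eq, add_comm]; exact h1.symm
    have h4 : (a - b) • R a (R b f) = R b f - R a f := by
      rw [eq_sub_iff_add_eq, add_comm]; exact h2.symm
    have h5 : (b - a) • R a (R b f) = R a f - R b f := by
      rw [← neg_sub a b, neg_smul, h4, neg_sub]
    rw [smul_sub, h5, this, sub_self]
  rcases smul_eq_zero.1 h3 with h | h
  · exact absurd (sub_eq_zero.1 h).symm hab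
  · exact sub_eq_zero.1 h

/-- Yosida's approximation. -/
def yos (R : ℝ → E →L[ℝ] E) (a : ℝ) : E →L[ℝ] E := a • (a • R a - 1)

lemma yos_apply (a : ℝ) (x : E) : yos R a x = a • (a • R a x - x) := rfl

/-- With L = b − R_b⁻¹ this says (a R_a − 1)u = R_a L u for u = R_b f. Throughout, `b • R b f - f`
stands for L u on the dense range of R_b. -/
lemma smul_sub_eq (hR : ResolventFamily R) {a b : ℝ} (ha : 0 < a) (hb : 0 < b) (f : E) :
    a • R a (R b f) - R b f = R a (b • R b f - f) := by
  have h2 := hR.resolvent b a hb ha f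
  rw [map_add, map_smul, sub_smul] at h2
  rw [map_sub, map_smul]
  nth_rewrite 2 [h2]
  abel

lemma yos_range (hR : ResolventFamily R) {a b : ℝ} (ha : 0 < a) (hb : 0 < b) (f : E) :
    yos R a (R b f) = a • R a (b • R b f - f) := by
  rw [yos_apply, hR.smul_sub_eq ha hb]

lemma norm_yos_range_le (hR : ResolventFamily R) {a b : ℝ} (ha : 0 < a) (hb : 0 < b) (f : E) :
    ‖yos R a (R b f)‖ ≤ ‖b • R b f - f‖ := by
  rw [hR.yos_range ha hb, norm_smul, Real.norm_eq_abs, abs_of_pos ha]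
  exact hR.norm_le ha _

lemma tendsto_smul_R (hR : ResolventFamily R) (x : E) :
    Tendsto (fun a => a • R a x) atTop (𝓝 x) := by
  refine tendsto_of_dense_of_bound (S := fun a => a • R a) (S₀ := 1) (C := 1) ?_
    (hR.dense 1 one_pos) ?_ x
  · filter_upwards [eventually_gt_atTop 0] with a ha x
    rw [smul_apply, norm_smul, Real.norm_eq_abs, abs_of_pos ha, one_mul]
    exact hR.norm_le ha x
  · rintro _ ⟨f, rfl⟩
    change Tendsto (fun a => a • R a (R 1 f)) atTop (𝓝 (R 1 f))
    rw [tendsto_iff_norm_sub_tendsto_zero]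
    have h0 : Tendsto (fun a : ℝ => a⁻¹ * ‖(1:ℝ) • R 1 f - f‖) atTop (𝓝 0) := by
      simpa using tendsto_inv_atTop_zero.mul_const ‖(1:ℝ) • R 1 f - f‖
    refine squeeze_zero' (Eventually.of_forall fun _ => norm_nonneg _) ?_ h0
    filter_upwards [eventually_gt_atTop 0] with a ha
    rw [hR.smul_sub_eq ha one_pos, ← div_eq_inv_mul, le_div_iff₀' ha]
    exact hR.norm_le ha _

lemma tendsto_yos_range (hR : ResolventFamily R) {b : ℝ} (hb : 0 < b) (f : E) :
    Tendsto (fun a => yos R a (R b f)) atTop (𝓝 (b • R b f - f)) := by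
  refine (hR.tendsto_smul_R (b • R b f - f)).congr' ?_
  filter_upwards [eventually_gt_atTop 0] with a ha
  rw [hR.yos_range ha hb]

lemma inner_yos_self_le (hR : ResolventFamily R) {a : ℝ} (ha : 0 < a) (x : E) :
    inner ℝ (yos R a x) x ≤ 0 := by
  rw [yos_apply, inner_smul_left, inner_sub_left, inner_smul_left, real_inner_self_eq_norm_sq]
  have h1 := real_inner_le_norm (R a x) x
  have h2 := hR.norm_le ha x
  refine mul_nonpos_of_nonneg_of_nonpos ha.le ?_
  have h3 : a * inner ℝ (R a x) x ≤ ‖x‖ * ‖x‖ := by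
    calc a * inner ℝ (R a x) x ≤ a * (‖R a x‖ * ‖x‖) := by gcongr
      _ = (a * ‖R a x‖) * ‖x‖ := by ring
      _ ≤ _ := by gcongr
  change a * inner ℝ (R a x) x - ‖x‖ ^ 2 ≤ 0
  nlinarith

/-- The semigroup generated by Yosida's approximation. -/
def ysg (R : ℝ → E →L[ℝ] E) (a t : ℝ) : E →L[ℝ] E := NormedSpace.exp (t • yos R a)

lemma ysg_zero (a : ℝ) (x : E) : ysg R a 0 x = x := by
  simp [ysg]

lemma ysg_yos (a t : ℝ) (x : E) : ysg R a t (yos R a x) = yos R a (ysg R a t x) := by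
  have : Commute (NormedSpace.exp (t • yos R a)) (yos R a) :=
    (((Commute.refl (yos R a)).smul_right t).exp_right).symm
  exact DFunLike.congr_fun this.eq x

lemma ysg_comm_of_comm {a t : ℝ} {S : E →L[ℝ] E} (h : Commute S (yos R a)) (x : E) :
    ysg R a t (S x) = S (ysg R a t x) := by
  have : Commute S (NormedSpace.exp (t • yos R a)) := (h.smul_right t).exp_right
  exact (DFunLike.congr_fun this.eq x).symm

lemma commute_R_yos (hR : ResolventFamily R) {a b : ℝ} (ha : 0 < a) (hb : 0 < b) :
    Commute (R b) (yos R a) := by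
  refine ContinuousLinearMap.ext fun x => ?_
  change R b (yos R a x) = yos R a (R b x)
  rw [yos_apply, yos_apply, map_smul, map_sub, map_smul, hR.comm hb ha]

lemma inner_gen_symm (hR : ResolventFamily R) {b : ℝ} (hb : 0 < b) (x y : E) :
    inner ℝ (b • R b x - x) (R b y) = inner ℝ (R b x) (b • R b y - y) := by
  rw [inner_sub_left, inner_sub_right, inner_smul_left, inner_smul_right, hR.symm b hb x y,
    conj_trivial]

lemma injective (hR : ResolventFamily R) {b : ℝ} (hb : 0 < b) : Function.Injective (R b) := by
  refine (injective_iff_map_eq_zero (R b)).2 fun x hx => ?_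
  refine (hR.dense b hb).eq_zero_of_inner_left (𝕜 := ℝ) ?_
  intro y
  rw [← hR.symm b hb, hx, inner_zero_left]

lemma commute_yos (hR : ResolventFamily R) {a b : ℝ} (ha : 0 < a) (hb : 0 < b) :
    Commute (yos R a) (yos R b) := by
  have h := hR.commute_R_yos hb ha
  have : Commute (a • R a - 1) (yos R b) := (h.smul_left a).sub_left (Commute.one_left _)
  exact this.smul_left a

variable [CompleteSpace E]

lemma hasDerivAt_ysg (a t : ℝ) (x : E) :
    HasDerivAt (fun s => ysg R a s x) (ysg R a t (yos R a x)) t := by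
  have h := hasDerivAt_exp_smul_const (𝕂 := ℝ) (yos R a) t
  exact (h.clm_apply (hasDerivAt_const t x)).congr_deriv (by simp [ysg])

lemma ysg_add (a s t : ℝ) (x : E) : ysg R a (s + t) x = ysg R a s (ysg R a t x) := by
  let : NormedAlgebra ℚ (E →L[ℝ] E) := NormedAlgebra.restrictScalars ℚ ℝ _
  have : NormedSpace.exp ((s + t) • yos R a) =
      NormedSpace.exp (s • yos R a) * NormedSpace.exp (t • yos R a) := by
    rw [add_smul]
    exact NormedSpace.exp_add_of_commute (((Commute.refl _).smul_left s).smul_right t)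
  exact DFunLike.congr_fun this x

lemma norm_ysg_le (hR : ResolventFamily R) {a t : ℝ} (ha : 0 < a) (ht : 0 ≤ t) (x : E) :
    ‖ysg R a t x‖ ≤ ‖x‖ := by
  have hd : ∀ s, HasDerivAt (fun s => ‖ysg R a s x‖ ^ 2)
      (2 * inner ℝ (ysg R a s x) (ysg R a s (yos R a x))) s := fun s =>
    (hasDerivAt_ysg a s x).norm_sq
  have hanti : Antitone fun s => ‖ysg R a s x‖ ^ 2 := by
    refine antitone_of_deriv_nonpos (fun s => (hd s).differentiableAt) fun s => ?_
    rw [(hd s).deriv, ysg_yos, real_inner_comm]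
    linarith [hR.inner_yos_self_le ha (ysg R a s x)]
  have h := hanti ht
  simp only [ysg_zero] at h
  exact le_of_sq_le_sq h (norm_nonneg _)

/-- The path s ↦ e^{s A_a} e^{(t−s) A_c} x joins the two semigroups; as the approximations commute,
its derivative is the contraction e^{s A_a} e^{(t−s) A_c} applied to A_a x − A_c x. -/
lemma norm_ysg_sub_le (hR : ResolventFamily R) {a c t : ℝ} (ha : 0 < a) (hc : 0 < c) (ht : 0 ≤ t)
    (x : E) : ‖ysg R a t x - ysg R c t x‖ ≤ t * ‖yos R a x - yos R c x‖ := by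
  have hd : ∀ s, HasDerivAt (fun s => ysg R a s (ysg R c (t - s) x))
      (ysg R a s (ysg R c (t - s) (yos R a x - yos R c x))) s := by
    intro s
    have h1 := hasDerivAt_exp_smul_const (𝕂 := ℝ) (yos R a) s
    have h2 : HasDerivAt (fun s => ysg R c (t - s) x)
        (-(ysg R c (t - s) (yos R c x))) s := by
      have := HasDerivAt.scomp (𝕜 := ℝ) (𝕜' := ℝ) (h := fun s => t - s) s
        (hasDerivAt_ysg (R := R) c (t - s) x) ((hasDerivAt_id s).const_sub t)
      rw [neg_one_smul] at this
      exact this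
    refine (h1.clm_apply h2).congr_deriv ?_
    have e1 : ysg R c (t - s) (yos R a x) = yos R a (ysg R c (t - s) x) :=
      ysg_comm_of_comm (hR.commute_yos ha hc) x
    rw [map_sub (ysg R c (t - s)), map_sub (ysg R a s), e1, map_neg]
    exact (sub_eq_add_neg _ _).symm
  have := (convex_Icc (0:ℝ) t).norm_image_sub_le_of_norm_hasDerivWithin_le
    (f := fun s => ysg R a s (ysg R c (t - s) x)) (C := ‖yos R a x - yos R c x‖) (x := 0) (y := t)
    (fun s _ => (hd s).hasDerivWithinAt) (fun s hs =>
      (hR.norm_ysg_le ha hs.1 _).trans (hR.norm_ysg_le hc (sub_nonneg.2 hs.2) _))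
    (Set.left_mem_Icc.2 ht) (Set.right_mem_Icc.2 ht)
  rw [sub_self, ysg_zero, ysg_zero, sub_zero, Real.norm_eq_abs, abs_of_nonneg ht,
    mul_comm] at this
  exact this

lemma exists_tendsto_ysg (hR : ResolventFamily R) {t : ℝ} (ht : 0 ≤ t) (x : E) :
    ∃ y, Tendsto (fun n : ℕ => ysg R ((n : ℝ) + 1) t x) atTop (𝓝 y) := by
  have hpos : ∀ n : ℕ, (0:ℝ) < n + 1 := fun n => by positivity
  have hto : Tendsto (fun n : ℕ => (n : ℝ) + 1) atTop atTop :=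
    tendsto_atTop_add_const_right _ _ tendsto_natCast_atTop_atTop
  refine cauchySeq_tendsto_of_complete (Metric.cauchySeq_iff'.2 fun ε hε => ?_)
  obtain ⟨_, ⟨f, rfl⟩, hxy⟩ := Metric.mem_closure_iff.1 (hR.dense 1 one_pos x) (ε / 4) (by positivity)
  have hc := ((hR.tendsto_yos_range one_pos f).comp hto).cauchySeq
  obtain ⟨N, hN⟩ := Metric.cauchySeq_iff'.1 hc (ε / 4 / (t + 1)) (by positivity)
  refine ⟨N, fun n hn => ?_⟩
  have h1 := hN n hn
  simp only [Function.comp] at h1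
  set y := R 1 f
  have h2 := hR.norm_ysg_sub_le (hpos n) (hpos N) ht y
  rw [dist_eq_norm] at h1 hxy ⊢
  have e : ysg R ((n : ℝ) + 1) t x - ysg R ((N : ℝ) + 1) t x =
      ysg R ((n : ℝ) + 1) t (x - y) - ysg R ((N : ℝ) + 1) t (x - y) +
      (ysg R ((n : ℝ) + 1) t y - ysg R ((N : ℝ) + 1) t y) := by
    simp only [map_sub]; abel
  have h3 := hR.norm_ysg_le (hpos n) ht (x - y)
  have h4 := hR.norm_ysg_le (hpos N) ht (x - y)
  rw [lt_div_iff₀' (by positivity)] at h1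
  have h5 : t * ‖yos R ((n : ℝ) + 1) y - yos R ((N : ℝ) + 1) y‖ < ε / 4 := by
    nlinarith [norm_nonneg (yos R ((n : ℝ) + 1) y - yos R ((N : ℝ) + 1) y)]
  calc _ ≤ ‖ysg R ((n : ℝ) + 1) t (x - y)‖ + ‖ysg R ((N : ℝ) + 1) t (x - y)‖ +
        ‖ysg R ((n : ℝ) + 1) t y - ysg R ((N : ℝ) + 1) t y‖ := by
        rw [e]
        exact (norm_add_le _ _).trans (add_le_add (norm_sub_le _ _) le_rfl)
    _ < ε := by linarith

open Classical in
/-- The semigroup with resolvent `R`. -/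
def sg (hR : ResolventFamily R) (t : ℝ) : E →L[ℝ] E :=
  if ht : 0 ≤ t then
    continuousLinearMapOfTendsto (fun n : ℕ => ysg R ((n : ℝ) + 1) t)
      (f := fun x => (hR.exists_tendsto_ysg ht x).choose)
      (tendsto_pi_nhds.2 fun x => (hR.exists_tendsto_ysg ht x).choose_spec)
  else 0

lemma tendsto_sg (hR : ResolventFamily R) {t : ℝ} (ht : 0 ≤ t) (x : E) :
    Tendsto (fun n : ℕ => ysg R ((n : ℝ) + 1) t x) atTop (𝓝 (hR.sg t x)) := by
  rw [sg, dif_pos ht]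
  exact (hR.exists_tendsto_ysg ht x).choose_spec

lemma norm_sg_le (hR : ResolventFamily R) {t : ℝ} (ht : 0 ≤ t) (x : E) : ‖hR.sg t x‖ ≤ ‖x‖ :=
  le_of_tendsto (hR.tendsto_sg ht x).norm
    (Eventually.of_forall fun n => hR.norm_ysg_le (by positivity) ht x)

lemma sg_zero (hR : ResolventFamily R) (x : E) : hR.sg 0 x = x := by
  refine tendsto_nhds_unique (hR.tendsto_sg le_rfl x) ?_
  simp_rw [ysg_zero]
  exact tendsto_const_nhds

lemma tendsto_ysg_of_tendsto (hR : ResolventFamily R) {t : ℝ} (ht : 0 ≤ t) {u : ℕ → E} {x : E}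
    (hu : Tendsto u atTop (𝓝 x)) :
    Tendsto (fun n : ℕ => ysg R ((n : ℝ) + 1) t (u n)) atTop (𝓝 (hR.sg t x)) := by
  have h1 : Tendsto (fun n : ℕ => ysg R ((n : ℝ) + 1) t (u n - x)) atTop (𝓝 0) := by
    refine squeeze_zero_norm (fun n => hR.norm_ysg_le (by positivity) ht _) ?_
    exact tendsto_iff_norm_sub_tendsto_zero.1 hu
  have h2 := h1.add (hR.tendsto_sg ht x)
  simpa using h2

lemma sg_add (hR : ResolventFamily R) {s t : ℝ} (hs : 0 ≤ s) (ht : 0 ≤ t) (x : E) :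
    hR.sg (s + t) x = hR.sg s (hR.sg t x) := by
  refine tendsto_nhds_unique (hR.tendsto_sg (add_nonneg hs ht) x) ?_
  simp_rw [ysg_add]
  exact hR.tendsto_ysg_of_tendsto hs (hR.tendsto_sg ht x)

lemma sg_R (hR : ResolventFamily R) {t b : ℝ} (ht : 0 ≤ t) (hb : 0 < b) (x : E) :
    hR.sg t (R b x) = R b (hR.sg t x) := by
  refine tendsto_nhds_unique (hR.tendsto_sg ht (R b x)) ?_
  refine (((R b).continuous.tendsto _).comp (hR.tendsto_sg ht x)).congr fun n => ?_
  exact (ysg_comm_of_comm (hR.commute_R_yos (by positivity) hb) x).symm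

lemma sg_symm (hR : ResolventFamily R) {t : ℝ} (ht : 0 ≤ t) (x y : E) :
    inner ℝ (hR.sg t x) y = inner ℝ x (hR.sg t y) := by
  refine tendsto_nhds_unique ((hR.tendsto_sg ht x).inner tendsto_const_nhds) ?_
  refine (tendsto_const_nhds.inner (hR.tendsto_sg ht y)).congr fun n => ?_
  have hpos : (0:ℝ) < n + 1 := by positivity
  have hsa : IsSelfAdjoint (t • yos R ((n : ℝ) + 1)) := by
    rw [ContinuousLinearMap.isSelfAdjoint_iff_isSymmetric]
    intro x y
    change inner ℝ (t • yos R ((n : ℝ) + 1) x) y = inner ℝ x (t • yos R ((n : ℝ) + 1) y)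
    simp only [yos_apply, inner_smul_left, inner_smul_right, inner_sub_left, inner_sub_right,
      hR.symm _ hpos, conj_trivial]
  exact ((ContinuousLinearMap.isSelfAdjoint_iff_isSymmetric.1 hsa.exp) x y).symm

lemma tendsto_sg_zero (hR : ResolventFamily R) (x : E) :
    Tendsto (fun t => hR.sg t x) (𝓝[≥] 0) (𝓝 x) := by
  refine tendsto_of_dense_of_bound (S := hR.sg) (S₀ := 1) (C := 1) ?_ (hR.dense 1 one_pos) ?_ x
  · filter_upwards [self_mem_nhdsWithin] with t ht x
    rw [one_mul]
    exact hR.norm_sg_le ht x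
  · rintro _ ⟨f, rfl⟩
    change Tendsto (fun t => hR.sg t (R 1 f)) (𝓝[≥] 0) (𝓝 (R 1 f))
    rw [tendsto_iff_norm_sub_tendsto_zero]
    have h0 : Tendsto (fun t : ℝ => ‖(1:ℝ) • R 1 f - f‖ * t) (𝓝[≥] 0) (𝓝 0) := by
      have : Continuous fun t : ℝ => ‖(1:ℝ) • R 1 f - f‖ * t := by fun_prop
      simpa using (this.tendsto 0).mono_left nhdsWithin_le_nhds
    refine squeeze_zero' (Eventually.of_forall fun _ => norm_nonneg _) ?_ h0
    filter_upwards [self_mem_nhdsWithin] with t ht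
    have ht' : 0 ≤ t := ht
    refine le_of_tendsto ((hR.tendsto_sg ht' (R 1 f)).sub_const (R 1 f)).norm
      (Eventually.of_forall fun n => ?_)
    have hpos : (0:ℝ) < n + 1 := by positivity
    have := (convex_Icc (0:ℝ) t).norm_image_sub_le_of_norm_hasDerivWithin_le
      (f := fun s => ysg R ((n : ℝ) + 1) s (R 1 f)) (C := ‖(1:ℝ) • R 1 f - f‖) (x := 0) (y := t)
      (fun s _ => (hasDerivAt_ysg _ s _).hasDerivWithinAt) (fun s hs =>
        (hR.norm_ysg_le hpos hs.1 _).trans (hR.norm_yos_range_le hpos one_pos f))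
      (Set.left_mem_Icc.2 ht') (Set.right_mem_Icc.2 ht')
    rwa [ysg_zero, sub_zero, Real.norm_eq_abs, abs_of_nonneg ht'] at this

lemma norm_sg_sub_le (hR : ResolventFamily R) {s t : ℝ} (hs : 0 ≤ s) (ht : 0 ≤ t) (x : E) :
    ‖hR.sg t x - hR.sg s x‖ ≤ ‖hR.sg |t - s| x - x‖ := by
  wlog hst : s ≤ t generalizing s t
  · rw [norm_sub_rev, abs_sub_comm]
    exact this ht hs (le_of_not_ge hst)
  have e : hR.sg t x - hR.sg s x = hR.sg s (hR.sg |t - s| x - x) := by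
    rw [map_sub, ← hR.sg_add hs (abs_nonneg _), abs_of_nonneg (sub_nonneg.2 hst)]
    congr 3; ring
  rw [e]
  exact hR.norm_sg_le hs _

lemma continuousOn_sg (hR : ResolventFamily R) (x : E) :
    ContinuousOn (fun t => hR.sg t x) (Set.Ici 0) := by
  intro s hs
  rw [ContinuousWithinAt, tendsto_iff_norm_sub_tendsto_zero]
  have h1 : Tendsto (fun t : ℝ => |t - s|) (𝓝[Set.Ici 0] s) (𝓝[≥] 0) := by
    refine tendsto_nhdsWithin_iff.2 ⟨?_, Eventually.of_forall fun t => Set.mem_Ici.2 (abs_nonneg _)⟩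
    have : Continuous fun t : ℝ => |t - s| := by fun_prop
    simpa using (this.tendsto s).mono_left nhdsWithin_le_nhds
  have h2 := tendsto_iff_norm_sub_tendsto_zero.1 ((hR.tendsto_sg_zero x).comp h1)
  refine squeeze_zero' (Eventually.of_forall fun _ => norm_nonneg _) ?_ h2
  filter_upwards [self_mem_nhdsWithin] with t ht
  exact hR.norm_sg_sub_le hs ht x

/-- The fundamental theorem of calculus for the Yosida semigroups passes to the limit by dominated
convergence. The absolute value makes the integrand continuous on all of ℝ, since `sg` is zero at
negative times. -/
lemma sg_sub_eq_integral (hR : ResolventFamily R) {b : ℝ} (hb : 0 < b) (f : E) {t : ℝ}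
    (ht : 0 ≤ t) :
    hR.sg t (R b f) - R b f = ∫ s in (0:ℝ)..t, hR.sg |s| (b • R b f - f) := by
  have hpos : ∀ n : ℕ, (0:ℝ) < n + 1 := fun n => by positivity
  have hto : Tendsto (fun n : ℕ => (n : ℝ) + 1) atTop atTop :=
    tendsto_atTop_add_const_right _ _ tendsto_natCast_atTop_atTop
  have hcont : ∀ (n : ℕ) (x : E), Continuous fun s => ysg R ((n : ℝ) + 1) s x := fun n x =>
    continuous_iff_continuousAt.2 fun s => (hasDerivAt_ysg _ s x).continuousAt
  have h1 : ∀ n : ℕ, ysg R ((n : ℝ) + 1) t (R b f) - R b f =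
      ∫ s in (0:ℝ)..t, ysg R ((n : ℝ) + 1) s (yos R ((n : ℝ) + 1) (R b f)) := by
    intro n
    have := intervalIntegral.integral_eq_sub_of_hasDerivAt (a := 0) (b := t)
      (fun s _ => hasDerivAt_ysg (R := R) ((n : ℝ) + 1) s (R b f))
      ((hcont n _).intervalIntegrable _ _)
    rw [ysg_zero] at this
    exact this.symm
  refine tendsto_nhds_unique ((hR.tendsto_sg ht (R b f)).sub_const (R b f)) ?_
  simp_rw [h1]
  refine intervalIntegral.tendsto_integral_filter_of_dominated_convergence
    (fun _ => ‖b • R b f - f‖) ?_ ?_ (by simp) ?_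
  · exact Eventually.of_forall fun n => (hcont n _).aestronglyMeasurable
  · refine Eventually.of_forall fun n => Eventually.of_forall fun s hs => ?_
    rw [Set.uIoc_of_le ht] at hs
    exact (hR.norm_ysg_le (hpos n) hs.1.le _).trans (hR.norm_yos_range_le (hpos n) hb f)
  · refine Eventually.of_forall fun s hs => ?_
    rw [Set.uIoc_of_le ht] at hs
    rw [abs_of_pos hs.1]
    exact hR.tendsto_ysg_of_tendsto hs.1.le ((hR.tendsto_yos_range hb f).comp hto)

lemma hasDerivWithinAt_sg (hR : ResolventFamily R) {b : ℝ} (hb : 0 < b) (f : E) {t : ℝ}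
    (ht : 0 ≤ t) : HasDerivWithinAt (fun s => hR.sg s (R b f))
      (hR.sg t (b • R b f - f)) (Set.Ici 0) t := by
  have hc : Continuous fun s : ℝ => hR.sg |s| (b • R b f - f) :=
    (hR.continuousOn_sg _).comp_continuous continuous_abs fun s => Set.mem_Ici.2 (abs_nonneg s)
  have h1 : HasDerivAt (fun t => ∫ s in (0:ℝ)..t, hR.sg |s| (b • R b f - f))
      (hR.sg |t| (b • R b f - f)) t :=
    intervalIntegral.integral_hasDerivAt_right (hc.intervalIntegrable _ _)
      (hc.stronglyMeasurableAtFilter _ _) hc.continuousAt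
  rw [abs_of_nonneg ht] at h1
  refine ((h1.add_const (R b f)).hasDerivWithinAt (s := Set.Ici 0)).congr (fun s hs => ?_) ?_
  · rw [← hR.sg_sub_eq_integral hb f hs, sub_add_cancel]
  · rw [← hR.sg_sub_eq_integral hb f ht, sub_add_cancel]

lemma sg_of_fixed (hR : ResolventFamily R) {x : E} (hx : ∀ a, 0 < a → R a x = a⁻¹ • x) {t : ℝ}
    (ht : 0 ≤ t) : hR.sg t x = x := by
  have h := hR.sg_sub_eq_integral one_pos x ht
  simpa [hx 1 one_pos, sub_eq_zero] using h

/-- e^{t A_a} = e^{−ta} e^{t a² R_a}, and the exponential series of t a² R_a has nonnegative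
coefficients, so a closed convex cone preserved by R_a is preserved by the semigroup. -/
lemma ysg_mem_cone {K : Set E} (hcl : IsClosed K) (h0 : (0 : E) ∈ K)
    (hadd : ∀ x ∈ K, ∀ y ∈ K, x + y ∈ K) (hsmul : ∀ c : ℝ, 0 ≤ c → ∀ x ∈ K, c • x ∈ K)
    {a : ℝ} (ha : 0 < a) (hK : ∀ x ∈ K, R a x ∈ K) {t : ℝ} (ht : 0 ≤ t) {x : E} (hx : x ∈ K) :
    ysg R a t x ∈ K := by
  let : NormedAlgebra ℚ (E →L[ℝ] E) := NormedAlgebra.restrictScalars ℚ ℝ _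
  have hexp : NormedSpace.exp (t • yos R a) =
      Real.exp (-(t * a)) • NormedSpace.exp ((t * a ^ 2) • R a) := by
    have e : t • yos R a = algebraMap ℝ (E →L[ℝ] E) (-(t * a)) + (t * a ^ 2) • R a := by
      rw [yos, Algebra.algebraMap_eq_smul_one, smul_smul, smul_sub, smul_smul, neg_smul]
      rw [show t * a ^ 2 = t * a * a by ring]
      abel
    rw [e, NormedSpace.exp_add_of_commute (Algebra.commute_algebraMap_left _ _),
      ← NormedSpace.algebraMap_exp_comm, ← Real.exp_eq_exp_ℝ, Algebra.algebraMap_eq_smul_one,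
      smul_mul_assoc, one_mul]
  have hs := (NormedSpace.exp_series_hasSum_exp' (𝕂 := ℝ) ((t * a ^ 2) • R a)).mapL
    (ContinuousLinearMap.apply ℝ E x)
  rw [ysg, hexp]
  refine hsmul _ (Real.exp_pos _).le _ ?_
  refine hcl.mem_of_tendsto hs (Eventually.of_forall fun s => ?_)
  refine Finset.sum_induction _ (· ∈ K) (fun x y hx hy => hadd x hx y hy) h0 fun n hn => ?_
  clear hn
  change (((n.factorial : ℝ)⁻¹) • ((t * a ^ 2) • R a) ^ n) x ∈ K
  rw [smul_apply]
  refine hsmul _ (by positivity) _ ?_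
  clear * - hsmul hK hx ht ha
  induction n with
  | zero => simpa using hx
  | succ n ih =>
    rw [pow_succ']
    change (t * a ^ 2) • R a ((((t * a ^ 2) • R a) ^ n) x) ∈ K
    exact hsmul _ (by positivity) _ (hK _ ih)

lemma sg_mem_cone (hR : ResolventFamily R) {K : Set E} (hcl : IsClosed K) (h0 : (0 : E) ∈ K)
    (hadd : ∀ x ∈ K, ∀ y ∈ K, x + y ∈ K) (hsmul : ∀ c : ℝ, 0 ≤ c → ∀ x ∈ K, c • x ∈ K)
    (hK : ∀ a, 0 < a → ∀ x ∈ K, R a x ∈ K) {t : ℝ} (ht : 0 ≤ t) {x : E} (hx : x ∈ K) :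
    hR.sg t x ∈ K :=
  hcl.mem_of_tendsto (hR.tendsto_sg ht x) (Eventually.of_forall fun n =>
    ysg_mem_cone hcl h0 hadd hsmul (by positivity) (hK _ (by positivity)) ht hx)

/-! ### Smoothing effect of the semigroup. -/

lemma mul_le_sub_of_antitone {φ ψ : ℝ → ℝ} (hφ : ∀ s, 0 ≤ s →
    HasDerivWithinAt φ (-ψ s) (Set.Ici 0) s) (hψ : AntitoneOn ψ (Set.Ici 0)) {r t : ℝ}
    (hr : 0 ≤ r) (hrt : r < t) : (t - r) * ψ t ≤ φ r - φ t := by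
  obtain ⟨c, hc, he⟩ := exists_hasDerivAt_eq_slope φ (fun s => -ψ s) hrt
    (fun s hs => ((hφ s (hr.trans hs.1)).mono fun x hx => hr.trans hx.1).continuousWithinAt)
    (fun s hs => (hφ s (hr.trans hs.1.le)).hasDerivAt (Ici_mem_nhds (hr.trans_lt hs.1)))
  have h1 : ψ t ≤ ψ c := hψ (hr.trans hc.1.le) (hr.trans hrt.le) hc.2.le
  have h2 : 0 < t - r := sub_pos.2 hrt
  rw [eq_div_iff h2.ne'] at he
  nlinarith

/-- Analyticity estimate of the semigroup of a nonpositive self-adjoint operator. -/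
lemma norm_sg_gen_le (hR : ResolventFamily R) {b : ℝ} (hb : 0 < b) (h : E) {t : ℝ} (ht : 0 < t) :
    ‖hR.sg t (b • R b (R b h) - R b h)‖ ≤ t⁻¹ * ‖R b (R b h)‖ := by
  -- Two resolvents place v in Dom L², with L²v equal to `L2v`. Then φ(s) = ⟨P_s v, v⟩ has −φ' =
  -- −⟨P_s Lv, v⟩ ≥ 0 and φ'' = ⟨P_s L²v, v⟩ = ‖P_{s/2} Lv‖².
  set v := R b (R b h) with hv
  set h' := b • R b h - h with hh'
  set Lv := b • R b (R b h) - R b h with hLv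
  have hLv' : Lv = R b h' := by rw [hLv, hh', map_sub, map_smul]
  set L2v := b • Lv - h' with hL2v
  have d1 : ∀ s, 0 ≤ s → HasDerivWithinAt (fun s => inner ℝ (hR.sg s v) v)
      (-(-inner ℝ (hR.sg s Lv) v)) (Set.Ici 0) s := by
    intro s hs
    have := (hR.hasDerivWithinAt_sg hb (R b h) hs).inner ℝ (hasDerivWithinAt_const s _ v)
    rw [inner_zero_right, zero_add] at this
    rw [neg_neg]
    exact this
  have e2 : ∀ s, 0 ≤ s → inner ℝ (hR.sg s L2v) v = ‖hR.sg (s / 2) Lv‖ ^ 2 := by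
    intro s hs
    have hs2 : 0 ≤ s / 2 := by positivity
    rw [hR.sg_symm hs, hv, hR.sg_R hs hb, hL2v, hLv', hR.inner_gen_symm hb, ← hLv',
      ← real_inner_self_eq_norm_sq, hR.sg_symm hs2, ← hR.sg_add hs2 hs2, add_halves, hLv,
      map_sub, map_smul, hR.sg_R hs hb (R b h)]
  have d2 : ∀ s, 0 ≤ s → HasDerivWithinAt (fun s => -inner ℝ (hR.sg s Lv) v)
      (-(‖hR.sg (s / 2) Lv‖ ^ 2)) (Set.Ici 0) s := by
    intro s hs
    have := (hR.hasDerivWithinAt_sg hb h' hs).inner ℝ (hasDerivWithinAt_const s _ v)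
    rw [inner_zero_right, zero_add, ← hLv', e2 s hs] at this
    exact this.neg
  have e1 : ∀ s, 0 ≤ s → 0 ≤ -inner ℝ (hR.sg s Lv) v := by
    intro s hs
    have hs2 : 0 ≤ s / 2 := by positivity
    have e : inner ℝ (hR.sg s Lv) v = inner ℝ (hR.sg (s / 2) Lv) (hR.sg (s / 2) v) := by
      rw [← hR.sg_symm hs2, ← hR.sg_add hs2 hs2, add_halves]
    have hw : hR.sg (s / 2) v = R b (hR.sg (s / 2) (R b h)) := hR.sg_R hs2 hb _
    have hw2 : hR.sg (s / 2) Lv = b • R b (hR.sg (s / 2) (R b h)) - hR.sg (s / 2) (R b h) := by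
      rw [hLv, map_sub, map_smul, hR.sg_R hs2 hb (R b h)]
    rw [e, hw, hw2, inner_sub_left, inner_smul_left, conj_trivial]
    linarith [hR.pos b hb (hR.sg (s / 2) (R b h))]
  have a2 : AntitoneOn (fun s => ‖hR.sg (s / 2) Lv‖ ^ 2) (Set.Ici 0) := by
    intro r hr s hs hrs
    have hr' : (0:ℝ) ≤ r := hr
    have e : hR.sg (s / 2) Lv = hR.sg (s / 2 - r / 2) (hR.sg (r / 2) Lv) := by
      rw [← hR.sg_add (by linarith) (by positivity), sub_add_cancel]
    simp only
    rw [e]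
    gcongr
    exact hR.norm_sg_le (by linarith) _
  have a1 : AntitoneOn (fun s => -inner ℝ (hR.sg s Lv) v) (Set.Ici 0) := by
    intro r hr s hs hrs
    rcases hrs.eq_or_lt with rfl | hlt
    · exact le_rfl
    have := mul_le_sub_of_antitone d2 a2 hr hlt
    have h3 : 0 ≤ (s - r) * ‖hR.sg (s / 2) Lv‖ ^ 2 :=
      mul_nonneg (sub_nonneg.2 hrs) (sq_nonneg _)
    simp only at this ⊢
    linarith
  -- With ψ = −φ': monotonicity on [0, t] gives t ψ(t) ≤ φ(0) − φ(t) ≤ ‖v‖². On [t, 2t], where s/2 =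
  -- t at the right end, it gives t ‖P_t Lv‖² ≤ ψ(t) − ψ(2t) ≤ ψ(t). Together, (t ‖P_t Lv‖)² ≤ ‖v‖².
  have b1 := mul_le_sub_of_antitone d1 a1 le_rfl ht
  have b2 := mul_le_sub_of_antitone d2 a2 ht.le (show t < 2 * t by linarith)
  have e3 : 0 ≤ inner ℝ (hR.sg t v) v := by
    have ht2 : 0 ≤ t / 2 := by positivity
    have : inner ℝ (hR.sg t v) v = ‖hR.sg (t / 2) v‖ ^ 2 := by
      rw [← real_inner_self_eq_norm_sq, hR.sg_symm ht2, ← hR.sg_add ht2 ht2, add_halves,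
        real_inner_comm]
    rw [this]; positivity
  simp only [hR.sg_zero, real_inner_self_eq_norm_sq, sub_zero] at b1 b2
  rw [show 2 * t - t = t by ring, show 2 * t / 2 = t by ring] at b2
  have b3 := e1 (2 * t) (by positivity)
  have b4 : (t * ‖hR.sg t Lv‖) ^ 2 ≤ ‖v‖ ^ 2 := by
    have : t * (t * ‖hR.sg t Lv‖ ^ 2) ≤ t * (-inner ℝ (hR.sg t Lv) v) := by
      gcongr; linarith
    calc (t * ‖hR.sg t Lv‖) ^ 2 = t * (t * ‖hR.sg t Lv‖ ^ 2) := by ring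
      _ ≤ _ := by linarith
  have b5 := le_of_sq_le_sq b4 (norm_nonneg _)
  rwa [← div_eq_inv_mul, le_div_iff₀' ht]

/-- By the preceding estimate, v ↦ ⟨P_t f, Lv⟩ is bounded in the L² norm of v on the range of R_b²,
hence represented by some w. Self-adjointness then means L P_t f = w, that is, P_t f = R_b(b P_t f −
w). -/
lemma sg_mem_range (hR : ResolventFamily R) {b : ℝ} (hb : 0 < b) {t : ℝ} (ht : 0 < t) (f : E) :
    hR.sg t f ∈ Set.range (R b) := by
  let φ : E →ₗ[ℝ] ℝ := (innerₛₗ ℝ f).comp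
    ((hR.sg t).comp (b • (R b).comp (R b) - R b)).toLinearMap
  have hφ : ∀ h, φ h = inner ℝ f (hR.sg t (b • R b (R b h) - R b h)) := fun h => rfl
  obtain ⟨w, hw⟩ := exists_inner_eq_of_bound ((R b).comp (R b)).toLinearMap φ (‖f‖ * t⁻¹) (by
    intro h
    rw [hφ]
    refine (abs_real_inner_le_norm _ _).trans ?_
    rw [mul_assoc]
    gcongr
    exact hR.norm_sg_gen_le hb h ht)
  refine ⟨b • hR.sg t f - w, ?_⟩
  apply hR.injective hb
  refine ext_inner_right ℝ fun h => ?_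
  have h1 := hw h
  rw [hφ, ← hR.sg_symm ht.le] at h1
  change inner ℝ (hR.sg t f) (b • R b (R b h) - R b h) = inner ℝ w (R b (R b h)) at h1
  rw [hR.symm b hb, hR.symm b hb, hR.symm b hb, inner_sub_left, inner_smul_left, conj_trivial]
  rw [inner_sub_right, inner_smul_right] at h1
  linarith

end ResolventFamily

end Abstract

/-! ### Closed graph argument, and positive operators on L^∞(Ω). -/

namespace RandomMedium

variable {Ω : Type*} [MeasurableSpace Ω] {M : RandomMedium Ω}

/-- D is a closed operator, so the closed graph theorem applies to D S. -/
lemma exists_clm_D {S : M.L2 →L[ℝ] M.L2} (hS : ∀ f, S f ∈ M.domD) :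
    ∃ S' : M.L2 →L[ℝ] M.L2, ∀ f, S' f = M.D (S f) := by
  let l : M.L2 →ₗ[ℝ] M.L2 :=
    { toFun := fun f => M.D (S f)
      map_add' := fun f g => by
        rw [map_add]
        exact ((hasD_of_mem (hS f)).add (hasD_of_mem (hS g))).D_eq
      map_smul' := fun c f => by
        rw [map_smul]
        exact ((hasD_of_mem (hS f)).smul c).D_eq }
  refine ⟨ContinuousLinearMap.ofSeqClosedGraph (g := l) fun u x y hx hy => ?_, fun f => rfl⟩
  exact (hasD_of_tendsto (fun n => hasD_of_mem (hS (u n)))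
    ((S.continuous.tendsto x).comp hx) hy).D_eq.symm

/-- A positive operator on `L²` that acts on constants as the multiplication by `κ` induces an
operator of norm `κ` on `L^∞`. -/
lemma exists_linfty_clm {S : M.L2 →L[ℝ] M.L2} {κ : ℝ} (hκ : 0 ≤ κ)
    (hpos : ∀ f, 0 ≤ f → 0 ≤ S f)
    (hconst : ∀ c, S (Lp.const 2 M.μ c) = κ • Lp.const 2 M.μ c) :
    ∃ Q : Lp ℝ ⊤ M.μ →L[ℝ] Lp ℝ ⊤ M.μ,
      (∀ (f : Lp ℝ ⊤ M.μ) (g : M.L2), f =ᵐ[M.μ] g → Q f =ᵐ[M.μ] S g) ∧ ‖Q‖ = κ := by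
  -- One-sided bounds come from positivity applied to c − g; two-sided ones follow with −g.
  have hle : ∀ (g : M.L2) (c : ℝ), (∀ᵐ ω ∂M.μ, g ω ≤ c) → ∀ᵐ ω ∂M.μ, S g ω ≤ κ * c := by
    intro g c hg
    have h1 : 0 ≤ Lp.const 2 M.μ c - g := by
      refine (Lp.coeFn_nonneg _).1 ?_
      filter_upwards [hg, Lp.coeFn_sub (Lp.const 2 M.μ c) g, Lp.coeFn_const 2 M.μ c]
        with ω h1 h2 h3
      rw [h2, Pi.sub_apply, h3]
      simpa using h1
    have h2 := hpos _ h1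
    rw [map_sub, hconst] at h2
    filter_upwards [(Lp.coeFn_nonneg _).2 h2, Lp.coeFn_sub (κ • Lp.const 2 M.μ c) (S g),
      Lp.coeFn_smul κ (Lp.const 2 M.μ c), Lp.coeFn_const 2 M.μ c] with ω h3 h4 h5 h6
    rw [h4, Pi.sub_apply, h5, Pi.smul_apply, h6] at h3
    simpa using h3
  have hbdd : ∀ (g : M.L2) (c : ℝ), M.BddBy g c → M.BddBy (S g) (κ * c) := by
    intro g c hg
    have h1 := hle g c (Eventually.mono hg fun ω h => (abs_le.1 h).2)
    have h2 := hle (-g) c (by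
      filter_upwards [hg, Lp.coeFn_neg g] with ω h h'
      rw [h', Pi.neg_apply]
      linarith [(abs_le.1 h).1])
    rw [map_neg] at h2
    filter_upwards [h1, h2, Lp.coeFn_neg (S g)] with ω h3 h4 h5
    rw [h5, Pi.neg_apply] at h4
    exact abs_le.2 ⟨by linarith, h3⟩
  have hmem : ∀ f : Lp ℝ ⊤ M.μ, MemLp f 2 M.μ := fun f => (Lp.memLp f).mono_exponent le_top
  have hJ : ∀ f : Lp ℝ ⊤ M.μ, M.BddBy (hmem f).toLp ‖f‖ := by
    intro f
    filter_upwards [(hmem f).coeFn_toLp, enorm_ae_le_eLpNormEssSup f M.μ] with ω h1 h2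
    rw [h1, Lp.norm_def, eLpNorm_exponent_top, ← Real.norm_eq_abs, ← toReal_enorm]
    refine ENNReal.toReal_mono ?_ h2
    rw [← eLpNorm_exponent_top]
    exact Lp.eLpNorm_ne_top f
  have hS : ∀ f : Lp ℝ ⊤ M.μ, MemLp (S (hmem f).toLp) ⊤ M.μ := fun f =>
    memLp_top_of_bound (Lp.aestronglyMeasurable _) (κ * ‖f‖) (hbdd _ _ (hJ f))
  have hJadd : ∀ f g : Lp ℝ ⊤ M.μ, (hmem (f + g)).toLp = (hmem f).toLp + (hmem g).toLp := by
    intro f g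
    rw [← MemLp.toLp_add]
    exact MemLp.toLp_congr _ _ (Lp.coeFn_add f g)
  have hJsmul : ∀ (c : ℝ) (f : Lp ℝ ⊤ M.μ), (hmem (c • f)).toLp = c • (hmem f).toLp := by
    intro c f
    rw [← MemLp.toLp_const_smul]
    exact MemLp.toLp_congr _ _ (Lp.coeFn_smul c f)
  let Q : Lp ℝ ⊤ M.μ →L[ℝ] Lp ℝ ⊤ M.μ := LinearMap.mkContinuous
    { toFun := fun f => (hS f).toLp
      map_add' := fun f g => by
        rw [← MemLp.toLp_add]
        refine MemLp.toLp_congr _ _ ?_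
        rw [hJadd, map_add]
        exact Lp.coeFn_add _ _
      map_smul' := fun c f => by
        rw [RingHom.id_apply, ← MemLp.toLp_const_smul]
        refine MemLp.toLp_congr _ _ ?_
        rw [hJsmul, map_smul]
        exact Lp.coeFn_smul _ _ } κ (fun f => by
        have := Lp.norm_le_of_ae_bound (f := (hS f).toLp) (C := κ * ‖f‖) (by positivity) (by
          filter_upwards [(hS f).coeFn_toLp, hbdd _ _ (hJ f)] with ω h1 h2
          rw [h1]; exact h2)
        simpa using this)
  have hQ : ∀ (f : Lp ℝ ⊤ M.μ) (g : M.L2), f =ᵐ[M.μ] g → Q f =ᵐ[M.μ] S g := by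
    intro f g hfg
    have h1 : (hmem f).toLp = g := Lp.ext ((hmem f).coeFn_toLp.trans hfg)
    have h2 : Q f =ᵐ[M.μ] S (hmem f).toLp := (hS f).coeFn_toLp
    rwa [h1] at h2
  refine ⟨Q, hQ, le_antisymm (LinearMap.mkContinuous_norm_le _ hκ _) ?_⟩
  -- The constant 1 attains the bound κ.
  have h1 := Q.le_opNorm (Lp.const ⊤ M.μ 1)
  have h2 : Q (Lp.const ⊤ M.μ 1) = κ • Lp.const ⊤ M.μ 1 := by
    apply Lp.ext
    have h3 := hQ (Lp.const ⊤ M.μ 1) (Lp.const 2 M.μ 1)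
      ((Lp.coeFn_const ⊤ M.μ (1:ℝ)).trans (Lp.coeFn_const 2 M.μ (1:ℝ)).symm)
    rw [hconst] at h3
    filter_upwards [h3, Lp.coeFn_smul κ (Lp.const 2 M.μ (1:ℝ)), Lp.coeFn_const 2 M.μ (1:ℝ),
      Lp.coeFn_smul κ (Lp.const ⊤ M.μ (1:ℝ)), Lp.coeFn_const ⊤ M.μ (1:ℝ)] with ω h4 h5 h6 h7 h8
    rw [h4, h5, h7, Pi.smul_apply, Pi.smul_apply, h6, h8]
  have h9 : ‖Lp.const ⊤ M.μ (1:ℝ)‖ = 1 := by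
    rw [Lp.norm_const (p := ⊤) (μ := M.μ) (c := (1:ℝ)) ENNReal.top_ne_zero]
    simp
  rwa [h2, norm_smul, h9, mul_one, mul_one, Real.norm_eq_abs, abs_of_nonneg hκ] at h1

end RandomMedium

/-! ### The operator L: domains of powers, self-adjointness, commutation with G. -/

namespace Coefficients

open RandomMedium

variable {Ω : Type*} [MeasurableSpace Ω] {M : RandomMedium Ω} (A : Coefficients M)

lemma expV_neg_mulOp_cancel (f : M.L2) :
    M.mulOp (A.expV (-1)) (M.mulOp (A.expV 1) f) = f := by
  simpa using A.expV_mulOp_cancel (-1) f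

lemma inner_expV_mulOp (f g : M.L2) :
    inner ℝ (M.mulOp (A.expV (-1)) f) (M.mulOp (A.expV (-1)) g) = A.innerPi f g := by
  obtain ⟨C, hC⟩ := Cinf.bdd (A.expV_mem (-1))
  rw [hC.inner_mulOp_eq_integral, innerPi]
  refine integral_congr_ae ?_
  filter_upwards [hC.mulOp_coeFn g, A.expV_coeFn (-1)] with ω h1 h2
  rw [h1, h2, show -2 * A.V ω = -1 * A.V ω + -1 * A.V ω by ring, Real.exp_add]
  ring

lemma norm_expV_mulOp (f : M.L2) : ‖M.mulOp (A.expV (-1)) f‖ = A.normPi f := by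
  rw [normPi, ← inner_expV_mulOp, real_inner_self_eq_norm_sq, Real.sqrt_sq (norm_nonneg _)]

lemma mulOp_expV_nonneg (r : ℝ) {f : M.L2} (hf : 0 ≤ f) : 0 ≤ M.mulOp (A.expV r) f := by
  obtain ⟨C, hC⟩ := Cinf.bdd (A.expV_mem r)
  refine (Lp.coeFn_nonneg _).1 ?_
  filter_upwards [hC.mulOp_coeFn f, A.expV_coeFn r, (Lp.coeFn_nonneg f).2 hf] with ω h1 h2 h3
  rw [h1, h2]
  exact mul_nonneg (Real.exp_pos _).le h3

/-- Multiplication by e^{-V} carries (·,·)_π to the inner product of L²(μ) and is invertible. -/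
lemma innerPi_ext {u v : M.L2} (h : ∀ w, A.innerPi u w = A.innerPi v w) : u = v := by
  have h1 : M.mulOp (A.expV (-1)) u = M.mulOp (A.expV (-1)) v := by
    refine ext_inner_right ℝ fun w => ?_
    rw [← A.expV_neg_mulOp_cancel w, inner_expV_mulOp, inner_expV_mulOp, h]
  simpa [A.expV_mulOp_cancel 1] using congrArg (M.mulOp (A.expV 1)) h1

lemma tendsto_innerPi_left {ι : Type*} {l : Filter ι} {u : ι → M.L2} {w : M.L2}
    (h : Tendsto u l (𝓝 w)) (v : M.L2) :
    Tendsto (fun i => A.innerPi (u i) v) l (𝓝 (A.innerPi w v)) := by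
  simp_rw [← inner_expV_mulOp]
  exact (((M.mulOp (A.expV (-1))).continuous.tendsto _).comp h).inner tendsto_const_nhds

section Generator

lemma L_G {ε : ℝ} (hε : 0 < ε) {lam : ℝ} (hlam : 0 < lam) (f : M.L2) :
    A.L ε lam (A.G ε lam f) = lam • A.G ε lam f - f := by
  rw [L, Function.leftInverse_invFun (A.G_injective hε hlam) f]

lemma domL_eq {ε : ℝ} (hε : 0 < ε) {lam : ℝ} (hlam : 0 < lam) : A.domL ε lam = M.H 2 :=
  A.range_G hε hlam

lemma exists_G_eq_of_mem {ε : ℝ} (hε : 0 < ε) {lam : ℝ} (hlam : 0 < lam) {u : M.L2}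
    (hu : u ∈ M.H 2) : ∃ f, A.G ε lam f = u := by
  rwa [← A.range_G hε hlam] at hu

lemma L_mem_H {ε : ℝ} (hε : 0 < ε) {lam : ℝ} (hlam : 0 < lam) {m : ℕ} {u : M.L2}
    (hu : u ∈ M.H (m + 2)) : A.L ε lam u ∈ M.H m := by
  obtain ⟨f, hf, rfl⟩ := A.exists_G_eq hε hlam hu
  rw [A.L_G hε hlam]
  exact H_sub (H_smul _ (H_antitone (by omega) hu)) hf

/-- Bootstrap: u = G f with f = λu − Lu, so f has as many derivatives as the worse of u and Lu, and
G adds two. -/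
lemma mem_H_of_L_mem_H {ε : ℝ} (hε : 0 < ε) {lam : ℝ} (hlam : 0 < lam) {m : ℕ} {u : M.L2}
    (hu : u ∈ M.H 2) (h : A.L ε lam u ∈ M.H m) : u ∈ M.H (m + 2) := by
  induction m with
  | zero => exact hu
  | succ m ih =>
    have h1 : u ∈ M.H (m + 1) := H_antitone (by omega) (ih (H_succ_subset m h))
    obtain ⟨f, rfl⟩ := A.exists_G_eq_of_mem hε hlam hu
    refine A.G_mem_H hε hlam ?_
    have h2 : f = lam • A.G ε lam f - A.L ε lam (A.G ε lam f) := by rw [A.L_G hε hlam]; abel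
    rw [h2]
    exact H_sub (H_smul _ h1) h

lemma powDomain_L {ε : ℝ} (hε : 0 < ε) {lam : ℝ} (hlam : 0 < lam) (m : ℕ) :
    powDomain (A.domL ε lam) (A.L ε lam) m = M.H (2 * m) := by
  induction m with
  | zero => rfl
  | succ m ih =>
    ext u
    rw [mem_powDomain_succ, ih, A.domL_eq hε hlam]
    exact ⟨fun h => A.mem_H_of_L_mem_H hε hlam h.1 h.2,
      fun h => ⟨H_antitone (by omega) h, A.L_mem_H hε hlam h⟩⟩

lemma innerPi_L_symm {ε : ℝ} (hε : 0 < ε) {lam : ℝ} (hlam : 0 < lam) {u v : M.L2}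
    (hu : u ∈ M.H 2) (hv : v ∈ M.H 2) :
    A.innerPi u (A.L ε lam v) = A.innerPi (A.L ε lam u) v := by
  obtain ⟨f, rfl⟩ := A.exists_G_eq_of_mem hε hlam hu
  obtain ⟨g, rfl⟩ := A.exists_G_eq_of_mem hε hlam hv
  rw [A.L_G hε hlam, A.L_G hε hlam, innerPi_sub_left, innerPi_sub_right, innerPi_smul_left,
    innerPi_smul_right, A.innerPi_G_left hε hlam f g]

/-- For u in the domain of the adjoint, taking v = G g and using the symmetry of G gives (u, g)_π =
(G(λu − w), g)_π for all g, so u lies in the range of G. -/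
lemma selfAdjoint_L {ε : ℝ} (hε : 0 < ε) {lam : ℝ} (hlam : 0 < lam) (u w : M.L2) :
    (u ∈ A.domL ε lam ∧ A.L ε lam u = w) ↔
      ∀ v ∈ A.domL ε lam, A.innerPi u (A.L ε lam v) = A.innerPi w v := by
  rw [A.domL_eq hε hlam]
  constructor
  · rintro ⟨hu, rfl⟩ v hv
    exact A.innerPi_L_symm hε hlam hu hv
  · intro h
    have h1 : u = A.G ε lam (lam • u - w) := by
      refine A.innerPi_ext fun g => ?_
      have h2 := h (A.G ε lam g) (by rw [← A.range_G hε hlam]; exact ⟨g, rfl⟩)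
      rw [A.L_G hε hlam, innerPi_sub_right, innerPi_smul_right] at h2
      rw [A.innerPi_G_left hε hlam, innerPi_sub_left, innerPi_smul_left]
      linarith
    refine ⟨by rw [← A.range_G hε hlam, h1]; exact ⟨_, rfl⟩, ?_⟩
    have h3 := A.L_G hε hlam (lam • u - w)
    rw [← h1] at h3
    rw [h3]; abel

lemma L_mem_Hinf {ε : ℝ} (hε : 0 < ε) {lam : ℝ} (hlam : 0 < lam) {u : M.L2}
    (hu : u ∈ M.Hinf) : A.L ε lam u ∈ M.Hinf := fun m => A.L_mem_H hε hlam (hu (m + 2))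

lemma G_L_comm {ε : ℝ} (hε : 0 < ε) {lam : ℝ} (hlam : 0 < lam) {u : M.L2}
    (hu : u ∈ M.H 2) : A.L ε lam (A.G ε lam u) = A.G ε lam (A.L ε lam u) := by
  obtain ⟨f, rfl⟩ := A.exists_G_eq_of_mem hε hlam hu
  rw [A.L_G hε hlam, A.L_G hε hlam]
  simp only [← A.Gl_apply hε hlam, map_sub, map_smul]

lemma G_iterate_mem_H {ε : ℝ} (hε : 0 < ε) {lam : ℝ} (hlam : 0 < lam) (k : ℕ) {m : ℕ} {f : M.L2}
    (hf : f ∈ M.H m) : (A.G ε lam)^[k] f ∈ M.H (m + 2 * k) := by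
  induction k with
  | zero => exact hf
  | succ k ih =>
    rw [Function.iterate_succ_apply']
    exact A.G_mem_H hε hlam ih

lemma L_G_iterate {ε : ℝ} (hε : 0 < ε) {lam : ℝ} (hlam : 0 < lam) (k : ℕ) {f : M.L2}
    (hf : f ∈ M.H 2) :
    A.L ε lam ((A.G ε lam)^[k] f) = (A.G ε lam)^[k] (A.L ε lam f) := by
  induction k with
  | zero => rfl
  | succ k ih =>
    rw [Function.iterate_succ_apply', Function.iterate_succ_apply',
      A.G_L_comm hε hlam (H_antitone (by omega) (A.G_iterate_mem_H hε hlam k hf)), ih]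

lemma exists_G_eq_Hinf {ε : ℝ} (hε : 0 < ε) {lam : ℝ} (hlam : 0 < lam) {u : M.L2}
    (hu : u ∈ M.Hinf) : ∃ f ∈ M.Hinf, A.G ε lam f = u := by
  obtain ⟨f, hf⟩ := A.exists_G_eq_of_mem hε hlam (hu 2)
  refine ⟨f, fun m => ?_, hf⟩
  obtain ⟨g, hg, hg'⟩ := A.exists_G_eq hε hlam (hu (m + 2))
  rwa [A.G_injective hε hlam (hf.trans hg'.symm)]

lemma exists_G_iterate_eq {ε : ℝ} (hε : 0 < ε) {lam : ℝ} (hlam : 0 < lam) (k : ℕ) {u : M.L2}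
    (hu : u ∈ M.Hinf) : ∃ f ∈ M.Hinf, (A.G ε lam)^[k] f = u := by
  induction k generalizing u with
  | zero => exact ⟨u, hu, rfl⟩
  | succ k ih =>
    obtain ⟨f, hf, rfl⟩ := ih hu
    obtain ⟨g, hg, rfl⟩ := A.exists_G_eq_Hinf hε hlam hf
    exact ⟨g, hg, Function.iterate_succ_apply _ _ _⟩

/-- Boundedness of D^k G^k turns convergence in L² of g into convergence of G^k g for the k-th
seminorm. It comes from applying the closed graph argument k times. -/
lemma exists_clm_iterate {ε : ℝ} (hε : 0 < ε) {lam : ℝ} (hlam : 0 < lam) (k : ℕ) :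
    ∃ S : M.L2 →L[ℝ] M.L2, ∀ f, S f = M.D^[k] ((A.G ε lam)^[k] f) := by
  induction k with
  | zero => exact ⟨1, fun f => rfl⟩
  | succ k ih =>
    obtain ⟨S, hS⟩ := ih
    have h1 : ∀ f, (S.comp (A.Gl hε hlam)) f = M.D^[k] ((A.G ε lam)^[k + 1] f) := fun f => by
      rw [Function.iterate_succ_apply, ← hS]; rfl
    obtain ⟨S', hS'⟩ := exists_clm_D (S := S.comp (A.Gl hε hlam)) (fun f => by
      rw [h1]
      have h2 := A.G_iterate_mem_H hε hlam (k + 1) (mem_H_zero f)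
      exact (H_antitone (show k + 1 ≤ 0 + 2 * (k + 1) by omega) h2).2)
    exact ⟨S', fun f => by rw [hS', h1, Function.iterate_succ_apply' M.D]⟩

end Generator

/-! ### The semigroup (P_t): generator, smoothness, sub-Markov property. -/

section Semigroup

open Classical in
/-- The resolvents, conjugated by `e^{-V}`, so as to be symmetric in `L²(μ)`. -/
def conjG {ε : ℝ} (hε : 0 < ε) (a : ℝ) : M.L2 →L[ℝ] M.L2 :=
  if ha : 0 < a then
    (M.mulOp (A.expV (-1))).comp ((A.Gl hε ha).comp (M.mulOp (A.expV 1))) else 0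

lemma conjG_mulOp {ε : ℝ} (hε : 0 < ε) {a : ℝ} (ha : 0 < a) (f : M.L2) :
    A.conjG hε a (M.mulOp (A.expV (-1)) f) = M.mulOp (A.expV (-1)) (A.G ε a f) := by
  rw [conjG, dif_pos ha]
  simp only [ContinuousLinearMap.comp_apply, A.expV_mulOp_cancel 1, Gl_apply]

lemma mulOp_expV_surjective : Function.Surjective (M.mulOp (A.expV (-1))) := fun f =>
  ⟨_, A.expV_neg_mulOp_cancel f⟩

lemma resolventFamily_conjG {ε : ℝ} (hε : 0 < ε) : ResolventFamily (A.conjG hε) where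
  resolvent a b ha hb f := by
    obtain ⟨f, rfl⟩ := A.mulOp_expV_surjective f
    rw [A.conjG_mulOp hε ha, ← map_smul, ← map_add, A.conjG_mulOp hε hb,
      ← A.G_resolvent hε ha hb]
  symm a ha f g := by
    obtain ⟨f, rfl⟩ := A.mulOp_expV_surjective f
    obtain ⟨g, rfl⟩ := A.mulOp_expV_surjective g
    rw [A.conjG_mulOp hε ha, A.conjG_mulOp hε ha, inner_expV_mulOp, inner_expV_mulOp,
      A.innerPi_G_left hε ha]
  pos a ha f := by
    obtain ⟨f, rfl⟩ := A.mulOp_expV_surjective f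
    rw [A.conjG_mulOp hε ha, inner_expV_mulOp, inner_expV_mulOp]
    exact A.lam_mul_innerPi_G_le hε ha f
  dense a ha := by
    have h1 : DenseRange (A.G ε a) := by
      rw [DenseRange, A.range_G hε ha]; exact dense_H_two
    have h2 := A.mulOp_expV_surjective.denseRange.comp h1 (M.mulOp (A.expV (-1))).continuous
    refine h2.mono ?_
    rintro _ ⟨f, rfl⟩
    exact ⟨_, A.conjG_mulOp hε ha f⟩

/-- The semigroup `(P_t)`. -/
def P {ε : ℝ} (hε : 0 < ε) (t : ℝ) : M.L2 →L[ℝ] M.L2 :=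
  (M.mulOp (A.expV 1)).comp
    (((A.resolventFamily_conjG hε).sg t).comp (M.mulOp (A.expV (-1))))

lemma P_apply {ε : ℝ} (hε : 0 < ε) (t : ℝ) (f : M.L2) : A.P hε t f =
    M.mulOp (A.expV 1) ((A.resolventFamily_conjG hε).sg t (M.mulOp (A.expV (-1)) f)) := rfl

lemma mulOp_P {ε : ℝ} (hε : 0 < ε) (t : ℝ) (f : M.L2) :
    M.mulOp (A.expV (-1)) (A.P hε t f) =
      (A.resolventFamily_conjG hε).sg t (M.mulOp (A.expV (-1)) f) :=
  A.expV_neg_mulOp_cancel _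

lemma P_add {ε : ℝ} (hε : 0 < ε) {s t : ℝ} (hs : 0 ≤ s) (ht : 0 ≤ t) (f : M.L2) :
    A.P hε (s + t) f = A.P hε s (A.P hε t f) := by
  rw [P_apply, P_apply, mulOp_P, ResolventFamily.sg_add _ hs ht]

lemma isSemigroup_P {ε : ℝ} (hε : 0 < ε) : M.IsSemigroup (A.P hε) where
  zero f := by rw [P_apply, ResolventFamily.sg_zero, A.expV_mulOp_cancel 1]
  add s t hs ht f := A.P_add hε hs ht f
  continuousOn f := (M.mulOp (A.expV 1)).continuous.comp_continuousOn
    ((A.resolventFamily_conjG hε).continuousOn_sg _)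

lemma normPi_P_le {ε : ℝ} (hε : 0 < ε) {t : ℝ} (ht : 0 ≤ t) (f : M.L2) :
    A.normPi (A.P hε t f) ≤ A.normPi f := by
  rw [← norm_expV_mulOp, ← norm_expV_mulOp, mulOp_P]
  exact ResolventFamily.norm_sg_le _ ht _

lemma innerPi_P_left {ε : ℝ} (hε : 0 < ε) {t : ℝ} (ht : 0 ≤ t) (f g : M.L2) :
    A.innerPi (A.P hε t f) g = A.innerPi f (A.P hε t g) := by
  rw [← inner_expV_mulOp, ← inner_expV_mulOp, mulOp_P, mulOp_P, ResolventFamily.sg_symm _ ht]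

lemma P_G {ε : ℝ} (hε : 0 < ε) {lam : ℝ} (hlam : 0 < lam) {t : ℝ} (ht : 0 ≤ t) (f : M.L2) :
    A.P hε t (A.G ε lam f) = A.G ε lam (A.P hε t f) := by
  rw [P_apply, ← A.conjG_mulOp hε hlam, ResolventFamily.sg_R _ ht hlam, ← mulOp_P,
    A.conjG_mulOp hε hlam, A.expV_mulOp_cancel 1]

lemma P_G_iterate {ε : ℝ} (hε : 0 < ε) {lam : ℝ} (hlam : 0 < lam) {t : ℝ} (ht : 0 ≤ t) (k : ℕ)
    (f : M.L2) : A.P hε t ((A.G ε lam)^[k] f) = (A.G ε lam)^[k] (A.P hε t f) := by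
  induction k with
  | zero => rfl
  | succ k ih => rw [Function.iterate_succ_apply', Function.iterate_succ_apply',
      A.P_G hε hlam ht, ih]

lemma P_L {ε : ℝ} (hε : 0 < ε) {lam : ℝ} (hlam : 0 < lam) {t : ℝ} (ht : 0 ≤ t) {u : M.L2}
    (hu : u ∈ M.H 2) : A.P hε t (A.L ε lam u) = A.L ε lam (A.P hε t u) := by
  obtain ⟨f, rfl⟩ := A.exists_G_eq_of_mem hε hlam hu
  rw [A.L_G hε hlam, A.P_G hε hlam ht, A.L_G hε hlam, map_sub, map_smul, A.P_G hε hlam ht]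

lemma hasDerivWithinAt_P {ε : ℝ} (hε : 0 < ε) {lam : ℝ} (hlam : 0 < lam) {t : ℝ} (ht : 0 ≤ t)
    {u : M.L2} (hu : u ∈ M.H 2) :
    HasDerivWithinAt (fun s => A.P hε s u) (A.P hε t (A.L ε lam u)) (Set.Ici 0) t := by
  obtain ⟨f, rfl⟩ := A.exists_G_eq_of_mem hε hlam hu
  have h := (A.resolventFamily_conjG hε).hasDerivWithinAt_sg hlam (M.mulOp (A.expV (-1)) f) ht
  have h1 := (M.mulOp (A.expV 1)).hasFDerivAt.comp_hasDerivWithinAt t h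
  rw [A.conjG_mulOp hε hlam, ← map_smul, ← map_sub, ← A.L_G hε hlam] at h1
  exact h1

/-- On H² the limit is the right derivative at 0. Conversely, if the limit w exists for u, symmetry
of P_t gives (u, Lv)_π = (w, v)_π for all v in Dom L, and self-adjointness puts u in the domain. -/
lemma tendsto_P_iff {ε : ℝ} (hε : 0 < ε) {lam : ℝ} (hlam : 0 < lam) (u w : M.L2) :
    Tendsto (fun t : ℝ => t⁻¹ • (A.P hε t u - u)) (𝓝[>] 0) (𝓝 w) ↔
      u ∈ A.domL ε lam ∧ A.L ε lam u = w := by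
  have hgen : ∀ v ∈ M.H 2, Tendsto (fun t : ℝ => t⁻¹ • (A.P hε t v - v)) (𝓝[>] 0)
      (𝓝 (A.L ε lam v)) := by
    intro v hv
    have h1 := A.hasDerivWithinAt_P hε hlam le_rfl hv
    rw [← hasDerivWithinAt_Ioi_iff_Ici, hasDerivWithinAt_iff_tendsto_slope' Set.self_notMem_Ioi,
      (A.isSemigroup_P hε).zero] at h1
    refine h1.congr fun t => ?_
    rw [slope, sub_zero, vsub_eq_sub, (A.isSemigroup_P hε).zero]
  constructor
  · intro h
    rw [A.selfAdjoint_L hε hlam, A.domL_eq hε hlam]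
    intro v hv
    refine tendsto_nhds_unique ?_ (A.tendsto_innerPi_left h v)
    rw [innerPi_comm]
    refine (A.tendsto_innerPi_left (hgen v hv) u).congr' ?_
    filter_upwards [self_mem_nhdsWithin] with t ht
    rw [innerPi_smul_left, innerPi_smul_left, innerPi_sub_left, innerPi_sub_left,
      A.innerPi_P_left hε (le_of_lt ht), A.innerPi_comm v, A.innerPi_comm v]
  · rintro ⟨hu, rfl⟩
    rw [A.domL_eq hε hlam] at hu
    exact hgen u hu

lemma P_mem_Hinf {ε : ℝ} (hε : 0 < ε) {t : ℝ} (ht : 0 ≤ t) {f : M.L2} (hf : f ∈ M.Hinf) :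
    A.P hε t f ∈ M.Hinf := by
  intro k
  obtain ⟨g, -, rfl⟩ := A.exists_G_iterate_eq hε one_pos k hf
  rw [A.P_G_iterate hε one_pos ht]
  exact H_antitone (by omega) (A.G_iterate_mem_H hε one_pos k (mem_H_zero _))

lemma exists_P_eq_G {ε : ℝ} (hε : 0 < ε) {lam : ℝ} (hlam : 0 < lam) {t : ℝ} (ht : 0 < t)
    (f : M.L2) : ∃ g, A.P hε t f = A.G ε lam g := by
  obtain ⟨g, hg⟩ := (A.resolventFamily_conjG hε).sg_mem_range hlam ht (M.mulOp (A.expV (-1)) f)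
  obtain ⟨g, rfl⟩ := A.mulOp_expV_surjective g
  refine ⟨g, ?_⟩
  rw [P_apply, ← hg, A.conjG_mulOp hε hlam, A.expV_mulOp_cancel 1]

/-- Each halving of the time yields one more factor G: if P_{t/2} f = G^k g and P_{t/2} g = G g',
then P_t f = G^k P_{t/2} g = G^{k+1} g'. -/
lemma P_mem_Hinf_of_pos {ε : ℝ} (hε : 0 < ε) {t : ℝ} (ht : 0 < t) (f : M.L2) :
    A.P hε t f ∈ M.Hinf := by
  have h : ∀ k : ℕ, ∀ t : ℝ, 0 < t → ∃ g, A.P hε t f = (A.G ε 1)^[k] g := by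
    intro k
    induction k with
    | zero => exact fun t _ => ⟨_, rfl⟩
    | succ k ih =>
      intro t ht
      obtain ⟨g, hg⟩ := ih (t / 2) (by positivity)
      obtain ⟨g', hg'⟩ := A.exists_P_eq_G hε one_pos (half_pos ht) g
      refine ⟨g', ?_⟩
      rw [Function.iterate_succ_apply, ← hg', ← A.P_G_iterate hε one_pos (by positivity), ← hg,
        ← A.P_add hε (by positivity) (by positivity), add_halves]
  intro k
  obtain ⟨g, hg⟩ := h k t ht
  rw [hg]
  exact H_antitone (by omega) (A.G_iterate_mem_H hε one_pos k (mem_H_zero _))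

/-- Writing f = G^k g, which is possible in H^∞, gives D^k P_s f = (D^k G^k) P_s g: a bounded
operator applied to an L²-differentiable curve. -/
lemma hasDerivWithinAt_iterate_D_P {ε : ℝ} (hε : 0 < ε) (k : ℕ) {t : ℝ} (ht : 0 ≤ t)
    {f : M.L2} (hf : f ∈ M.Hinf) :
    HasDerivWithinAt (fun s => M.D^[k] (A.P hε s f)) (M.D^[k] (A.P hε t (A.L ε 1 f)))
      (Set.Ici 0) t := by
  obtain ⟨S, hS⟩ := A.exists_clm_iterate hε one_pos k
  obtain ⟨g, hg, rfl⟩ := A.exists_G_iterate_eq hε one_pos k hf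
  have h := S.hasFDerivAt.comp_hasDerivWithinAt t (A.hasDerivWithinAt_P hε one_pos ht (hg 2))
  rw [hS, ← A.P_G_iterate hε one_pos ht, ← A.L_G_iterate hε one_pos k (hg 2)] at h
  have e : ∀ s, 0 ≤ s → M.D^[k] (A.P hε s ((A.G ε 1)^[k] g)) = S (A.P hε s g) := fun s hs => by
    rw [hS, A.P_G_iterate hε one_pos hs]
  exact h.congr (fun s hs => e s hs) (e t ht)

lemma L_iterate_mem_Hinf {ε : ℝ} (hε : 0 < ε) (n : ℕ) {f : M.L2} (hf : f ∈ M.Hinf) :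
    (A.L ε 1)^[n] f ∈ M.Hinf := by
  induction n with
  | zero => exact hf
  | succ n ih => rw [Function.iterate_succ_apply']; exact A.L_mem_Hinf hε one_pos ih

lemma P_L_iterate {ε : ℝ} (hε : 0 < ε) {t : ℝ} (ht : 0 ≤ t) (n : ℕ) {f : M.L2}
    (hf : f ∈ M.Hinf) : A.P hε t ((A.L ε 1)^[n] f) = (A.L ε 1)^[n] (A.P hε t f) := by
  induction n with
  | zero => rfl
  | succ n ih =>
    rw [Function.iterate_succ_apply', Function.iterate_succ_apply',
      A.P_L hε one_pos ht (A.L_iterate_mem_Hinf hε n hf 2), ih]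

lemma smoothOn_Ici_P {ε : ℝ} (hε : 0 < ε) {f : M.L2} (hf : f ∈ M.Hinf) :
    M.SmoothOn (Set.Ici 0) (fun t => A.P hε t f) := by
  refine ⟨fun n t => A.P hε t ((A.L ε 1)^[n] f), fun t _ => rfl, fun n t ht => ?_⟩
  have hn := A.L_iterate_mem_Hinf hε n hf
  refine ⟨A.P_mem_Hinf hε ht hn, fun k => ?_⟩
  simp only [Function.iterate_succ_apply']
  exact A.hasDerivWithinAt_iterate_D_P hε k ht hn

/-- Near t > 0 one has P_s f = P_{s − t/2} g with g = P_{t/2} f already in H^∞, which reduces the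
claim to the case of smooth initial data. -/
lemma smoothOn_Ioi_P {ε : ℝ} (hε : 0 < ε) (f : M.L2) :
    M.SmoothOn (Set.Ioi 0) (fun t => A.P hε t f) := by
  refine ⟨fun n t => (A.L ε 1)^[n] (A.P hε t f), fun t _ => rfl, fun n t ht => ?_⟩
  have ht0 : 0 < t := ht
  refine ⟨A.L_iterate_mem_Hinf hε n (A.P_mem_Hinf_of_pos hε ht f), fun k => ?_⟩
  set g := A.P hε (t / 2) f with hg
  have hgi : g ∈ M.Hinf := A.P_mem_Hinf_of_pos hε (half_pos ht0) f
  have e : ∀ (n : ℕ) (s : ℝ), t / 2 ≤ s →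
      (A.L ε 1)^[n] (A.P hε s f) = A.P hε (s - t / 2) ((A.L ε 1)^[n] g) := by
    intro n s hs
    rw [A.P_L_iterate hε (sub_nonneg.2 hs) n hgi, hg,
      ← A.P_add hε (sub_nonneg.2 hs) (half_pos ht0).le, sub_add_cancel]
  have h1 := (A.hasDerivWithinAt_iterate_D_P hε k (sub_nonneg.2 (half_le_self ht0.le))
    (A.L_iterate_mem_Hinf hε n hgi)).hasDerivAt (Ici_mem_nhds (by linarith))
  rw [← Function.iterate_succ_apply' (A.L ε 1) n g, ← e _ t (half_le_self ht0.le)] at h1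
  have h2 := (h1.comp_sub_const t (t / 2)).congr_of_eventuallyEq
    (f₁ := fun s => M.D^[k] ((A.L ε 1)^[n] (A.P hε s f))) (by
      filter_upwards [Ioi_mem_nhds (half_lt_self ht0)] with s hs
      rw [e n s (le_of_lt hs)])
  exact h2.hasDerivWithinAt

lemma P_nonneg {ε : ℝ} (hε : 0 < ε) {t : ℝ} (ht : 0 ≤ t) {f : M.L2} (hf : 0 ≤ f) :
    0 ≤ A.P hε t f := by
  refine A.mulOp_expV_nonneg 1 ?_
  refine (A.resolventFamily_conjG hε).sg_mem_cone (K := {f : M.L2 | 0 ≤ f}) isClosed_Ici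
    (le_refl (0 : M.L2)) (fun x hx y hy => add_nonneg (α := M.L2) hx hy) (fun c hc x hx => ?_)
    (fun a ha x hx => ?_) ht (A.mulOp_expV_nonneg (-1) hf)
  · refine (Lp.coeFn_nonneg _).1 ?_
    filter_upwards [Lp.coeFn_smul c x, (Lp.coeFn_nonneg x).2 hx] with ω h1 h2
    rw [h1]
    exact mul_nonneg hc h2
  · rw [conjG, dif_pos ha]
    exact A.mulOp_expV_nonneg _ (A.G_nonneg hε ha (A.mulOp_expV_nonneg _ hx))

lemma P_const {ε : ℝ} (hε : 0 < ε) {t : ℝ} (ht : 0 ≤ t) (c : ℝ) :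
    A.P hε t (Lp.const 2 M.μ c) = Lp.const 2 M.μ c := by
  rw [P_apply, ResolventFamily.sg_of_fixed _ (fun a ha => ?_) ht, A.expV_mulOp_cancel 1]
  rw [A.conjG_mulOp hε ha, A.G_const hε ha, map_smul]

lemma P_mem_Icc {ε : ℝ} (hε : 0 < ε) {t : ℝ} (ht : 0 ≤ t) {f : M.L2}
    (hf : ∀ᵐ ω ∂M.μ, 0 ≤ f ω ∧ f ω ≤ 1) :
    ∀ᵐ ω ∂M.μ, 0 ≤ (A.P hε t f) ω ∧ (A.P hε t f) ω ≤ 1 := by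
  have h1 : 0 ≤ f := (Lp.coeFn_nonneg _).1 (hf.mono fun ω h => h.1)
  have h2 : 0 ≤ Lp.const 2 M.μ (1:ℝ) - f := by
    refine (Lp.coeFn_nonneg _).1 ?_
    filter_upwards [hf, Lp.coeFn_sub (Lp.const 2 M.μ (1:ℝ)) f, Lp.coeFn_const 2 M.μ (1:ℝ)]
      with ω h1 h2 h3
    rw [h2, Pi.sub_apply, h3]
    simpa using h1.2
  have h3 := A.P_nonneg hε ht h2
  rw [map_sub, A.P_const hε ht] at h3
  filter_upwards [(Lp.coeFn_nonneg _).2 (A.P_nonneg hε ht h1), (Lp.coeFn_nonneg _).2 h3,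
    Lp.coeFn_sub (Lp.const 2 M.μ (1:ℝ)) (A.P hε t f), Lp.coeFn_const 2 M.μ (1:ℝ)]
    with ω h4 h5 h6 h7
  rw [h6, Pi.sub_apply, h7] at h5
  exact ⟨h4, by simpa using h5⟩

end Semigroup

end Coefficients

end

/-! ### Assembly of the theorem. -/

theorem proposition3p1 {Ω : Type*} [MeasurableSpace Ω] (M : RandomMedium Ω) (A : Coefficients M)
    (ε : ℝ) (hε : 0 < ε) :
    -- `G_λ^ε` is well defined by the weak resolvent equation, and one-to-one
    (∀ lam : ℝ, 0 < lam →
      (∀ f u, A.IsResolventSolution ε lam f u ↔ u = A.G ε lam f) ∧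
      Function.Injective (A.G ε lam)) ∧
    -- regularity of the resolvent and domains of the powers of `L^ε`
    (∀ lam : ℝ, 0 < lam →
      (∀ f, A.G ε lam f ∈ M.H 2) ∧
      (∀ m : ℕ, 1 ≤ m → ∀ f ∈ M.H m, A.G ε lam f ∈ M.H (m + 2)) ∧
      (∀ m : ℕ, powDomain (A.domL ε lam) (A.L ε lam) m = M.H (2 * m))) ∧
    -- `L^ε` is densely defined and equal to its adjoint for `(·, ·)_π`
    (∀ lam : ℝ, 0 < lam →
      Dense (A.domL ε lam) ∧
      ∀ u w : M.L2, (u ∈ A.domL ε lam ∧ A.L ε lam u = w) ↔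
        ∀ v ∈ A.domL ε lam, A.innerPi u (A.L ε lam v) = A.innerPi w v) ∧
    ∃ P : ℝ → M.L2 →L[ℝ] M.L2,
      -- strongly continuous contraction semigroup of self-adjoint operators
      M.IsSemigroup P ∧
      (∀ t, 0 ≤ t → ∀ f, A.normPi (P t f) ≤ A.normPi f) ∧
      (∀ t, 0 ≤ t → ∀ f g, A.innerPi (P t f) g = A.innerPi f (P t g)) ∧
      -- its generator is `L^ε`
      (∀ lam : ℝ, 0 < lam → ∀ u w : M.L2,
        Tendsto (fun t : ℝ => t⁻¹ • (P t u - u)) (𝓝[>] 0) (𝓝 w) ↔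
          u ∈ A.domL ε lam ∧ A.L ε lam u = w) ∧
      -- smoothness
      (∀ f : M.L2, ContinuousOn (fun t => P t f) (Set.Ici 0) ∧
        M.SmoothOn (Set.Ioi 0) (fun t => P t f)) ∧
      (∀ f ∈ M.Hinf, M.SmoothOn (Set.Ici 0) (fun t => P t f)) ∧
      -- sub-Markov property
      (∀ f : M.L2, (∀ᵐ ω ∂M.μ, 0 ≤ f ω ∧ f ω ≤ 1) →
        ∀ t, 0 ≤ t → ∀ᵐ ω ∂M.μ, 0 ≤ (P t f) ω ∧ (P t f) ω ≤ 1) ∧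
      -- action on `L^∞(Ω)`
      (∀ t, 0 ≤ t → ∃ Q : Lp ℝ ⊤ M.μ →L[ℝ] Lp ℝ ⊤ M.μ,
        (∀ (f : Lp ℝ ⊤ M.μ) (g : M.L2), f =ᵐ[M.μ] g → Q f =ᵐ[M.μ] P t g) ∧ ‖Q‖ = 1) ∧
      (∀ lam : ℝ, 0 < lam → ∃ R : Lp ℝ ⊤ M.μ →L[ℝ] Lp ℝ ⊤ M.μ,
        (∀ (f : Lp ℝ ⊤ M.μ) (g : M.L2), f =ᵐ[M.μ] g → R f =ᵐ[M.μ] A.G ε lam g) ∧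
          ‖R‖ = 1 / lam) := by
  refine ⟨fun lam hlam => ⟨A.isResolventSolution_iff_eq_G hε hlam, A.G_injective hε hlam⟩,
    fun lam hlam => ⟨fun f => A.G_mem_H hε hlam (RandomMedium.mem_H_zero f),
      fun m _ f hf => A.G_mem_H hε hlam hf, A.powDomain_L hε hlam⟩,
    fun lam hlam => ⟨?_, A.selfAdjoint_L hε hlam⟩,
    A.P hε, A.isSemigroup_P hε, fun t ht f => A.normPi_P_le hε ht f,
    fun t ht f g => A.innerPi_P_left hε ht f g, fun lam hlam => A.tendsto_P_iff hε hlam,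
    fun f => ⟨(A.isSemigroup_P hε).continuousOn f, A.smoothOn_Ioi_P hε f⟩,
    fun f hf => A.smoothOn_Ici_P hε hf, fun f hf t ht => A.P_mem_Icc hε ht hf,
    fun t ht => ?_, fun lam hlam => ?_⟩
  · rw [A.domL_eq hε hlam]
    exact RandomMedium.dense_H_two
  · exact RandomMedium.exists_linfty_clm zero_le_one (fun f hf => A.P_nonneg hε ht hf)
      (fun c => by rw [A.P_const hε ht, one_smul])
  · rw [one_div]
    exact RandomMedium.exists_linfty_clm (S := A.Gl hε hlam) (inv_nonneg.2 hlam.le)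
      (fun f hf => A.G_nonneg hε hlam hf) (A.G_const hε hlam)
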